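/- Consider one time slot of a planar wireless network. The nodes form a homogeneous Poisson point process of density $\lambda>0$; each node transmits, independently of everything else, with probability $p\in(0,1)$, and is otherwise a receiver. A typical emitter located at $x$, in addition to the nodes of the process, has a packet for a destination $D\neq x$. Let $L\ge 1$ be the number of receive antennas, $\alpha>2$ the path-loss exponent and $\beta>0$ the capture threshold. Under Rayleigh fading, all channel vectors are independent standard complex normal vectors in $\mathbb C^L$, independent of the locations and of the transmission decisions. Noise is ignored. With optimum combining, the signal-to-interference ratio of a link from $x$ to a receiver at $y$ is $$\mathrm{SINR}_{x,y}=|x-y|^{-\alpha}\,h_0^{*}R^{-1}h_0,\qquad R=\sum_{i}|X_i-y|^{-\alpha}h_ih_i^{*},$$ where $h_0$ is the channel vector of the link, the sum runs over the transmitting nodes $X_i$ of the process, and $h_i$ is the channel vector from $X_i$ to the receiver. Let $P_s(x,y)=P(\mathrm{SINR}_{x,y}\ge\beta)$ for fixed $y$ (by invariance it depends only on $|x-y|$). For a location $y$ let $\theta_y\in[0,\pi]$ be the angle at $x$ between the directions of $D$ and of $y$. Under NFP routing (nearest receiver with forward progress), the next relay $Y^*$ is the receiver nearest to $x$ among those with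 $\theta\le\pi/2$. Then $Y^*$ almost surely exists and is unique, the random variable $|Y^*-x|\cos\theta_{Y^*}\,P_s(x,Y^*)$ is integrable, and its expectation, the expected progress, is $$\mathrm{prog}_{NFP}(\lambda,p)=\mathrm E\bigl[|Y^*-x|\cos\theta_{Y^*}\,P_s(x,Y^*)\bigr]=\frac1{\sqrt\lambda}\sum_{k=0}^{L-1}\frac{\Gamma(k+3/2)\,(\beta^{2/\alpha}\Delta)^k\,p^k(1-p)}{k!\,\bigl((1-p)\pi/2+\Delta\beta^{2/\alpha}p\bigr)^{k+3/2}},$$ where $\Delta=\frac{2\pi}{\alpha}\Gamma(2/\alpha)\Gamma(1-2/\alpha)$. -/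

import Mathlib

open MeasureTheory ProbabilityTheory EuclideanGeometry

noncomputable section

/-- The Euclidean plane. -/
abbrev Plane : Type := EuclideanSpace ℝ (Fin 2)

/-- The number of points of the random sequence `X` that fall in `A`. -/
def pointCount {Ω : Type*} (X : ℕ → Ω → Plane) (A : Set Plane) (ω : Ω) : ℕ∞ :=
  Set.encard {i : ℕ | X i ω ∈ A}

/-- `X` enumerates the points of a homogeneous Poisson point process with `lam` points per unit
area: counts in sets of finite area are Poisson, and counts in disjoint sets are independent. -/
structure IsPoissonPointProcess {Ω : Type*} [MeasurableSpace Ω] (μ : Measure Ω)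
    (X : ℕ → Ω → Plane) (lam : ℝ) : Prop where
  measurable : ∀ i, Measurable (X i)
  count_law : ∀ A : Set Plane, MeasurableSet A → volume A ≠ ⊤ →
    μ.map (pointCount X A) =
      (poissonMeasure (Real.toNNReal (lam * volume.real A))).map (Nat.cast : ℕ → ℕ∞)
  count_indep : ∀ (n : ℕ) (A : Fin n → Set Plane), (∀ j, MeasurableSet (A j)) →
    (∀ j, volume (A j) ≠ ⊤) → (∀ j k, j ≠ k → Disjoint (A j) (A k)) →
    iIndepFun (fun j => pointCount X (A j)) μ

/-- The standard complex normal law: independent real and imaginary parts, each centred Gaussian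
of variance `1 / 2`, so that the mean of `‖z‖ ^ 2` is `1`. -/
def complexNormal : Measure ℂ :=
  ((gaussianReal 0 (1 / 2)).prod (gaussianReal 0 (1 / 2))).map
    (fun z : ℝ × ℝ => (z.1 : ℂ) + (z.2 : ℂ) * Complex.I)

/-- The law of a Rayleigh channel vector to an array of `L` antennas. -/
def channelLaw (L : ℕ) : Measure (Fin L → ℂ) := Measure.pi (fun _ => complexNormal)

/-- The random data of one time slot of the network. -/
structure AlohaNetwork (Ω : Type*) (L : ℕ) where
  /-- the location of node `i` -/
  X : ℕ → Ω → Plane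
  /-- whether node `i` transmits in the slot -/
  T : ℕ → Ω → Bool
  /-- the channel vector from node `i` to the receiver of the link under study -/
  h : ℕ → Ω → (Fin L → ℂ)
  /-- the channel vector from the emitter of that link to its receiver -/
  h₀ : Ω → (Fin L → ℂ)

/-- Slotted Aloha with transmission probability `p` on a Poisson field of nodes of density `lam`,
under Rayleigh fading: each node transmits independently with probability `p`, channel vectors are
independent and complex normal, and locations, transmission decisions, interfering channels and the
channel of the link are independent of each other. -/
structure AlohaNetwork.HasLaw {Ω : Type*} [MeasurableSpace Ω] {L : ℕ} (N : AlohaNetwork Ω L)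
    (μ : Measure Ω) (lam p : ℝ) : Prop where
  poisson : IsPoissonPointProcess μ N.X lam
  measurable_T : ∀ i, Measurable (N.T i)
  transmit_prob : ∀ i, μ {ω | N.T i ω = true} = ENNReal.ofReal p
  indep_T : iIndepFun N.T μ
  measurable_h : ∀ i, Measurable (N.h i)
  law_h : ∀ i, μ.map (N.h i) = channelLaw L
  indep_h : iIndepFun N.h μ
  measurable_h₀ : Measurable N.h₀
  law_h₀ : μ.map N.h₀ = channelLaw L
  indep_X_rest : IndepFun (fun ω i => N.X i ω)
    (fun ω => ((fun i => N.T i ω), (fun i => N.h i ω), N.h₀ ω)) μ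
  indep_T_rest : IndepFun (fun ω i => N.T i ω) (fun ω => ((fun i => N.h i ω), N.h₀ ω)) μ
  indep_h_h₀ : IndepFun (fun ω i => N.h i ω) N.h₀ μ

namespace AlohaNetwork

variable {Ω : Type*} {L : ℕ} (N : AlohaNetwork Ω L)

/-- The set of receivers: the locations of the nodes that do not transmit. -/
def receivers (ω : Ω) : Set Plane := {y | ∃ i, N.T i ω = false ∧ N.X i ω = y}

/-- The interference covariance matrix at a receiver located at `y`, noise being ignored. -/
def covariance (α : ℝ) (y : Plane) (ω : Ω) : Matrix (Fin L) (Fin L) ℂ :=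
  ∑' i, if N.T i ω = true then
    (dist (N.X i ω) y ^ (-α)) • Matrix.vecMulVec (N.h i ω) (star (N.h i ω)) else 0

/-- The signal-to-interference ratio after optimum combining, for an emitter at `x` and a receiver
at `y`; the emitter is not one of the interferers. -/
def sinr (α : ℝ) (x y : Plane) (ω : Ω) : ℝ :=
  dist x y ^ (-α) *
    (star (N.h₀ ω) ⬝ᵥ Matrix.mulVec (N.covariance α y ω)⁻¹ (N.h₀ ω)).re

/-- The probability of successful communication from `x` to `y`, with capture threshold `β`. -/
def successProb [MeasurableSpace Ω] (μ : Measure Ω) (α β : ℝ) (x y : Plane) : ℝ :=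
  μ.real {ω | β ≤ N.sinr α x y ω}

/-- `y` is a nearest receiver to `x` among those `z` whose direction from `x` makes an angle of at
most `π / 2` with the direction of the destination `D`. -/
def IsNFPRelay (x D : Plane) (ω : Ω) (y : Plane) : Prop :=
  (y ∈ N.receivers ω ∧ ∠ D x y ≤ Real.pi / 2) ∧
    ∀ z ∈ N.receivers ω, ∠ D x z ≤ Real.pi / 2 → dist x y ≤ dist x z

open Classical in
/-- The next relay selected by the emitter at `x` (the emitter itself if there is none). -/
def nfpRelay (x D : Plane) (ω : Ω) : Plane :=
  if h : ∃ y, N.IsNFPRelay x D ω y then h.choose else x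

/-- The progress toward `D` offered by the selected relay, weighted by the success probability of
a link from the emitter to the location of that relay. -/
def weightedProgress [MeasurableSpace Ω] (μ : Measure Ω) (α β : ℝ) (x D : Plane) (ω : Ω) : ℝ :=
  dist x (N.nfpRelay x D ω) * Real.cos (∠ D x (N.nfpRelay x D ω)) *
    N.successProb μ α β x (N.nfpRelay x D ω)

end AlohaNetwork

/-- The spatial contention constant `Δ`. -/
def contentionConst (α : ℝ) : ℝ :=
  2 * Real.pi / α * Real.Gamma (2 / α) * Real.Gamma (1 - 2 / α)

end

/-! ### Poisson processes: Campbell's formula, Laplace functional, independent marks -/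

section

open Filter Topology
open scoped ENNReal NNReal

/-! The success probability is evaluated at a fixed receiver position, so the mean progress is the
integral of r cos θ P_s(r) against the law of the relay. Two laws have to be found: that of the
signal-to-interference ratio and that of the relay.

Success probability. Put t = β r^α. Given the interference matrix R, the substitution h₀ =
(tR)^{1/2} v turns the outage probability into π^{-L} det(tR) ∫_{|v|<1} exp(-v* tR v) dv
(`channelLaw_real_quadForm_lt`), an expression that stays continuous at singular positive
semidefinite matrices. For finitely many interferers of powers w_i (factor t included) its mean over
the channels is explicit. The exponential tilts each Gaussian channel; the determinant expands over
injective choices of one interferer per row, so that independence factors the mean; symmetrising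
over the rows leaves a function of ρ = |v|². After radial integration the integrand is minus the
derivative in ρ of the probability that at most L - 1 independent events of odds ρ w_i occur
(`hasDerivAt_atMostProb`). Hence the mean outage is the probability that at least L interferers are
marked, a node of power w being marked with probability w / (1 + w)
(`integral_outageProb_interference`).

Marking thins the Poisson process, so the number of marked transmitters is Poisson with mean λ p ∫
t|z|^{-α} / (1 + t|z|^{-α}) dz = λ p Δ t^{2/α} = λ p Δ β^{2/α} r². This is proved with the Laplace
functional (`IsPoissonPointProcess.tendsto_integral_prod`) and convergence of generating functions;
continuity of the outage expression handles the passage to infinitely many nodes. Thus P_s(r) is the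
probability that such a Poisson variable is less than L (`HasLaw.successProb_eq`).

Relay. Receivers have density κ = λ(1 - p). The relay sits at distance r only if the half-disc of
radius r, of area π r² / 2, holds no receiver; its law has density κ exp(-κ π r² / 2) on the forward
half-plane (`HasLaw.map_nfpRelay`). In polar coordinates the cosine integrates to 2 and the k-th
Poisson term gives a Gamma integral of r^{2k+2} exp(-b r²) with b = λ((1 - p)π/2 + Δ β^{2/α} p); the
powers of λ collapse to λ^{-1/2}. -/

theorem abs_prod_sub_prod_le {ι : Type*} (s : Finset ι) (a b : ι → ℝ)
    (ha : ∀ i, a i ∈ Set.Icc (0 : ℝ) 1) (hb : ∀ i, b i ∈ Set.Icc (0 : ℝ) 1) :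
    |∏ i ∈ s, (1 - a i) - ∏ i ∈ s, (1 - b i)| ≤ ∑ i ∈ s, |a i - b i| := by
  classical
  induction s using Finset.induction_on with
  | empty => simp
  | insert j s hj ih =>
    rw [Finset.prod_insert hj, Finset.prod_insert hj, Finset.sum_insert hj]
    have h1 : |∏ i ∈ s, (1 - a i)| ≤ 1 := by
      rw [Finset.abs_prod]
      refine Finset.prod_le_one (fun i _ => abs_nonneg _) fun i _ => ?_
      rw [abs_le]; constructor <;> linarith [(ha i).1, (ha i).2]
    have h2 : |1 - b j| ≤ 1 := by
      rw [abs_le]; constructor <;> linarith [(hb j).1, (hb j).2]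
    calc |(1 - a j) * ∏ i ∈ s, (1 - a i) - (1 - b j) * ∏ i ∈ s, (1 - b i)|
        = |(b j - a j) * ∏ i ∈ s, (1 - a i)
            + (1 - b j) * (∏ i ∈ s, (1 - a i) - ∏ i ∈ s, (1 - b i))| := by ring_nf
      _ ≤ |b j - a j| * |∏ i ∈ s, (1 - a i)|
            + |1 - b j| * |∏ i ∈ s, (1 - a i) - ∏ i ∈ s, (1 - b i)| := by
          rw [← abs_mul, ← abs_mul]; exact abs_add_le _ _
      _ ≤ |b j - a j| * 1 + 1 * ∑ i ∈ s, |a i - b i| := by gcongr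
      _ = _ := by rw [abs_sub_comm]; ring

theorem prod_one_sub_mem_Icc {ι : Type*} (s : Finset ι) (a : ι → ℝ)
    (ha : ∀ i, a i ∈ Set.Icc (0 : ℝ) 1) : ∏ i ∈ s, (1 - a i) ∈ Set.Icc (0 : ℝ) 1 :=
  ⟨Finset.prod_nonneg fun i _ => by linarith [(ha i).2],
    Finset.prod_le_one (fun i _ => by linarith [(ha i).2]) fun i _ => by linarith [(ha i).1]⟩

theorem lintegral_cast_poissonMeasure (r : ℝ≥0) :
    ∫⁻ n, (n : ℝ≥0∞) ∂(poissonMeasure r) = r := by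
  rw [poissonMeasure, lintegral_sum_measure]
  simp only [lintegral_smul_measure, lintegral_dirac, smul_eq_mul]
  have h : HasSum (fun n : ℕ => Real.exp (-r) * r ^ n / n.factorial * n) r := by
    rw [← hasSum_nat_add_iff' 1]
    simp only [Finset.range_one, Finset.sum_singleton, CharP.cast_eq_zero, mul_zero, sub_zero]
    have h1 := (hasSum_one_poissonMeasure r).mul_left (r : ℝ)
    rw [mul_one] at h1
    refine h1.congr_fun fun n => ?_
    rw [Nat.factorial_succ]; push_cast; field_simp; ring
  have h2 := ENNReal.ofReal_tsum_of_nonneg (fun n => by positivity) h.summable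
  rw [h.tsum_eq, ENNReal.ofReal_coe_nnreal] at h2
  rw [h2]
  refine tsum_congr fun n => ?_
  rw [ENNReal.ofReal_mul (by positivity), ENNReal.ofReal_natCast]

theorem integral_pow_poissonMeasure (r : ℝ≥0) (s : ℝ) :
    ∫ n, s ^ n ∂(poissonMeasure r) = Real.exp (-(r * (1 - s))) := by
  rw [integral_poissonMeasure]
  have h := (NormedSpace.expSeries_div_hasSum_exp (r * s : ℝ)).mul_left (Real.exp (-r))
  rw [← Real.exp_eq_exp_ℝ, ← Real.exp_add] at h
  rw [show -((r : ℝ) * (1 - s)) = -r + r * s by ring, ← h.tsum_eq]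
  refine tsum_congr fun n => ?_
  rw [smul_eq_mul, mul_pow]; ring

section PointProcess

theorem pointCount_eq_tsum {Ω : Type*} (X : ℕ → Ω → Plane) (A : Set Plane) (ω : Ω) :
    (pointCount X A ω : ℝ≥0∞) = ∑' i, A.indicator 1 (X i ω) := by
  rw [pointCount, ← ENNReal.tsum_set_one, tsum_subtype {i | X i ω ∈ A} (fun _ => (1 : ℝ≥0∞))]
  rfl

/-- Only finitely many points meet the support of `φ`, so the partial products are eventually
constant; the limit groups the factors by the value of `φ`. -/
theorem eventually_prod_one_sub_eq {Ω : Type*} {X : ℕ → Ω → Plane} (φ : SimpleFunc Plane ℝ) {ω : Ω}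
    (hω : ∀ c ∈ φ.range.filter (· ≠ 0), pointCount X (φ ⁻¹' {c}) ω ≠ ⊤) :
    ∀ᶠ n in atTop, ∏ i ∈ Finset.range n, (1 - φ (X i ω)) =
      ∏ c ∈ φ.range.filter (· ≠ 0), (1 - c) ^ (pointCount X (φ ⁻¹' {c}) ω).toNat := by
  classical
  set s := φ.range.filter (· ≠ 0) with hs
  have hfin : {i | φ (X i ω) ≠ 0}.Finite := by
    have : {i | φ (X i ω) ≠ 0} ⊆ ⋃ c ∈ s, {i | X i ω ∈ φ ⁻¹' {c}} := by
      intro i hi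
      simp only [Set.mem_iUnion]
      exact ⟨φ (X i ω), by simpa [hs] using hi, rfl⟩
    refine Set.Finite.subset (Set.Finite.biUnion s.finite_toSet fun c hc => ?_) this
    exact Set.encard_ne_top_iff.1 (hω c hc)
  obtain ⟨N, hN⟩ := hfin.bddAbove
  filter_upwards [eventually_gt_atTop N] with n hn
  -- Each factor is spread over all nonzero values so that the two products can be exchanged.
  have h1 : ∀ i, 1 - φ (X i ω) = ∏ c ∈ s, if φ (X i ω) = c then 1 - c else 1 := by
    intro i
    rw [Finset.prod_ite_eq]
    split_ifs with h
    · rfl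
    · have : φ (X i ω) = 0 := by simpa [hs] using h
      simp [this]
  simp_rw [h1]
  rw [Finset.prod_comm]
  refine Finset.prod_congr rfl fun c hc => ?_
  rw [Finset.prod_ite, Finset.prod_const_one, mul_one, Finset.prod_const]
  congr 1
  have : {i | X i ω ∈ φ ⁻¹' {c}} = ((Finset.range n).filter fun i => φ (X i ω) = c : Finset ℕ) := by
    ext i
    simp only [Set.mem_preimage, Set.mem_singleton_iff, Finset.coe_filter, Finset.mem_range]
    refine ⟨fun hi => ⟨lt_of_le_of_lt (hN ?_) hn, hi⟩, fun hi => hi.2⟩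
    have h0 : c ≠ 0 := (Finset.mem_filter.1 hc).2
    change φ (X i ω) ≠ 0
    rw [show φ (X i ω) = c from hi]; exact h0
  rw [pointCount, this, Set.encard_coe_eq_coe_finsetCard, ENat.toNat_natCast]

variable {Ω : Type*} [MeasurableSpace Ω] {μ : Measure Ω} {X : ℕ → Ω → Plane} {lam : ℝ}

theorem measurable_pointCount (hX : ∀ i, Measurable (X i)) {A : Set Plane}
    (hA : MeasurableSet A) : Measurable (pointCount X A) :=
  measurable_encard.comp (measurable_set_iff.2 fun i =>
    measurableSet_setOfPred.1 (hX i hA))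

namespace IsPoissonPointProcess

theorem ae_pointCount_ne_top (h : IsPoissonPointProcess μ X lam) {A : Set Plane}
    (hA : MeasurableSet A) (hA' : volume A ≠ ⊤) : ∀ᵐ ω ∂μ, pointCount X A ω ≠ ⊤ := by
  have h1 := h.count_law A hA hA'
  have h2 : ∀ᵐ n ∂(μ.map (pointCount X A)), n ≠ ⊤ := by
    rw [h1, ae_map_iff (by fun_prop) (MeasurableSet.of_discrete)]
    exact .of_forall fun n => ENat.natCast_ne_top n
  exact ae_of_ae_map (measurable_pointCount h.measurable hA).aemeasurable h2

theorem lintegral_pointCount (h : IsPoissonPointProcess μ X lam) (hlam : 0 ≤ lam) {A : Set Plane}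
    (hA : MeasurableSet A) (hA' : volume A ≠ ⊤) :
    ∫⁻ ω, (pointCount X A ω : ℝ≥0∞) ∂μ = ENNReal.ofReal lam * volume A := by
  rw [← lintegral_map (f := fun n : ℕ∞ => (n : ℝ≥0∞)) (by fun_prop)
    (measurable_pointCount h.measurable hA), h.count_law A hA hA',
    lintegral_map (by fun_prop) (by fun_prop)]
  simp only [ENat.toENNReal_coe]
  rw [lintegral_cast_poissonMeasure, ← ENNReal.ofReal, ENNReal.ofReal_mul hlam,
    measureReal_def, ENNReal.ofReal_toReal hA']

/-- Campbell's formula as an identity of measures. Mean Poisson counts give it on sets of finite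
area, and balls exhaust the plane. -/
theorem sum_map_eq (h : IsPoissonPointProcess μ X lam) (hlam : 0 ≤ lam) :
    Measure.sum (fun i => μ.map (X i)) = ENNReal.ofReal lam • (volume : Measure Plane) := by
  have key : ∀ A : Set Plane, MeasurableSet A → volume A ≠ ⊤ →
      Measure.sum (fun i => μ.map (X i)) A = (ENNReal.ofReal lam • (volume : Measure Plane)) A := by
    intro A hA hA'
    rw [Measure.smul_apply, smul_eq_mul, ← h.lintegral_pointCount hlam hA hA',
      Measure.sum_apply _ hA]
    simp_rw [pointCount_eq_tsum]
    have hm (i) : Measurable fun ω => A.indicator (1 : Plane → ℝ≥0∞) (X i ω) :=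
      (measurable_one.indicator hA).comp (h.measurable i)
    rw [lintegral_tsum fun i => (hm i).aemeasurable]
    refine tsum_congr fun i => ?_
    rw [Measure.map_apply (h.measurable i) hA, ← lintegral_indicator_one (h.measurable i hA)]
    rfl
  ext A hA
  have hU : A = ⋃ n : ℕ, A ∩ Metric.closedBall 0 n := by
    rw [← Set.inter_iUnion, Metric.iUnion_closedBall_nat, Set.inter_univ]
  have hm : Monotone fun n : ℕ => A ∩ Metric.closedBall (0 : Plane) n := fun a b hab =>
    Set.inter_subset_inter_right _ (Metric.closedBall_subset_closedBall (by exact_mod_cast hab))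
  rw [hU, hm.measure_iUnion, hm.measure_iUnion]
  refine iSup_congr fun n => key _ (hA.inter measurableSet_closedBall) ?_
  exact ((measure_mono Set.inter_subset_right).trans_lt measure_closedBall_lt_top).ne

theorem tsum_lintegral (h : IsPoissonPointProcess μ X lam) (hlam : 0 ≤ lam) {f : Plane → ℝ≥0∞}
    (hf : Measurable f) :
    ∑' i, ∫⁻ ω, f (X i ω) ∂μ = ENNReal.ofReal lam * ∫⁻ z, f z := by
  rw [← smul_eq_mul, ← lintegral_smul_measure, ← h.sum_map_eq hlam, lintegral_sum_measure]
  exact tsum_congr fun i => (lintegral_map hf (h.measurable i)).symm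

theorem integral_pow_pointCount (h : IsPoissonPointProcess μ X lam) (hlam : 0 ≤ lam)
    {A : Set Plane} (hA : MeasurableSet A) (hA' : volume A ≠ ⊤) (s : ℝ) :
    ∫ ω, s ^ (pointCount X A ω).toNat ∂μ = Real.exp (-(lam * volume.real A * (1 - s))) := by
  rw [← integral_map (f := fun n : ℕ∞ => s ^ n.toNat)
    (measurable_pointCount h.measurable hA).aemeasurable (by fun_prop), h.count_law A hA hA',
    integral_map (by fun_prop) (by fun_prop)]
  simp only [ENat.toNat_natCast]
  rw [integral_pow_poissonMeasure, Real.coe_toNNReal _ (by positivity)]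

theorem iIndepFun_pointCount (h : IsPoissonPointProcess μ X lam) {ι : Type*} [Fintype ι]
    (A : ι → Set Plane) (hA : ∀ j, MeasurableSet (A j)) (hA' : ∀ j, volume (A j) ≠ ⊤)
    (hd : ∀ j k, j ≠ k → Disjoint (A j) (A k)) : iIndepFun (fun j => pointCount X (A j)) μ := by
  let e := Fintype.equivFin ι
  have h1 := h.count_indep _ (fun j => A (e.symm j)) (fun j => hA _) (fun j => hA' _)
    (fun j k hjk => hd _ _ (e.symm.injective.ne hjk))
  have h2 := h1.precomp e.injective
  simpa [Function.comp_def] using h2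

/-- Counts on the level sets are independent, so the limit is a product of Poisson generating
functions evaluated at `1 - c`; their exponents add up to the integral of `φ`. -/
theorem tendsto_integral_prod_simpleFunc [IsProbabilityMeasure μ]
    (h : IsPoissonPointProcess μ X lam) (hlam : 0 ≤ lam)
    (φ : SimpleFunc Plane ℝ) (hφ : ∀ z, φ z ∈ Set.Icc (0 : ℝ) 1) (hi : Integrable φ) :
    Tendsto (fun n => ∫ ω, ∏ i ∈ Finset.range n, (1 - φ (X i ω)) ∂μ) atTop
      (𝓝 (Real.exp (-(lam * ∫ z, φ z)))) := by
  classical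
  set s := φ.range.filter (· ≠ 0) with hs
  have hvol : ∀ c ∈ s, volume (φ ⁻¹' {c}) ≠ ⊤ := fun c hc =>
    (SimpleFunc.measure_preimage_lt_top_of_integrable φ hi (Finset.mem_filter.1 hc).2).ne
  have hlim : Real.exp (-(lam * ∫ z, φ z)) =
      ∫ ω, ∏ c ∈ s, (1 - c) ^ (pointCount X (φ ⁻¹' {c}) ω).toNat ∂μ := by
    have hind := h.iIndepFun_pointCount (fun c : s => φ ⁻¹' {(c : ℝ)})
      (fun c => φ.measurableSet_preimage _) (fun c => hvol c c.2)
      (fun j k hjk => Disjoint.preimage _ (by simpa using fun hh => hjk (Subtype.ext hh)))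
    have h2 := hind.integral_fun_prod_comp
      (f := fun (c : s) (n : ℕ∞) => (1 - (c : ℝ)) ^ n.toNat)
      (fun c => (measurable_pointCount h.measurable (φ.measurableSet_preimage _)).aemeasurable)
      (fun c => by fun_prop)
    have h3 : ∀ ω, ∏ c ∈ s, (1 - c) ^ (pointCount X (φ ⁻¹' {c}) ω).toNat =
        ∏ c : s, (1 - (c : ℝ)) ^ (pointCount X (φ ⁻¹' {(c : ℝ)}) ω).toNat := fun ω =>
      (Finset.prod_coe_sort s fun c => (1 - c) ^ (pointCount X (φ ⁻¹' {c}) ω).toNat).symm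
    simp_rw [h3]
    rw [h2]
    simp_rw [h.integral_pow_pointCount hlam (φ.measurableSet_preimage _) (hvol _ (Subtype.prop _))]
    rw [← Real.exp_sum, ← SimpleFunc.integral_eq_integral φ hi, SimpleFunc.integral_eq_sum_filter, ← hs,
      Finset.mul_sum, ← Finset.sum_neg_distrib, ← Finset.sum_coe_sort]
    congr 1
    refine Finset.sum_congr rfl fun c _ => ?_
    simp only [sub_sub_cancel, smul_eq_mul]; ring
  rw [hlim]
  refine tendsto_integral_of_dominated_convergence (fun _ => 1) (fun n => ?_) (by simp)
    (fun n => ?_) ?_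
  · refine (Finset.measurable_prod _ fun i _ => ?_).aestronglyMeasurable
    exact measurable_const.sub (φ.measurable.comp (h.measurable i))
  · refine .of_forall fun ω => ?_
    have := prod_one_sub_mem_Icc (Finset.range n) (fun i => φ (X i ω)) (fun i => hφ _)
    rw [Real.norm_of_nonneg this.1]; exact this.2
  · have : ∀ᵐ ω ∂μ, ∀ c : s, pointCount X (φ ⁻¹' {(c : ℝ)}) ω ≠ ⊤ := by
      rw [ae_all_iff]
      exact fun c => h.ae_pointCount_ne_top (φ.measurableSet_preimage _) (hvol c c.2)
    filter_upwards [this] with ω hω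
    exact tendsto_const_nhds.congr' ((eventually_prod_one_sub_eq φ fun c hc => hω ⟨c, hc⟩).mono
      fun n hn => hn.symm)

/-- The Laplace functional of a Poisson point process. -/
theorem tendsto_integral_prod [IsProbabilityMeasure μ]
    (h : IsPoissonPointProcess μ X lam) (hlam : 0 ≤ lam) {g : Plane → ℝ} (hg : Measurable g)
    (hg01 : ∀ z, g z ∈ Set.Icc (0 : ℝ) 1) (hi : Integrable g) :
    Tendsto (fun n => ∫ ω, ∏ i ∈ Finset.range n, (1 - g (X i ω)) ∂μ) atTop
      (𝓝 (Real.exp (-(lam * ∫ z, g z)))) := by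
  have h0 : (0 : ℝ) ∈ Set.Icc (0 : ℝ) 1 := by simp
  let φ : ℕ → SimpleFunc Plane ℝ := SimpleFunc.approxOn g hg (Set.Icc 0 1) 0 h0
  have hφ : ∀ m z, φ m z ∈ Set.Icc (0 : ℝ) 1 := fun m z => SimpleFunc.approxOn_mem hg h0 m z
  have hφi : ∀ m, Integrable (φ m) := fun m =>
    SimpleFunc.integrable_approxOn hg hi h0 (by simp) m
  have hL1 : Tendsto (fun m => ∫⁻ z, ‖φ m z - g z‖ₑ) atTop (𝓝 0) := by
    refine SimpleFunc.tendsto_approxOn_L1_enorm hg h0 (.of_forall fun z => ?_) ?_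
    · rw [isClosed_Icc.closure_eq]; exact hg01 z
    · simpa using hi.2
  have hL1' : Tendsto (fun m => lam * ∫ z, |φ m z - g z|) atTop (𝓝 0) := by
    rw [← mul_zero lam]
    refine Tendsto.const_mul _ ?_
    have := (ENNReal.tendsto_toReal ENNReal.zero_ne_top).comp hL1
    refine this.congr fun m => ?_
    exact (integral_norm_eq_lintegral_enorm ((hφi m).sub hi).1).symm
  have hint : Tendsto (fun m => Real.exp (-(lam * ∫ z, φ m z))) atTop
      (𝓝 (Real.exp (-(lam * ∫ z, g z)))) := by
    refine (Real.continuous_exp.tendsto _).comp (Tendsto.neg (Tendsto.const_mul _ ?_))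
    exact tendsto_integral_of_L1 _ hi.1 (.of_forall hφi) hL1
  have hmeas : ∀ (f : Plane → ℝ), Measurable f → (∀ z, f z ∈ Set.Icc (0 : ℝ) 1) → ∀ n,
      Integrable (fun ω => ∏ i ∈ Finset.range n, (1 - f (X i ω))) μ := by
    intro f hf hf01 n
    refine Integrable.of_bound (C := 1) (Finset.measurable_prod _ fun i _ =>
      measurable_const.sub (hf.comp (h.measurable i))).aestronglyMeasurable (.of_forall fun ω => ?_)
    have := prod_one_sub_mem_Icc (Finset.range n) (fun i => f (X i ω)) (fun i => hf01 _)
    rw [Real.norm_of_nonneg this.1]; exact this.2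
  -- Telescoping the products and applying Campbell's formula gives a bound by the L¹ distance that
  -- is uniform in `n`; this permits interchanging the limits in `n` and `m`.
  have hdiff : ∀ n m, |∫ ω, ∏ i ∈ Finset.range n, (1 - g (X i ω)) ∂μ -
      ∫ ω, ∏ i ∈ Finset.range n, (1 - φ m (X i ω)) ∂μ| ≤ lam * ∫ z, |φ m z - g z| := by
    intro n m
    have hd : Measurable fun z => |φ m z - g z| := ((φ m).measurable.sub hg).abs
    have hb : ∀ i, Integrable (fun ω => |φ m (X i ω) - g (X i ω)|) μ := fun i => by
      refine Integrable.of_bound (C := 1) (hd.comp (h.measurable i)).aestronglyMeasurable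
        (.of_forall fun ω => ?_)
      have h1 := hφ m (X i ω)
      have h2 := hg01 (X i ω)
      rw [Real.norm_eq_abs, abs_abs, abs_le]
      constructor <;> linarith [h1.1, h1.2, h2.1, h2.2]
    rw [← integral_sub (hmeas g hg hg01 n) (hmeas _ (φ m).measurable (hφ m) n)]
    refine (abs_integral_le_integral_abs).trans ?_
    calc ∫ ω, |∏ i ∈ Finset.range n, (1 - g (X i ω)) -
            ∏ i ∈ Finset.range n, (1 - φ m (X i ω))| ∂μ
        ≤ ∫ ω, ∑ i ∈ Finset.range n, |φ m (X i ω) - g (X i ω)| ∂μ := by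
          refine integral_mono (((hmeas g hg hg01 n).sub
            (hmeas _ (φ m).measurable (hφ m) n)).abs) (integrable_finsetSum _ fun i _ => hb i)
            fun ω => ?_
          rw [abs_sub_comm]
          exact abs_prod_sub_prod_le _ _ _ (fun i => hφ m _) (fun i => hg01 _)
      _ = ∑ i ∈ Finset.range n, ∫ ω, |φ m (X i ω) - g (X i ω)| ∂μ :=
          integral_finsetSum _ fun i _ => hb i
      _ ≤ lam * ∫ z, |φ m z - g z| := by
          have h1 := h.tsum_lintegral hlam (f := fun z => ENNReal.ofReal |φ m z - g z|)
            hd.ennreal_ofReal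
          have hii : Integrable fun z => |φ m z - g z| := ((hφi m).sub hi).abs
          rw [← ENNReal.ofReal_le_ofReal_iff (mul_nonneg hlam (integral_nonneg fun _ => abs_nonneg _)),
            ENNReal.ofReal_mul hlam,
            ofReal_integral_eq_lintegral_ofReal hii (.of_forall fun _ => abs_nonneg _), ← h1,
            ENNReal.ofReal_sum_of_nonneg fun i _ => integral_nonneg fun _ => abs_nonneg _]
          refine le_trans (le_of_eq (Finset.sum_congr rfl fun i _ => ?_))
            (ENNReal.sum_le_tsum (Finset.range n))
          exact ofReal_integral_eq_lintegral_ofReal (hb i) (.of_forall fun _ => abs_nonneg _)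
  rw [Metric.tendsto_atTop]
  intro ε hε
  obtain ⟨m, hm1, hm2⟩ := ((hL1'.eventually (gt_mem_nhds (show (0 : ℝ) < ε / 3 by positivity))).and
    (Metric.tendsto_nhds.1 hint (ε / 3) (by positivity))).exists
  obtain ⟨N, hN⟩ := Metric.tendsto_atTop.1
    (h.tendsto_integral_prod_simpleFunc hlam (φ m) (hφ m) (hφi m)) (ε / 3) (by positivity)
  refine ⟨N, fun n hn => ?_⟩
  have h1 := hdiff n m
  have h2 := hN n hn
  rw [Real.dist_eq] at *
  rw [abs_lt] at *
  rw [abs_le] at h1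
  constructor <;> linarith [h1.1, h1.2, h2.1, h2.2, hm2.1, hm2.2]

end IsPoissonPointProcess

/-- Integrating out the independent transmission decisions first replaces `g` by `q * g`, so
thinning reduces to the Laplace functional. The value `true` of `b` serves the interferers, `false`
the receivers. -/
theorem AlohaNetwork.HasLaw.tendsto_integral_prod_marked [IsProbabilityMeasure μ] {L : ℕ}
    {N : AlohaNetwork Ω L} {p : ℝ} (h : N.HasLaw μ lam p) (hlam : 0 ≤ lam) (b : Bool) {q : ℝ}
    (hq : ∀ i, μ.real {ω | N.T i ω = b} = q) {g : Plane → ℝ} (hg : Measurable g)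
    (hg01 : ∀ z, g z ∈ Set.Icc (0 : ℝ) 1) (hi : Integrable g) :
    Tendsto (fun n => ∫ ω, ∏ i ∈ Finset.range n,
      (1 - if N.T i ω = b then g (N.X i ω) else 0) ∂μ) atTop
      (𝓝 (Real.exp (-(lam * (q * ∫ z, g z))))) := by
  have hq01 : q ∈ Set.Icc (0 : ℝ) 1 := by
    rw [← hq 0]; exact ⟨measureReal_nonneg, measureReal_le_one⟩
  rw [← integral_const_mul]
  refine (h.poisson.tendsto_integral_prod hlam (g := fun z => q * g z) (hg.const_mul q)
    (fun z => ⟨mul_nonneg hq01.1 (hg01 z).1, mul_le_one₀ hq01.2 (hg01 z).1 (hg01 z).2⟩)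
    (hi.const_mul q)).congr fun n => ?_
  have hXm : Measurable fun ω i => N.X i ω := measurable_pi_lambda _ h.poisson.measurable
  have hTm : Measurable fun ω i => N.T i ω := measurable_pi_lambda _ h.measurable_T
  have hind : IndepFun (fun ω i => N.X i ω) (fun ω i => N.T i ω) μ :=
    h.indep_X_rest.comp measurable_id measurable_fst
  let F : (ℕ → Plane) × (ℕ → Bool) → ℝ := fun x =>
    ∏ i ∈ Finset.range n, (1 - if x.2 i = b then g (x.1 i) else 0)
  have hF01 : ∀ x, F x ∈ Set.Icc (0 : ℝ) 1 := fun x => prod_one_sub_mem_Icc _ _ fun i => by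
    split_ifs
    · exact hg01 _
    · simp
  have hF : Measurable F := Finset.measurable_prod _ fun i _ => measurable_const.sub
    (Measurable.ite ((show Measurable fun x : (ℕ → Plane) × (ℕ → Bool) => x.2 i by fun_prop)
      (measurableSet_singleton b))
      (hg.comp ((measurable_pi_apply i).comp measurable_fst)) measurable_const)
  have hprob1 : IsProbabilityMeasure (μ.map fun ω i => N.X i ω) :=
    Measure.isProbabilityMeasure_map hXm.aemeasurable
  have hprob2 : IsProbabilityMeasure (μ.map fun ω i => N.T i ω) :=
    Measure.isProbabilityMeasure_map hTm.aemeasurable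
  have hmap := (indepFun_iff_map_prod_eq_prod_map_map hXm.aemeasurable hTm.aemeasurable).1 hind
  have hFi : Integrable F ((μ.map fun ω i => N.X i ω).prod (μ.map fun ω i => N.T i ω)) :=
    Integrable.of_bound (C := 1) hF.aestronglyMeasurable (.of_forall fun x => by
      rw [Real.norm_of_nonneg (hF01 x).1]; exact (hF01 x).2)
  have hinner : ∀ x : ℕ → Plane, ∫ τ, F (x, τ) ∂(μ.map fun ω i => N.T i ω) =
      ∏ i ∈ Finset.range n, (1 - q * g (x i)) := by
    intro x
    have hFx : Measurable fun τ => F (x, τ) := hF.comp (measurable_const.prodMk measurable_id)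
    rw [integral_map hTm.aemeasurable hFx.aestronglyMeasurable]
    have hT : iIndepFun (fun (i : Fin n) => N.T i) μ := h.indep_T.precomp Fin.val_injective
    have h1 := hT.integral_fun_prod_comp
      (f := fun (i : Fin n) τ => 1 - if τ = b then g (x i) else 0)
      (fun i => (h.measurable_T i).aemeasurable) (fun i => by fun_prop)
    simp only [F]
    simp_rw [Finset.prod_range]
    refine h1.trans (Finset.prod_congr rfl fun i _ => ?_)
    have hms : MeasurableSet {ω | N.T i ω = b} := h.measurable_T i (measurableSet_singleton b)
    have h2 : (fun ω => if N.T i ω = b then g (x i) else 0) =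
        {ω | N.T i ω = b}.indicator fun _ => g (x i) := by
      ext ω; simp [Set.indicator]
    rw [integral_sub (integrable_const _)
      (by rw [h2]; exact (integrable_const _).indicator hms), h2,
      integral_indicator hms, setIntegral_const, hq]
    simp
  calc ∫ ω, ∏ i ∈ Finset.range n, (1 - q * g (N.X i ω)) ∂μ
      = ∫ x, ∏ i ∈ Finset.range n, (1 - q * g (x i)) ∂(μ.map fun ω i => N.X i ω) := by
        have hG : Measurable fun x : ℕ → Plane => ∏ i ∈ Finset.range n, (1 - q * g (x i)) :=
          Finset.measurable_fun_prod _ fun i _ =>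
            measurable_const.sub ((hg.comp (measurable_pi_apply i)).const_mul q)
        rw [integral_map hXm.aemeasurable hG.aestronglyMeasurable]
    _ = ∫ z, F z ∂(μ.map fun ω => ((fun i => N.X i ω), fun i => N.T i ω)) := by
        rw [hmap, integral_prod _ hFi]
        simp_rw [hinner]
    _ = _ := by
        rw [integral_map (hXm.prodMk hTm).aemeasurable hF.aestronglyMeasurable]

end PointProcess
end

/-! ### The complex normal law and the outage probability of a fixed matrix -/

section

open Filter Topology
open scoped ENNReal NNReal

theorem complexNormal_eq_withDensity :
    complexNormal = volume.withDensity
      (fun z : ℂ => ENNReal.ofReal (Real.pi⁻¹ * Real.exp (-‖z‖ ^ 2))) := by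
  have hv : (1 / 2 : ℝ≥0) ≠ 0 := by norm_num
  have hd : Measurable fun z : ℂ => ENNReal.ofReal (Real.pi⁻¹ * Real.exp (-‖z‖ ^ 2)) := by
    fun_prop
  have he : (fun z : ℝ × ℝ => (z.1 : ℂ) + (z.2 : ℂ) * Complex.I) =
      Complex.measurableEquivRealProd.symm := by
    ext z
    simp [Complex.measurableEquivRealProd_symm_apply, Complex.ext_iff]
  rw [complexNormal, gaussianReal_of_var_ne_zero _ hv,
    prod_withDensity (measurable_gaussianPDF _ _) (measurable_gaussianPDF _ _), he]
  ext s hs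
  rw [Measure.map_apply (MeasurableEquiv.measurable _) hs, withDensity_apply _ hs,
    withDensity_apply _ (MeasurableEquiv.measurable _ hs), ← Measure.volume_eq_prod,
    ← (Complex.volume_preserving_equiv_real_prod.symm).setLIntegral_comp_preimage hs hd]
  refine lintegral_congr fun z => ?_
  simp only [gaussianPDF]
  rw [← ENNReal.ofReal_mul (gaussianPDFReal_nonneg _ _ _), gaussianPDFReal, gaussianPDFReal]
  congr 1
  rw [Complex.sq_norm, Complex.measurableEquivRealProd_symm_apply, Complex.normSq_mk]
  push_cast
  rw [show 2 * Real.pi * (1 / 2) = Real.pi by ring, show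
    -(z.1 * z.1 + z.2 * z.2) = -(z.1 - 0) ^ 2 / (2 * (1 / 2)) + -(z.2 - 0) ^ 2 / (2 * (1 / 2)) by
      ring, Real.exp_add]
  have h := Real.mul_self_sqrt Real.pi_pos.le
  nth_rewrite 3 [← h]
  rw [mul_inv]; ring

instance : IsProbabilityMeasure complexNormal :=
  Measure.isProbabilityMeasure_map (by fun_prop)

instance (L : ℕ) : IsProbabilityMeasure (channelLaw L) := by
  unfold channelLaw; infer_instance

/-- The squared Hermitian norm of a complex vector. -/
noncomputable def sumSq {L : ℕ} (v : Fin L → ℂ) : ℝ := ∑ r, ‖v r‖ ^ 2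

/-- The density of the standard complex normal law on `ℂ ^ L`. -/
noncomputable def channelPDF {L : ℕ} (v : Fin L → ℂ) : ℝ := (Real.pi ^ L)⁻¹ * Real.exp (-sumSq v)

theorem sumSq_nonneg {L : ℕ} (v : Fin L → ℂ) : 0 ≤ sumSq v :=
  Finset.sum_nonneg fun _ _ => by positivity

theorem channelPDF_nonneg {L : ℕ} (v : Fin L → ℂ) : 0 ≤ channelPDF v := by
  unfold channelPDF; positivity

@[fun_prop]
theorem continuous_sumSq {L : ℕ} : Continuous (sumSq (L := L)) := by
  unfold sumSq; fun_prop

@[fun_prop]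
theorem continuous_channelPDF {L : ℕ} : Continuous (channelPDF (L := L)) := by
  unfold channelPDF; fun_prop

theorem channelLaw_eq_withDensity (L : ℕ) :
    channelLaw L = volume.withDensity (fun v => ENNReal.ofReal (channelPDF v)) := by
  have hd : Measurable fun z : ℂ => Real.pi⁻¹ * Real.exp (-‖z‖ ^ 2) := by fun_prop
  have hfin : ∫⁻ z : ℂ, ENNReal.ofReal (Real.pi⁻¹ * Real.exp (-‖z‖ ^ 2)) = 1 := by
    rw [← setLIntegral_univ, ← withDensity_apply _ MeasurableSet.univ,
      ← complexNormal_eq_withDensity, measure_univ]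
  have hint : Integrable fun z : ℂ => Real.pi⁻¹ * Real.exp (-‖z‖ ^ 2) := by
    refine ⟨hd.aestronglyMeasurable, ?_⟩
    rw [hasFiniteIntegral_iff_ofReal (.of_forall fun z => by positivity), hfin]
    exact ENNReal.one_lt_top
  unfold channelLaw
  refine Measure.pi_eq fun s hs => ?_
  rw [withDensity_apply _ (MeasurableSet.univ_pi hs), ← lintegral_indicator
    (MeasurableSet.univ_pi hs)]
  have h1 : ∀ v : Fin L → ℂ, (Set.univ.pi s).indicator
      (fun v => ENNReal.ofReal (channelPDF v)) v = ENNReal.ofReal (∏ i, (s i).indicator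
        (fun z : ℂ => Real.pi⁻¹ * Real.exp (-‖z‖ ^ 2)) (v i)) := by
    intro v
    by_cases hv : v ∈ Set.univ.pi s
    · rw [Set.indicator_of_mem hv]
      congr 1
      rw [Finset.prod_congr rfl fun i _ => Set.indicator_of_mem (hv i (Set.mem_univ i)) _,
        Finset.prod_mul_distrib, ← Real.exp_sum, channelPDF, sumSq]
      simp
    · rw [Set.indicator_of_notMem hv]
      simp only [Set.mem_pi, Set.mem_univ, forall_const, not_forall] at hv
      obtain ⟨i, hi⟩ := hv
      rw [Finset.prod_eq_zero (Finset.mem_univ i) (Set.indicator_of_notMem hi _),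
        ENNReal.ofReal_zero]
  have hnn : ∀ i, 0 ≤ (s i).indicator (fun z : ℂ => Real.pi⁻¹ * Real.exp (-‖z‖ ^ 2)) := fun i =>
    Set.indicator_nonneg fun z _ => by positivity
  rw [lintegral_congr h1, ← ofReal_integral_eq_lintegral_ofReal]
  · rw [integral_fintype_prod_volume_eq_prod (𝕜 := ℝ) (E := fun _ : Fin L => ℂ)
      fun i => (s i).indicator (fun z : ℂ => Real.pi⁻¹ * Real.exp (-‖z‖ ^ 2)),
      ENNReal.ofReal_prod_of_nonneg fun i _ => integral_nonneg (hnn i)]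
    refine Finset.prod_congr rfl fun i _ => ?_
    rw [ofReal_integral_eq_lintegral_ofReal (hint.indicator (hs i)) (.of_forall (hnn i)),
      complexNormal_eq_withDensity, withDensity_apply _ (hs i), ← lintegral_indicator (hs i)]
    refine lintegral_congr fun z => ?_
    by_cases hz : z ∈ s i <;> simp [hz]
  · exact Integrable.fintype_prod fun i => hint.indicator (hs i)
  · exact .of_forall fun v => Finset.prod_nonneg fun i _ => hnn i _

theorem integral_channelLaw {L : ℕ} {E : Type*} [NormedAddCommGroup E] [NormedSpace ℝ E]
    (f : (Fin L → ℂ) → E) :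
    ∫ v, f v ∂channelLaw L = ∫ v, channelPDF v • f v := by
  rw [channelLaw_eq_withDensity, integral_withDensity_eq_integral_toReal_smul (by fun_prop)
    (.of_forall fun v => ENNReal.ofReal_lt_top)]
  simp_rw [ENNReal.toReal_ofReal (channelPDF_nonneg _)]

/-- The real determinant of a complex linear map is the squared modulus of its complex determinant.
-/
theorem map_mulVec_volume {L : ℕ} {C : Matrix (Fin L) (Fin L) ℂ} (hC : C.det ≠ 0) :
    (volume : Measure (Fin L → ℂ)).map C.mulVec =
      ENNReal.ofReal ((‖C.det‖ ^ 2)⁻¹) • volume := by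
  have hdet : LinearMap.det ((Matrix.toLin' C).restrictScalars ℝ) = ‖C.det‖ ^ 2 := by
    rw [LinearMap.det_restrictScalars, Algebra.norm_complex_eq, LinearMap.det_toLin']
    simp [Complex.sq_norm]
  have h := Measure.map_linearMap_addHaar_eq_smul_addHaar
    (f := (Matrix.toLin' C).restrictScalars ℝ) (volume : Measure (Fin L → ℂ)) (by rw [hdet]; positivity)
  rw [hdet, abs_of_nonneg (by positivity)] at h
  exact h

open scoped Matrix in
theorem star_dotProduct_conjTranspose_mul_self {L : ℕ} (C : Matrix (Fin L) (Fin L) ℂ)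
    (v : Fin L → ℂ) : (star v ⬝ᵥ (Cᴴ * C) *ᵥ v).re = sumSq (C *ᵥ v) := by
  rw [← Matrix.mulVec_mulVec, Matrix.dotProduct_mulVec, Matrix.vecMul_conjTranspose, star_star,
    sumSq, dotProduct, Complex.re_sum]
  refine Finset.sum_congr rfl fun r _ => ?_
  rw [Complex.sq_norm, Complex.normSq_apply]
  simp

theorem star_dotProduct_self_re {L : ℕ} (v : Fin L → ℂ) : (star v ⬝ᵥ v).re = sumSq v := by
  have h := star_dotProduct_conjTranspose_mul_self 1 v
  simpa using h

open scoped Matrix in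
theorem norm_det_sq {L : ℕ} (C : Matrix (Fin L) (Fin L) ℂ) :
    ‖C.det‖ ^ 2 = (Cᴴ * C).det.re := by
  rw [Matrix.det_mul, Matrix.det_conjTranspose, Complex.sq_norm, Complex.normSq_apply]
  simp

theorem integral_comp_mulVec {L : ℕ} {C : Matrix (Fin L) (Fin L) ℂ} (hC : C.det ≠ 0)
    {E : Type*} [NormedAddCommGroup E] [NormedSpace ℝ E] {G : (Fin L → ℂ) → E}
    (hG : StronglyMeasurable G) :
    ∫ v, G (C.mulVec v) = (‖C.det‖ ^ 2)⁻¹ • ∫ v, G v := by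
  have hm : Measurable C.mulVec := (by fun_prop : Continuous C.mulVec).measurable
  rw [← integral_map hm.aemeasurable hG.aestronglyMeasurable, map_mulVec_volume hC,
    integral_smul_measure, ENNReal.toReal_ofReal (by positivity)]

open scoped Matrix in
-- The weight changes the Gaussian exponent from |v|² to |Cv|²; substituting u = Cv restores the
-- standard law. Under the tilted law, `v` is therefore distributed as C⁻¹u.
theorem integral_tilted {L : ℕ} {C : Matrix (Fin L) (Fin L) ℂ} (hC : C.det ≠ 0)
    {E : Type*} [NormedAddCommGroup E] [NormedSpace ℝ E] {F : (Fin L → ℂ) → E}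
    (hF : StronglyMeasurable F) :
    ∫ v, Real.exp (-(star v ⬝ᵥ (Cᴴ * C - 1) *ᵥ v).re) • F v ∂channelLaw L =
      (‖C.det‖ ^ 2)⁻¹ • ∫ u, F (C⁻¹ *ᵥ u) ∂channelLaw L := by
  rw [integral_channelLaw, integral_channelLaw]
  have hm : Measurable (C⁻¹).mulVec := (by fun_prop : Continuous (C⁻¹).mulVec).measurable
  rw [← integral_comp_mulVec hC (G := fun u => channelPDF u • F (C⁻¹ *ᵥ u))
    (continuous_channelPDF.stronglyMeasurable.smul (hF.comp_measurable hm))]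
  refine integral_congr_ae (.of_forall fun v => ?_)
  simp only
  rw [Matrix.mulVec_mulVec, Matrix.nonsing_inv_mul _ (isUnit_iff_ne_zero.2 hC), Matrix.one_mulVec,
    smul_smul, Matrix.sub_mulVec, dotProduct_sub, Matrix.one_mulVec, Complex.sub_re,
    star_dotProduct_conjTranspose_mul_self, star_dotProduct_self_re, channelPDF, channelPDF,
    mul_assoc, ← Real.exp_add]
  congr 3
  ring_nf

theorem integrable_complexNormal_sq : Integrable (fun z : ℂ => ‖z‖ ^ 2) complexNormal ∧
    ∫ z, ‖z‖ ^ 2 ∂complexNormal = 1 := by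
  have he : ∀ z : ℝ × ℝ, ‖(z.1 : ℂ) + (z.2 : ℂ) * Complex.I‖ ^ 2 = z.1 ^ 2 + z.2 ^ 2 := fun z => by
    rw [Complex.sq_norm, Complex.normSq_add_mul_I]
  have hg : Integrable (fun x : ℝ => x ^ 2) (gaussianReal 0 (1 / 2)) :=
    (memLp_id_gaussianReal (μ := 0) (v := 1 / 2) 2).integrable_sq
  have hgi : ∫ x, x ^ 2 ∂(gaussianReal 0 (1 / 2)) = 1 / 2 := by
    have h := variance_id_gaussianReal (μ := 0) (v := 1 / 2)
    rw [variance_eq_integral (by fun_prop)] at h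
    simpa using h
  have hm : AEMeasurable (fun z : ℝ × ℝ => (z.1 : ℂ) + (z.2 : ℂ) * Complex.I)
    ((gaussianReal 0 (1 / 2)).prod (gaussianReal 0 (1 / 2))) := by fun_prop
  have h1 := hg.comp_fst (gaussianReal 0 (1 / 2))
  have h2 := hg.comp_snd (gaussianReal 0 (1 / 2))
  constructor
  · rw [complexNormal, integrable_map_measure (by fun_prop) hm]
    exact (h1.add h2).congr (.of_forall fun z => (he z).symm)
  · rw [complexNormal, integral_map hm (by fun_prop)]
    simp_rw [he]
    rw [integral_add h1 h2, integral_fun_fst (fun x : ℝ => x ^ 2),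
      integral_fun_snd (fun x : ℝ => x ^ 2), hgi]
    simp; norm_num

theorem memLp_complexNormal : MemLp (fun z : ℂ => z) 2 complexNormal :=
  (memLp_two_iff_integrable_sq_norm (by fun_prop)).2 integrable_complexNormal_sq.1

theorem integral_complexNormal : ∫ z, z ∂complexNormal = 0 := by
  have hm : AEMeasurable (fun z : ℝ × ℝ => (z.1 : ℂ) + (z.2 : ℂ) * Complex.I)
    ((gaussianReal 0 (1 / 2)).prod (gaussianReal 0 (1 / 2))) := by fun_prop
  have hg : Integrable (fun x : ℝ => (x : ℂ)) (gaussianReal 0 (1 / 2)) :=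
    ((memLp_id_gaussianReal (μ := 0) (v := 1 / 2) 1).integrable le_rfl).ofReal
  have hgi : ∫ x : ℝ, (x : ℂ) ∂(gaussianReal 0 (1 / 2)) = 0 := by
    rw [integral_complex_ofReal]
    simp
  have h1 := hg.comp_fst (gaussianReal 0 (1 / 2))
  have h2 := (hg.mul_const Complex.I).comp_snd (gaussianReal 0 (1 / 2))
  rw [complexNormal, integral_map hm (by fun_prop), integral_add h1 h2,
    integral_fun_fst (fun x : ℝ => (x : ℂ)), integral_fun_snd (fun x : ℝ => (x : ℂ) * Complex.I),
    integral_mul_const, hgi]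
  simp

theorem integrable_channelLaw_mul_star {L : ℕ} (r s : Fin L) :
    Integrable (fun v : Fin L → ℂ => v r * star (v s)) (channelLaw L) := by
  have h : ∀ r : Fin L, MemLp (fun v : Fin L → ℂ => v r) 2 (channelLaw L) := fun r =>
    memLp_complexNormal.comp_measurePreserving
      (measurePreserving_eval (fun _ : Fin L => complexNormal) r)
  exact (h r).integrable_mul (h s).star

theorem integral_channelLaw_mul_star {L : ℕ} (r s : Fin L) :
    ∫ v : Fin L → ℂ, v r * star (v s) ∂channelLaw L = if r = s then 1 else 0 := by
  have h1 : ∀ v : Fin L → ℂ, v r * star (v s) =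
      ∏ i, ((if i = r then v i else 1) * (if i = s then star (v i) else 1)) := fun v => by
    rw [Finset.prod_mul_distrib]; simp
  simp_rw [h1]
  rw [channelLaw, integral_fintype_prod_eq_prod (𝕜 := ℂ) (E := fun _ : Fin L => ℂ)
    (fun i z => (if i = r then z else 1) * (if i = s then star z else 1))]
  split_ifs with h
  · subst h
    refine Finset.prod_eq_one fun i _ => ?_
    by_cases hi : i = r
    · simp only [hi, if_true]
      have : ∀ z : ℂ, z * star z = ((‖z‖ ^ 2 : ℝ) : ℂ) := fun z => by
        rw [Complex.star_def, Complex.mul_conj, Complex.normSq_eq_norm_sq]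
      simp_rw [this]
      rw [integral_complex_ofReal, integrable_complexNormal_sq.2]; simp
    · simp [hi]
  · refine Finset.prod_eq_zero (Finset.mem_univ r) ?_
    simp [h, integral_complexNormal]

open scoped Matrix in
theorem integral_exp_quadForm {L : ℕ} {C : Matrix (Fin L) (Fin L) ℂ} (hC : C.det ≠ 0) :
    ∫ v, Real.exp (-(star v ⬝ᵥ (Cᴴ * C - 1) *ᵥ v).re) ∂channelLaw L =
      ((Cᴴ * C).det.re)⁻¹ := by
  have h := integral_tilted hC (F := fun _ => (1 : ℝ)) stronglyMeasurable_const
  simpa [norm_det_sq] using h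

open scoped Matrix in
-- A standard vector u has identity covariance, so C⁻¹u has covariance C⁻¹(C⁻¹)* = (C*C)⁻¹.
theorem integral_exp_quadForm_mul_star {L : ℕ} {C : Matrix (Fin L) (Fin L) ℂ} (hC : C.det ≠ 0)
    (r s : Fin L) :
    ∫ v, Real.exp (-(star v ⬝ᵥ (Cᴴ * C - 1) *ᵥ v).re) • (v r * star (v s)) ∂channelLaw L =
      ((Cᴴ * C).det.re)⁻¹ • (Cᴴ * C)⁻¹ r s := by
  rw [integral_tilted hC (F := fun v => v r * star (v s))
    (by fun_prop : Continuous fun v : Fin L → ℂ => v r * star (v s)).stronglyMeasurable,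
    norm_det_sq]
  congr 1
  have h1 : ∀ u : Fin L → ℂ, (C⁻¹ *ᵥ u) r * star ((C⁻¹ *ᵥ u) s) =
      ∑ a, ∑ b, (C⁻¹ r a * star (C⁻¹ s b)) * (u a * star (u b)) := fun u => by
    simp only [Matrix.mulVec, dotProduct, star_sum, star_mul', Finset.sum_mul_sum]
    refine Finset.sum_congr rfl fun a _ => Finset.sum_congr rfl fun b _ => by ring
  simp_rw [h1]
  rw [integral_finsetSum _ fun a _ => integrable_finsetSum _ fun b _ =>
    (integrable_channelLaw_mul_star a b).const_mul _]
  simp_rw [integral_finsetSum _ fun b _ => (integrable_channelLaw_mul_star _ b).const_mul _,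
    integral_const_mul, integral_channelLaw_mul_star]
  rw [Matrix.mul_inv_rev, ← Matrix.conjTranspose_nonsing_inv, Matrix.mul_apply]
  simp

/-- The probability that the quadratic form of `R⁻¹` at a channel vector is less than `1`. -/
noncomputable def outageProb {L : ℕ} (R : Matrix (Fin L) (Fin L) ℂ) : ℝ :=
  (Real.pi ^ L)⁻¹ * R.det.re *
    ∫ v in {v : Fin L → ℂ | sumSq v < 1}, Real.exp (-(star v ⬝ᵥ R.mulVec v).re)

theorem measurableSet_sumSq_lt {L : ℕ} : MeasurableSet {v : Fin L → ℂ | sumSq v < 1} :=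
  measurableSet_lt continuous_sumSq.measurable measurable_const

theorem volume_sumSq_lt_ne_top {L : ℕ} : volume {v : Fin L → ℂ | sumSq v < 1} ≠ ⊤ := by
  have h := Complex.volume_sum_rpow_lt_one (Fin L) one_le_two
  have he : {v : Fin L → ℂ | sumSq v < 1} = {v : Fin L → ℂ | ∑ i, ‖v i‖ ^ (2 : ℝ) < 1} := by
    ext v; simp [sumSq]
  rw [he, h]
  exact ENNReal.ofReal_ne_top

open scoped Matrix MatrixOrder ComplexOrder in
-- Substitute h = Sv with S the Hermitian square root of R. The event becomes |v|² < 1, the Jacobian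
-- is det R, and the Gaussian exponent |Sv|² equals v*Rv.
theorem channelLaw_real_quadForm_lt {L : ℕ} {R : Matrix (Fin L) (Fin L) ℂ} (hR : R.PosDef) :
    (channelLaw L).real {h | (star h ⬝ᵥ R⁻¹ *ᵥ h).re < 1} = outageProb R := by
  obtain ⟨S, hS1, hS2⟩ : ∃ S : Matrix (Fin L) (Fin L) ℂ, Sᴴ = S ∧ S * S = R :=
    ⟨CFC.sqrt R, (Matrix.nonneg_iff_posSemidef.1 (CFC.sqrt_nonneg R)).isHermitian,
      CFC.sqrt_mul_sqrt_self R hR.posSemidef.nonneg⟩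
  have hS3 : Sᴴ * S = R := by rw [hS1, hS2]
  have hSd : S.det ≠ 0 := by
    intro h0
    have := hR.det_pos
    rw [← hS2, Matrix.det_mul, h0, mul_zero] at this
    exact lt_irrefl _ this
  have hSu := isUnit_iff_ne_zero.2 hSd
  set B : Set (Fin L → ℂ) := {h | (star h ⬝ᵥ R⁻¹ *ᵥ h).re < 1} with hB
  have hBm : MeasurableSet B := by
    refine measurableSet_lt (Continuous.measurable ?_) measurable_const
    fun_prop
  have hmem : ∀ v, S *ᵥ v ∈ B ↔ sumSq v < 1 := by
    intro v
    rw [hB, Set.mem_ofPred_eq, Matrix.mulVec_mulVec, ← hS2, Matrix.mul_inv_rev, Matrix.mul_assoc,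
      Matrix.nonsing_inv_mul _ hSu, Matrix.mul_one, Matrix.star_mulVec, hS1,
      ← Matrix.dotProduct_mulVec, Matrix.mulVec_mulVec, Matrix.mul_nonsing_inv _ hSu,
      Matrix.one_mulVec, star_dotProduct_self_re]
  have h1 : (channelLaw L).real B = ∫ h, B.indicator channelPDF h := by
    rw [← integral_indicator_one hBm, integral_channelLaw]
    refine integral_congr_ae (.of_forall fun h => ?_)
    by_cases hh : h ∈ B <;> simp [hh]
  have h2 := integral_comp_mulVec hSd (G := B.indicator channelPDF)
    (continuous_channelPDF.stronglyMeasurable.indicator hBm)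
  have hd : (‖S.det‖ ^ 2) ≠ 0 := by positivity
  have h3 : ∫ h, B.indicator channelPDF h =
      ‖S.det‖ ^ 2 * ∫ v, B.indicator channelPDF (S *ᵥ v) := by
    rw [h2, smul_eq_mul, mul_inv_cancel_left₀ hd]
  rw [h1, h3, outageProb, norm_det_sq, hS3, ← integral_indicator measurableSet_sumSq_lt,
    mul_comm (Real.pi ^ L)⁻¹, mul_assoc,
    ← integral_const_mul (Real.pi ^ L)⁻¹]
  refine congrArg (R.det.re * ·) (integral_congr_ae (.of_forall fun v => ?_))
  simp only
  by_cases hv : sumSq v < 1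
  · rw [Set.indicator_of_mem ((hmem v).2 hv), Set.indicator_of_mem (by exact hv), channelPDF,
      ← star_dotProduct_conjTranspose_mul_self, hS3]
  · rw [Set.indicator_of_notMem (mt (hmem v).1 hv), Set.indicator_of_notMem (by exact hv), mul_zero]

theorem outageProb_of_det_eq_zero {L : ℕ} {R : Matrix (Fin L) (Fin L) ℂ} (hR : R.det = 0) :
    outageProb R = 0 := by
  simp [outageProb, hR]

open scoped ComplexOrder in
theorem outageProb_mem_Icc {L : ℕ} {R : Matrix (Fin L) (Fin L) ℂ} (hR : R.PosSemidef) :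
    outageProb R ∈ Set.Icc (0 : ℝ) 1 := by
  by_cases h : R.det = 0
  · rw [outageProb_of_det_eq_zero h]; simp
  · rw [← channelLaw_real_quadForm_lt (hR.posDef_iff_det_ne_zero.2 h)]
    exact ⟨measureReal_nonneg, measureReal_le_one⟩

open scoped Matrix ComplexOrder in
-- Semidefiniteness bounds the exponential by 1 on a set of finite volume. No invertibility is
-- needed, so truncated interference with fewer than `L` transmitters is admitted.
theorem tendsto_outageProb {L : ℕ} {u : ℕ → Matrix (Fin L) (Fin L) ℂ}
    {R : Matrix (Fin L) (Fin L) ℂ} (hu : ∀ n, (u n).PosSemidef) (h : Tendsto u atTop (𝓝 R)) :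
    Tendsto (fun n => outageProb (u n)) atTop (𝓝 (outageProb R)) := by
  unfold outageProb
  refine Tendsto.mul (Tendsto.const_mul _ ?_) ?_
  · exact ((by fun_prop : Continuous fun A : Matrix (Fin L) (Fin L) ℂ => A.det.re).tendsto R).comp h
  · have hfin : IsFiniteMeasure (volume.restrict {v : Fin L → ℂ | sumSq v < 1}) :=
      ⟨by rw [Measure.restrict_apply_univ]; exact volume_sumSq_lt_ne_top.lt_top⟩
    refine tendsto_integral_of_dominated_convergence (fun _ => 1) (fun n => ?_)
      (integrable_const _) (fun n => .of_forall fun v => ?_) (.of_forall fun v => ?_)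
    · exact (by fun_prop : Continuous fun v : Fin L → ℂ =>
        Real.exp (-(star v ⬝ᵥ (u n) *ᵥ v).re)).aestronglyMeasurable
    · rw [Real.norm_of_nonneg (Real.exp_pos _).le, Real.exp_le_one_iff, neg_nonpos]
      exact (hu n).re_dotProduct_nonneg v
    · exact ((by fun_prop : Continuous fun A : Matrix (Fin L) (Fin L) ℂ =>
        Real.exp (-(star v ⬝ᵥ A *ᵥ v).re)).tendsto R).comp h

end

/-! ### Channel average of the tilted determinant -/

section

open Filter Topology
open scoped ENNReal NNReal
open scoped Matrix

theorem det_one_add_vecMulVec {L : ℕ} (u v : Fin L → ℂ) :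
    (1 + Matrix.vecMulVec u v).det = 1 + v ⬝ᵥ u := by
  rw [Matrix.vecMulVec_eq Unit, Matrix.det_one_add_replicateCol_mul_replicateRow]

theorem star_dotProduct_self {L : ℕ} (v : Fin L → ℂ) : star v ⬝ᵥ v = (sumSq v : ℂ) := by
  rw [sumSq, dotProduct]
  push_cast
  refine Finset.sum_congr rfl fun r _ => ?_
  rw [Pi.star_apply, Complex.star_def, mul_comm, Complex.mul_conj, Complex.normSq_eq_norm_sq]
  push_cast; rfl

theorem det_one_add_smul_vecMulVec_star {L : ℕ} (v : Fin L → ℂ) (w : ℝ) :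
    (1 + (w : ℂ) • Matrix.vecMulVec v (star v)).det = ((1 + w * sumSq v : ℝ) : ℂ) := by
  rw [← Matrix.smul_vecMulVec, det_one_add_vecMulVec, dotProduct_smul, star_dotProduct_self]
  push_cast; rfl

/-- The Sherman–Morrison formula; it gives the covariance of one channel under the tilt. -/
theorem inv_one_add_smul_vecMulVec_star {L : ℕ} (v : Fin L → ℂ) {w : ℝ} (hw : 0 ≤ w) :
    (1 + (w : ℂ) • Matrix.vecMulVec v (star v))⁻¹ =
      1 - ((w / (1 + w * sumSq v) : ℝ) : ℂ) • Matrix.vecMulVec v (star v) := by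
  have h0 : (1 + w * sumSq v : ℂ) ≠ 0 := by
    have := mul_nonneg hw (sumSq_nonneg v)
    exact_mod_cast (by positivity : (1 + w * sumSq v : ℝ) ≠ 0)
  refine Matrix.inv_eq_right_inv ?_
  rw [add_mul, mul_sub, mul_sub, one_mul, one_mul, mul_one, Matrix.smul_mul, Matrix.mul_smul,
    Matrix.vecMulVec_mul_vecMulVec, star_dotProduct_self]
  ext r s
  simp only [Matrix.add_apply, Matrix.sub_apply, Matrix.smul_apply, Matrix.vecMulVec_apply,
    smul_eq_mul, Pi.smul_apply, Pi.star_apply]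
  push_cast
  field_simp
  ring

open scoped MatrixOrder ComplexOrder in
-- Supplies the matrix required by `integral_tilted` for a single interferer: the positive square
-- root, nonsingular because the determinant 1 + w|v|² of its square is positive.
theorem exists_conjTranspose_mul_self_eq {L : ℕ} (v : Fin L → ℂ) {w : ℝ} (hw : 0 ≤ w) :
    ∃ C : Matrix (Fin L) (Fin L) ℂ, C.det ≠ 0 ∧
      Cᴴ * C = 1 + (w : ℂ) • Matrix.vecMulVec v (star v) := by
  have hpsd : (1 + (w : ℂ) • Matrix.vecMulVec v (star v)).PosSemidef :=
    Matrix.PosSemidef.one.add ((Matrix.posSemidef_vecMulVec_self_star v).smul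
      (by exact_mod_cast hw))
  set A := 1 + (w : ℂ) • Matrix.vecMulVec v (star v) with hA
  have hC : (CFC.sqrt A)ᴴ * CFC.sqrt A = A := by
    rw [(Matrix.nonneg_iff_posSemidef.1 (CFC.sqrt_nonneg A)).isHermitian,
      CFC.sqrt_mul_sqrt_self A hpsd.nonneg]
  refine ⟨CFC.sqrt A, fun h0 => ?_, hC⟩
  have h1 : A.det = 0 := by rw [← hC, Matrix.det_mul, h0, mul_zero]
  rw [hA, det_one_add_smul_vecMulVec_star] at h1
  have := mul_nonneg hw (sumSq_nonneg v)
  exact (by positivity : (1 + w * sumSq v : ℝ) ≠ 0) (by exact_mod_cast h1)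

theorem star_dotProduct_smul_vecMulVec {L : ℕ} (v h : Fin L → ℂ) (w : ℝ) :
    (star h ⬝ᵥ ((w : ℂ) • Matrix.vecMulVec v (star v)) *ᵥ h).re = w * ‖star v ⬝ᵥ h‖ ^ 2 := by
  rw [Matrix.smul_mulVec, Matrix.vecMulVec_mulVec, op_smul_eq_smul, dotProduct_smul,
    dotProduct_smul, smul_eq_mul, smul_eq_mul, Matrix.star_dotProduct h v, Complex.star_def,
    Complex.mul_conj, Complex.re_ofReal_mul, Complex.ofReal_re, Complex.normSq_eq_norm_sq]

theorem integral_exp_neg_mul_norm_dotProduct_sq {L : ℕ} (v : Fin L → ℂ) {w : ℝ} (hw : 0 ≤ w) :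
    ∫ h, Real.exp (-(w * ‖star v ⬝ᵥ h‖ ^ 2)) ∂channelLaw L = (1 + w * sumSq v)⁻¹ := by
  obtain ⟨C, hC, hC'⟩ := exists_conjTranspose_mul_self_eq v hw
  have h := integral_exp_quadForm hC
  rw [hC', add_sub_cancel_left, det_one_add_smul_vecMulVec_star, Complex.ofReal_re] at h
  simp_rw [star_dotProduct_smul_vecMulVec] at h
  exact h

theorem integral_exp_neg_mul_norm_dotProduct_sq_mul {L : ℕ} (v : Fin L → ℂ) {w : ℝ} (hw : 0 ≤ w)
    (r s : Fin L) :
    ∫ h, Real.exp (-(w * ‖star v ⬝ᵥ h‖ ^ 2)) • (h r * star (h s)) ∂channelLaw L =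
      (1 + w * sumSq v)⁻¹ •
        (1 - ((w / (1 + w * sumSq v) : ℝ) : ℂ) • Matrix.vecMulVec v (star v)) r s := by
  obtain ⟨C, hC, hC'⟩ := exists_conjTranspose_mul_self_eq v hw
  have h := integral_exp_quadForm_mul_star hC r s
  rw [hC', add_sub_cancel_left, det_one_add_smul_vecMulVec_star, Complex.ofReal_re,
    inv_one_add_smul_vecMulVec_star v hw] at h
  simp_rw [star_dotProduct_smul_vecMulVec] at h
  exact h

/-- The weighted sum of the rank-one matrices of a family of channel vectors. -/
noncomputable def interference {L : ℕ} {ι : Type*} [Fintype ι] (w : ι → ℝ) (h : ι → Fin L → ℂ) :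
    Matrix (Fin L) (Fin L) ℂ :=
  ∑ i, w i • Matrix.vecMulVec (h i) (star (h i))

/-- Row r of the matrix is a combination of the row vectors h_i*. Multilinearity expands the
determinant over the choices `σ` of an interferer for each row, and a repeated choice produces two
equal rows. Injectivity of the surviving `σ` is what later lets independence separate the factors.
-/
theorem det_interference {L : ℕ} {ι : Type*} [Fintype ι] [DecidableEq ι] (w : ι → ℝ)
    (h : ι → Fin L → ℂ) :
    (interference w h).det = ∑ σ : Fin L → ι with Function.Injective σ,
      ∑ τ : Equiv.Perm (Fin L), (Equiv.Perm.sign τ : ℂ) *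
        ∏ r, ((w (σ r) : ℂ) * (h (σ r) r * star (h (σ r) (τ r)))) := by
  have h1 : interference w h = fun r => ∑ i, ((w i : ℂ) * h i r) • star (h i) := by
    ext r s
    simp [interference, Matrix.sum_apply, Matrix.vecMulVec_apply, mul_assoc]
  change Matrix.detRowAlternating (interference w h) = _
  rw [h1]
  have h2 := (Matrix.detRowAlternating (R := ℂ) (n := Fin L)).toMultilinearMap.map_sum
    (fun (r : Fin L) (i : ι) => ((w i : ℂ) * h i r) • star (h i))
  refine h2.trans ?_
  rw [Finset.sum_filter]
  refine Finset.sum_congr rfl fun σ _ => ?_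
  have h3 := (Matrix.detRowAlternating (R := ℂ) (n := Fin L)).toMultilinearMap.map_smul_univ
    (fun r => (w (σ r) : ℂ) * h (σ r) r) (fun r => star (h (σ r)))
  refine h3.trans ?_
  split_ifs with hσ
  · have h4 : Matrix.det (Matrix.of fun r => star (h (σ r))) =
        ∑ τ : Equiv.Perm (Fin L), (Equiv.Perm.sign τ : ℂ) * ∏ r, star (h (σ r) (τ r)) := by
      rw [← Matrix.det_transpose, Matrix.det_apply']
      rfl
    change _ • Matrix.det (Matrix.of fun r => star (h (σ r))) = _
    rw [h4, smul_eq_mul, Finset.mul_sum]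
    refine Finset.sum_congr rfl fun τ _ => ?_
    rw [mul_left_comm, ← Finset.prod_mul_distrib]
    congr 1
    exact Finset.prod_congr rfl fun r _ => mul_assoc _ _ _
  · rw [Function.not_injective_iff] at hσ
    obtain ⟨a, b, hab, hne⟩ := hσ
    have : Matrix.detRowAlternating (fun r => star (h (σ r))) = 0 :=
      AlternatingMap.map_eq_zero_of_eq _ _ (i := a) (j := b) (by simp [hab]) hne
    change _ • Matrix.detRowAlternating (fun r => star (h (σ r))) = 0
    rw [this, smul_zero]

theorem filter_eq_empty_or_singleton {L : ℕ} {ι : Type*} [DecidableEq ι] {σ : Fin L → ι} (hσ : Function.Injective σ) (i : ι) :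
    (Finset.univ.filter fun r => σ r = i) = ∅ ∨
      ∃ r, (Finset.univ.filter fun r => σ r = i) = {r} := by
  by_cases h : ∃ r, σ r = i
  · obtain ⟨r, rfl⟩ := h
    right
    refine ⟨r, ?_⟩
    ext s
    simp [hσ.eq_iff]
  · left
    push Not at h
    ext s
    simp [h s]

section ProductIntegral

variable {L : ℕ} {ι : Type*} [Fintype ι] [DecidableEq ι]

theorem prod_comp_eq_prod_fiber {M : Type*} [CommMonoid M] (σ : Fin L → ι) (g : Fin L → ι → M) :
    ∏ r, g r (σ r) = ∏ i, ∏ r with σ r = i, g r i := by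
  rw [← Finset.prod_fiberwise Finset.univ σ fun r => g r (σ r)]
  refine Finset.prod_congr rfl fun i _ => Finset.prod_congr rfl fun r hr => ?_
  rw [(Finset.mem_filter.1 hr).2]

/-- Integral against a product law of a product of weights and of factors attached to distinct
coordinates. -/
theorem integral_pi_prod_mul_prod {E : Type*} [MeasurableSpace E] (γ : Measure E)
    [IsProbabilityMeasure γ] (e : ι → E → ℂ) (g : Fin L → ι → E → ℂ)
    {σ : Fin L → ι} (hσ : Function.Injective σ) (he : ∀ i, Integrable (e i) γ)
    (hg : ∀ r i, Integrable (fun x => e i x * g r i x) γ) (z : ι → ℂ) (m : Fin L → ι → ℂ)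
    (hz : ∀ i, ∫ x, e i x ∂γ = z i) (hm : ∀ r i, ∫ x, e i x * g r i x ∂γ = z i * m r i) :
    Integrable (fun h : ι → E => (∏ i, e i (h i)) * ∏ r, g r (σ r) (h (σ r)))
        (Measure.pi fun _ => γ) ∧
      ∫ h : ι → E, (∏ i, e i (h i)) * ∏ r, g r (σ r) (h (σ r)) ∂(Measure.pi fun _ => γ) =
        (∏ i, z i) * ∏ r, m r (σ r) := by
  have h1 : ∀ h : ι → E, (∏ i, e i (h i)) * ∏ r, g r (σ r) (h (σ r)) =
      ∏ i, (e i (h i) * ∏ r with σ r = i, g r i (h i)) := fun h => by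
    rw [prod_comp_eq_prod_fiber σ fun r i => g r i (h i), ← Finset.prod_mul_distrib]
  simp_rw [h1]
  constructor
  · refine Integrable.fintype_prod (f := fun i x => e i x * ∏ r with σ r = i, g r i x) fun i => ?_
    -- Injectivity leaves at most one factor `g` on each coordinate, so only zeroth and first
    -- moments under the tilt occur.
    rcases filter_eq_empty_or_singleton hσ i with h | ⟨r, h⟩
    · simpa [h] using he i
    · simpa [h] using hg r i
  · rw [integral_fintype_prod_eq_prod (𝕜 := ℂ) (E := fun _ : ι => E)
      fun i x => e i x * ∏ r with σ r = i, g r i x, prod_comp_eq_prod_fiber σ m,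
      ← Finset.prod_mul_distrib]
    refine Finset.prod_congr rfl fun i _ => ?_
    rcases filter_eq_empty_or_singleton hσ i with h | ⟨r, h⟩
    · simpa [h] using hz i
    · simpa [h] using hm r i

/-- Scaling each row by its own coefficient keeps the perturbation of the identity of rank one, so
the matrix determinant lemma applies even though the rows belong to different interferers. -/
theorem det_one_sub_rows (v : Fin L → ℂ) (c : Fin L → ℝ) :
    ∑ τ : Equiv.Perm (Fin L), (Equiv.Perm.sign τ : ℂ) *
        ∏ r, (1 - (c r : ℂ) • Matrix.vecMulVec v (star v)) r (τ r) =
      ((1 - ∑ r, c r * ‖v r‖ ^ 2 : ℝ) : ℂ) := by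
  have h1 : ((1 : Matrix (Fin L) (Fin L) ℂ) +
      Matrix.vecMulVec (fun r => -((c r : ℂ) * v r)) (star v)).det =
      ∑ τ : Equiv.Perm (Fin L), (Equiv.Perm.sign τ : ℂ) *
        ∏ r, (1 - (c r : ℂ) • Matrix.vecMulVec v (star v)) r (τ r) := by
    rw [← Matrix.det_transpose, Matrix.det_apply']
    refine Finset.sum_congr rfl fun τ _ => ?_
    congr 1
    refine Finset.prod_congr rfl fun r _ => ?_
    simp [Matrix.vecMulVec_apply]
    ring
  rw [← h1, det_one_add_vecMulVec, dotProduct]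
  push_cast
  rw [sub_eq_add_neg, ← Finset.sum_neg_distrib]
  congr 1
  refine Finset.sum_congr rfl fun r _ => ?_
  have h2 := Complex.mul_conj (v r)
  rw [Complex.normSq_eq_norm_sq] at h2
  push_cast at h2
  rw [← h2, Pi.star_apply, Complex.star_def]
  ring

/-- For fixed `σ` and `τ` the integrand factors over the independent channels: the selected ones
contribute tilted second moments, the others only their tilted mass. Summing over `τ` reassembles
the determinant of `det_one_sub_rows`. -/
theorem integral_det_interference_tilted (v : Fin L → ℂ) {w : ι → ℝ} (hw : ∀ i, 0 ≤ w i) :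
    Integrable (fun h : ι → Fin L → ℂ => (∏ i, (Real.exp (-(w i * ‖star v ⬝ᵥ h i‖ ^ 2)) : ℂ)) *
        (interference w h).det) (Measure.pi fun _ => channelLaw L) ∧
    ∫ h : ι → Fin L → ℂ, (∏ i, (Real.exp (-(w i * ‖star v ⬝ᵥ h i‖ ^ 2)) : ℂ)) *
        (interference w h).det ∂(Measure.pi fun _ => channelLaw L) =
      (((∏ i, (1 + w i * sumSq v)⁻¹) * ∑ σ : Fin L → ι with Function.Injective σ,
        (∏ r, w (σ r)) * (1 - ∑ r, w (σ r) / (1 + w (σ r) * sumSq v) * ‖v r‖ ^ 2) : ℝ) : ℂ) := by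
  have hem : ∀ i, Continuous fun x : Fin L → ℂ =>
      (Real.exp (-(w i * ‖star v ⬝ᵥ x‖ ^ 2)) : ℂ) := fun i => by fun_prop
  have heb : ∀ i (x : Fin L → ℂ), ‖(Real.exp (-(w i * ‖star v ⬝ᵥ x‖ ^ 2)) : ℂ)‖ ≤ 1 := by
    intro i x
    rw [Complex.norm_real, Real.norm_of_nonneg (Real.exp_pos _).le, Real.exp_le_one_iff]
    have := mul_nonneg (hw i) (sq_nonneg ‖star v ⬝ᵥ x‖)
    linarith
  have key := fun (σ : Fin L → ι) (hσ : Function.Injective σ) (τ : Equiv.Perm (Fin L)) =>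
    integral_pi_prod_mul_prod (channelLaw L)
      (fun i x => (Real.exp (-(w i * ‖star v ⬝ᵥ x‖ ^ 2)) : ℂ))
      (fun r i x => (w i : ℂ) * (x r * star (x (τ r)))) hσ
      (fun i => Integrable.of_bound (hem i).aestronglyMeasurable 1 (.of_forall (heb i)))
      (fun r i => ((integrable_channelLaw_mul_star r (τ r)).const_mul (w i : ℂ)).bdd_mul
        (hem i).aestronglyMeasurable (.of_forall (heb i)))
      (fun i => (((1 + w i * sumSq v)⁻¹ : ℝ) : ℂ))
      (fun r i => (w i : ℂ) *
        (1 - ((w i / (1 + w i * sumSq v) : ℝ) : ℂ) • Matrix.vecMulVec v (star v)) r (τ r))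
      (fun i => by rw [integral_complex_ofReal, integral_exp_neg_mul_norm_dotProduct_sq v (hw i)])
      (fun r i => by
        have h := integral_exp_neg_mul_norm_dotProduct_sq_mul v (hw i) r (τ r)
        simp_rw [Complex.real_smul] at h
        rw [mul_left_comm, ← h, ← integral_const_mul]
        exact integral_congr_ae (.of_forall fun x => mul_left_comm _ _ _))
  have hexp : ∀ h : ι → Fin L → ℂ, (∏ i, (Real.exp (-(w i * ‖star v ⬝ᵥ h i‖ ^ 2)) : ℂ)) *
      (interference w h).det = ∑ σ : Fin L → ι with Function.Injective σ,
      ∑ τ : Equiv.Perm (Fin L), (Equiv.Perm.sign τ : ℂ) *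
        ((∏ i, (Real.exp (-(w i * ‖star v ⬝ᵥ h i‖ ^ 2)) : ℂ)) *
          ∏ r, ((w (σ r) : ℂ) * (h (σ r) r * star (h (σ r) (τ r))))) := by
    intro h
    rw [det_interference, Finset.mul_sum]
    refine Finset.sum_congr rfl fun σ _ => ?_
    rw [Finset.mul_sum]
    exact Finset.sum_congr rfl fun τ _ => mul_left_comm _ _ _
  simp_rw [hexp]
  have hint : ∀ σ ∈ (Finset.univ.filter fun σ : Fin L → ι => Function.Injective σ),
      ∀ τ ∈ (Finset.univ : Finset (Equiv.Perm (Fin L))), Integrable (fun h : ι → Fin L → ℂ =>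
        (Equiv.Perm.sign τ : ℂ) * ((∏ i, (Real.exp (-(w i * ‖star v ⬝ᵥ h i‖ ^ 2)) : ℂ)) *
          ∏ r, ((w (σ r) : ℂ) * (h (σ r) r * star (h (σ r) (τ r))))))
        (Measure.pi fun _ => channelLaw L) := fun σ hσ τ _ =>
    (key σ (Finset.mem_filter.1 hσ).2 τ).1.const_mul _
  refine ⟨integrable_finsetSum _ fun σ hσ => integrable_finsetSum _ fun τ hτ => hint σ hσ τ hτ, ?_⟩
  rw [integral_finsetSum _ fun σ hσ => integrable_finsetSum _ fun τ hτ => hint σ hσ τ hτ]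
  rw [Complex.ofReal_mul, Complex.ofReal_sum, Finset.mul_sum]
  refine Finset.sum_congr rfl fun σ hσ => ?_
  rw [integral_finsetSum _ fun τ hτ => hint σ hσ τ hτ]
  have h1 := det_one_sub_rows v fun r => w (σ r) / (1 + w (σ r) * sumSq v)
  rw [Complex.ofReal_mul, ← h1, Finset.mul_sum, Finset.mul_sum]
  refine Finset.sum_congr rfl fun τ _ => ?_
  rw [integral_const_mul, (key σ (Finset.mem_filter.1 hσ).2 τ).2, Finset.prod_mul_distrib]
  push_cast
  ring

end ProductIntegral

end

/-! ### Symmetrisation, elementary symmetric functions and radial integration -/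

section

open Filter Topology
open scoped ENNReal NNReal

section Combinatorics

variable {L : ℕ} {ι : Type*} [Fintype ι] [DecidableEq ι]

/-- Permuting the rows permutes the injective `σ` and preserves the product of weights, so every row
has the same total and `x` may be replaced by its mean. With `x r` equal to |v_r|² this leaves a
dependence on |v|² alone. -/
theorem sum_injective_symmetrize (w c : ι → ℝ) (x : Fin L → ℝ) :
    L * ∑ σ : Fin L → ι with Function.Injective σ, (∏ r, w (σ r)) * ∑ r, c (σ r) * x r =
      (∑ r, x r) * ∑ σ : Fin L → ι with Function.Injective σ, (∏ r, w (σ r)) * ∑ r, c (σ r) := by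
  classical
  let T : Fin L → ℝ := fun r =>
    ∑ σ : Fin L → ι with Function.Injective σ, (∏ s, w (σ s)) * c (σ r)
  have hT : ∀ r r', T r = T r' := by
    intro r r'
    refine Finset.sum_bij' (fun σ _ => σ ∘ Equiv.swap r r') (fun σ _ => σ ∘ Equiv.swap r r')
      (fun σ hσ => ?_) (fun σ hσ => ?_) (fun σ _ => ?_) (fun σ _ => ?_) (fun σ _ => ?_)
    · simpa using hσ
    · simpa using hσ
    · ext s; simp
    · ext s; simp
    · simp only [Function.comp_apply, Equiv.swap_apply_right]
      rw [Equiv.prod_comp (Equiv.swap r r') fun s => w (σ s)]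
  have h1 : ∑ σ : Fin L → ι with Function.Injective σ, (∏ r, w (σ r)) * ∑ r, c (σ r) * x r =
      ∑ r, x r * T r := by
    simp_rw [T, Finset.mul_sum]
    rw [Finset.sum_comm]
    exact Finset.sum_congr rfl fun r _ => Finset.sum_congr rfl fun σ _ => by ring
  have h2 : ∑ σ : Fin L → ι with Function.Injective σ, (∏ r, w (σ r)) * ∑ r, c (σ r) =
      ∑ r, T r := by
    simp_rw [T, Finset.mul_sum]
    rw [Finset.sum_comm]
  rw [h1, h2]
  rcases L with _ | L
  · simp
  · simp_rw [hT _ 0]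
    rw [← Finset.sum_mul, Finset.sum_const, Finset.card_univ, Fintype.card_fin]
    simp only [nsmul_eq_mul]
    ring

/-- Each set of `L` indices is the image of exactly `L!` injections. -/
theorem sum_injective_eq_sum_powersetCard (F : Finset ι → ℝ) :
    ∑ σ : Fin L → ι with Function.Injective σ, F (Finset.univ.image σ) =
      L.factorial * ∑ S ∈ Finset.univ.powersetCard L, F S := by
  classical
  have hmap : ∀ σ ∈ (Finset.univ.filter fun σ : Fin L → ι => Function.Injective σ),
      Finset.univ.image σ ∈ Finset.univ.powersetCard L := fun σ hσ => by
    simp [Finset.mem_powersetCard, Finset.card_image_of_injective _ (Finset.mem_filter.1 hσ).2]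
  rw [← Finset.sum_fiberwise_of_maps_to hmap, Finset.mul_sum]
  refine Finset.sum_congr rfl fun S hS => ?_
  have hS' : S.card = L := (Finset.mem_powersetCard.1 hS).2
  have hcard : ((Finset.univ.filter fun σ : Fin L → ι => Function.Injective σ).filter
      fun σ => Finset.univ.image σ = S).card = L.factorial := by
    have h1 : Fintype.card (Fin L ↪ S) = L.factorial := by
      rw [Fintype.card_embedding_eq, Fintype.card_coe, hS', Fintype.card_fin, Nat.descFactorial_self]
    rw [← h1, ← Finset.card_univ]
    symm
    refine Finset.card_bij (fun f _ r => (f r : ι)) (fun f _ => ?_) (fun f _ g _ hfg => ?_)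
      (fun σ hσ => ?_)
    · have hinj : Function.Injective fun r => (f r : ι) := Subtype.val_injective.comp f.injective
      simp only [Finset.mem_filter, Finset.mem_univ, true_and]
      refine ⟨hinj, Finset.eq_of_subset_of_card_le ?_ ?_⟩
      · intro i hi
        obtain ⟨r, _, rfl⟩ := Finset.mem_image.1 hi
        exact (f r).2
      · rw [Finset.card_image_of_injective _ hinj, hS', Finset.card_univ, Fintype.card_fin]
    · ext r
      exact congrFun hfg r
    · simp only [Finset.mem_filter, Finset.mem_univ, true_and] at hσ
      exact ⟨⟨fun r => ⟨σ r, hσ.2 ▸ Finset.mem_image_of_mem σ (Finset.mem_univ r)⟩,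
        fun a b hab => hσ.1 (congrArg Subtype.val hab)⟩, Finset.mem_univ _, rfl⟩
  rw [Finset.sum_congr rfl fun σ hσ => by rw [(Finset.mem_filter.1 hσ).2], Finset.sum_const, hcard,
    nsmul_eq_mul]

end Combinatorics

section ElementarySymmetric

variable {ι : Type*}

/-- The elementary symmetric function of degree `k` of a family of real numbers. -/
noncomputable def elemSymm (s : Finset ι) (w : ι → ℝ) (k : ℕ) : ℝ :=
  ∑ S ∈ s.powersetCard k, ∏ i ∈ S, w i

/-- The elementary symmetric function with every term weighted by a sum over its indices. -/
noncomputable def elemSymmWith (s : Finset ι) (w c : ι → ℝ) (k : ℕ) : ℝ :=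
  ∑ S ∈ s.powersetCard k, (∏ i ∈ S, w i) * ∑ i ∈ S, c i

theorem elemSymm_zero (s : Finset ι) (w : ι → ℝ) : elemSymm s w 0 = 1 := by simp [elemSymm]

theorem elemSymmWith_zero (s : Finset ι) (w c : ι → ℝ) : elemSymmWith s w c 0 = 0 := by
  simp [elemSymmWith]

theorem elemSymm_empty_succ (w : ι → ℝ) (k : ℕ) : elemSymm ∅ w (k + 1) = 0 := by
  rw [elemSymm, Finset.powersetCard_eq_empty.2 (by simp), Finset.sum_empty]

theorem elemSymmWith_empty (w c : ι → ℝ) (k : ℕ) : elemSymmWith ∅ w c k = 0 := by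
  refine Finset.sum_eq_zero fun S hS => ?_
  rw [Finset.subset_empty.1 (Finset.mem_powersetCard.1 hS).1, Finset.sum_empty, mul_zero]

variable [DecidableEq ι]

theorem sum_powersetCard_insert {s : Finset ι} {x : ι} (hx : x ∉ s) (k : ℕ) (F : Finset ι → ℝ) :
    ∑ S ∈ (insert x s).powersetCard (k + 1), F S =
      ∑ S ∈ s.powersetCard (k + 1), F S + ∑ S ∈ s.powersetCard k, F (insert x S) := by
  have hmem : ∀ {j} {S : Finset ι}, S ∈ s.powersetCard j → x ∉ S := fun hS h =>
    hx ((Finset.mem_powersetCard.1 hS).1 h)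
  rw [Finset.powersetCard_succ_insert hx, Finset.sum_union, Finset.sum_image]
  · intro A hA B hB hAB
    rw [← Finset.erase_insert (hmem hA), ← Finset.erase_insert (hmem hB), hAB]
  · rw [Finset.disjoint_left]
    intro A hA hA'
    obtain ⟨B, _, rfl⟩ := Finset.mem_image.1 hA'
    exact hmem hA (Finset.mem_insert_self x B)

theorem elemSymm_insert {s : Finset ι} {x : ι} (hx : x ∉ s) (w : ι → ℝ) (k : ℕ) :
    elemSymm (insert x s) w (k + 1) = elemSymm s w (k + 1) + w x * elemSymm s w k := by
  rw [elemSymm, sum_powersetCard_insert hx, elemSymm, elemSymm, Finset.mul_sum]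
  congr 1
  refine Finset.sum_congr rfl fun S hS => ?_
  rw [Finset.prod_insert fun h => hx ((Finset.mem_powersetCard.1 hS).1 h)]

theorem elemSymmWith_insert {s : Finset ι} {x : ι} (hx : x ∉ s) (w c : ι → ℝ) (k : ℕ) :
    elemSymmWith (insert x s) w c (k + 1) =
      elemSymmWith s w c (k + 1) + w x * (elemSymmWith s w c k + c x * elemSymm s w k) := by
  rw [elemSymmWith, sum_powersetCard_insert hx, elemSymmWith, elemSymmWith, elemSymm,
    Finset.mul_sum, ← Finset.sum_add_distrib, Finset.mul_sum]
  congr 1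
  refine Finset.sum_congr rfl fun S hS => ?_
  have hS' : x ∉ S := fun h => hx ((Finset.mem_powersetCard.1 hS).1 h)
  rw [Finset.prod_insert hS', Finset.sum_insert hS']
  ring

/-- The probability that at most `L - 1` of independent events occur, the event `i` having odds
`ρ * w i`. -/
noncomputable def atMostProb (s : Finset ι) (w : ι → ℝ) (L : ℕ) (ρ : ℝ) : ℝ :=
  (∏ i ∈ s, (1 + ρ * w i)⁻¹) * ∑ k ∈ Finset.range L, ρ ^ k * elemSymm s w k

/-- Conditioning on the event `x`: if it fails, the allowance for the others is unchanged; if it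
occurs, one fewer of them may occur. -/
theorem atMostProb_insert {s : Finset ι} {x : ι} (hx : x ∉ s) (w : ι → ℝ) (L : ℕ) (ρ : ℝ) :
    atMostProb (insert x s) w (L + 1) ρ = (1 + ρ * w x)⁻¹ *
      (atMostProb s w (L + 1) ρ + ρ * w x * atMostProb s w L ρ) := by
  simp only [atMostProb]
  rw [Finset.prod_insert hx, Finset.sum_range_succ', Finset.sum_range_succ' _ L, elemSymm_zero,
    elemSymm_zero]
  simp_rw [elemSymm_insert hx, mul_add, Finset.sum_add_distrib]
  have : ∑ k ∈ Finset.range L, ρ ^ (k + 1) * (w x * elemSymm s w k) =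
      ρ * w x * ∑ k ∈ Finset.range L, ρ ^ k * elemSymm s w k := by
    rw [Finset.mul_sum]
    exact Finset.sum_congr rfl fun k _ => by ring
  rw [this]
  ring

/-- Varying the odds of event i matters only when exactly L - 1 of the others occur. Joining i to
those others gives a set of L indices, whence the elementary symmetric function weighted by a sum
over its indices; the factor (1 + ρ w_i)⁻¹ is left from differentiating the probability of event i.
-/
theorem hasDerivAt_atMostProb (s : Finset ι) {w : ι → ℝ} (hw : ∀ i, 0 ≤ w i) (L : ℕ) {ρ : ℝ}
    (hρ : 0 ≤ ρ) :
    HasDerivAt (atMostProb s w L)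
      (-(ρ ^ (L - 1) * (∏ i ∈ s, (1 + ρ * w i)⁻¹) *
        elemSymmWith s w (fun i => (1 + ρ * w i)⁻¹) L)) ρ := by
  induction s using Finset.induction_on generalizing L with
  | empty =>
    rcases L with _ | L
    · simp only [elemSymmWith_zero, mul_zero, neg_zero]
      have : atMostProb (∅ : Finset ι) w 0 = fun _ => 0 := by ext; simp [atMostProb]
      rw [this]; exact hasDerivAt_const _ _
    · have h1 : atMostProb (∅ : Finset ι) w (L + 1) = fun _ => 1 := by
        ext t
        simp only [atMostProb, Finset.prod_empty, one_mul]
        rw [Finset.sum_range_succ', elemSymm_zero]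
        simp [elemSymm_empty_succ]
      rw [h1, elemSymmWith_empty, mul_zero, neg_zero]
      exact hasDerivAt_const _ _
  | insert x s hx ih =>
    rcases L with _ | L
    · simp only [elemSymmWith_zero, mul_zero, neg_zero]
      have : atMostProb (insert x s) w 0 = fun _ => 0 := by ext; simp [atMostProb]
      rw [this]; exact hasDerivAt_const _ _
    · have h0 : 1 + ρ * w x ≠ 0 := by
        have := mul_nonneg hρ (hw x)
        positivity
      have hU : atMostProb (insert x s) w (L + 1) = fun ρ => (1 + ρ * w x)⁻¹ *
          (atMostProb s w (L + 1) ρ + ρ * w x * atMostProb s w L ρ) := by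
        ext t; exact atMostProb_insert hx w L t
      have hd1 : HasDerivAt (fun ρ : ℝ => ρ * w x) (w x) ρ := by
        simpa using (hasDerivAt_id ρ).mul_const (w x)
      have hd2 := (hd1.const_add 1).inv h0
      have hd := hd2.mul ((ih (L + 1)).add (hd1.mul (ih L)))
      rw [hU]
      refine hd.congr_deriv ?_
      have hstep : atMostProb s w (L + 1) ρ = atMostProb s w L ρ +
          (∏ i ∈ s, (1 + ρ * w i)⁻¹) * (ρ ^ L * elemSymm s w L) := by
        simp only [atMostProb]; rw [Finset.sum_range_succ, mul_add]
      -- The exponent `L - 1` truncates at `L = 0`, where the weighted symmetric function of degree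
      -- `0` vanishes.
      have hpow : ρ * (ρ ^ (L - 1) * (∏ i ∈ s, (1 + ρ * w i)⁻¹) *
          elemSymmWith s w (fun i => (1 + ρ * w i)⁻¹) L) = ρ ^ L * (∏ i ∈ s, (1 + ρ * w i)⁻¹) *
          elemSymmWith s w (fun i => (1 + ρ * w i)⁻¹) L := by
        rcases L with _ | L
        · simp [elemSymmWith_zero]
        · rw [Nat.add_sub_cancel, pow_succ]; ring
      simp only [Pi.add_apply, Pi.mul_apply, Pi.inv_apply, Nat.add_sub_cancel]
      rw [Finset.prod_insert hx, elemSymmWith_insert hx, hstep]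
      set P := ∏ i ∈ s, (1 + ρ * w i)⁻¹
      set g := elemSymmWith s w (fun i => (1 + ρ * w i)⁻¹) L
      set g1 := elemSymmWith s w (fun i => (1 + ρ * w i)⁻¹) (L + 1)
      set U := atMostProb s w L ρ
      set e := elemSymm s w L
      have h3 : ρ * w x * -(ρ ^ (L - 1) * P * g) = -(w x * (ρ ^ L * P * g)) := by
        rw [← hpow]; ring
      rw [h3]
      have hb := inv_mul_cancel₀ h0
      rw [div_eq_mul_inv, ← inv_pow]
      set b := (1 + ρ * w x)⁻¹
      linear_combination (-(w x * b * U)) * hb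

end ElementarySymmetric

section Radial

theorem volume_sumSq_le {L : ℕ} (hL : 1 ≤ L) {a : ℝ} (ha : 0 ≤ a) :
    volume {v : Fin L → ℂ | sumSq v ≤ a} =
      ENNReal.ofReal (Real.pi ^ L / L.factorial * a ^ L) := by
  have : Nonempty (Fin L) := ⟨⟨0, hL⟩⟩
  have h := Complex.volume_sum_rpow_le (Fin L) one_le_two (√a)
  have he : {v : Fin L → ℂ | sumSq v ≤ a} =
      {v : Fin L → ℂ | (∑ i, ‖v i‖ ^ (2 : ℝ)) ^ (1 / 2 : ℝ) ≤ √a} := by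
    ext v
    have h2 : ∑ i, ‖v i‖ ^ (2 : ℝ) = sumSq v := by simp [sumSq]
    rw [Set.mem_ofPred_eq, Set.mem_ofPred_eq, h2, ← Real.sqrt_eq_rpow, Real.sqrt_le_sqrt_iff ha]
  rw [he, h, ← ENNReal.ofReal_pow (Real.sqrt_nonneg a), ← ENNReal.ofReal_mul (by positivity),
    pow_mul, Real.sq_sqrt ha, Fintype.card_fin]
  congr 1
  rw [show (2 : ℝ) / 2 + 1 = 2 by norm_num, Real.Gamma_two,
    show 2 * (L : ℝ) / 2 + 1 = L + 1 by ring, Real.Gamma_nat_eq_factorial]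
  ring

theorem volume_sumSq_lt_one {L : ℕ} :
    volume {v : Fin L → ℂ | sumSq v < 1} = ENNReal.ofReal (Real.pi ^ L / L.factorial) := by
  have h := Complex.volume_sum_rpow_lt_one (Fin L) one_le_two
  have he : {v : Fin L → ℂ | sumSq v < 1} = {v : Fin L → ℂ | ∑ i, ‖v i‖ ^ (2 : ℝ) < 1} := by
    ext v; simp [sumSq]
  rw [he, h, Fintype.card_fin]
  congr 1
  rw [show (2 : ℝ) / 2 + 1 = 2 by norm_num, Real.Gamma_two,
    show 2 * (L : ℝ) / 2 + 1 = L + 1 by ring, Real.Gamma_nat_eq_factorial]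
  ring

/-- Comparison of distribution functions: the ball of squared radius a has volume π^L a^L / L!,
whose derivative in a is the density. -/
theorem map_sumSq_restrict {L : ℕ} (hL : 1 ≤ L) :
    (volume.restrict {v : Fin L → ℂ | sumSq v < 1}).map sumSq =
      (volume.restrict (Set.Ioo (0 : ℝ) 1)).withDensity
        fun ρ => ENNReal.ofReal (Real.pi ^ L / (L - 1).factorial * ρ ^ (L - 1)) := by
  have hfin : IsFiniteMeasure (volume.restrict {v : Fin L → ℂ | sumSq v < 1}) :=
    ⟨by rw [Measure.restrict_apply_univ]; exact volume_sumSq_lt_ne_top.lt_top⟩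
  have hm : Measurable (sumSq (L := L)) := continuous_sumSq.measurable
  have hfin' := Measure.isFiniteMeasure_map (volume.restrict {v : Fin L → ℂ | sumSq v < 1})
    (sumSq (L := L))
  refine Measure.ext_of_Iic _ _ fun a => ?_
  rw [Measure.map_apply hm measurableSet_Iic, Measure.restrict_apply (hm measurableSet_Iic),
    withDensity_apply _ measurableSet_Iic, Measure.restrict_restrict measurableSet_Iic]
  have hint : ∀ b : ℝ, 0 ≤ b → ∫⁻ ρ in Set.Ioc 0 b,
      ENNReal.ofReal (Real.pi ^ L / (L - 1).factorial * ρ ^ (L - 1)) =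
      ENNReal.ofReal (Real.pi ^ L / L.factorial * b ^ L) := by
    intro b hb
    rw [← ofReal_integral_eq_lintegral_ofReal, ← intervalIntegral.integral_of_le hb,
      intervalIntegral.integral_const_mul, integral_pow]
    · congr 1
      obtain ⟨m, rfl⟩ : ∃ m, L = m + 1 := ⟨L - 1, by omega⟩
      simp only [Nat.add_sub_cancel, Nat.factorial_succ]
      push_cast
      field_simp
      simp
    · exact (by fun_prop : Continuous fun ρ : ℝ => Real.pi ^ L / (L - 1).factorial *
        ρ ^ (L - 1)).integrableOn_Ioc
    · filter_upwards [ae_restrict_mem measurableSet_Ioc] with ρ hρ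
      have := hρ.1.le
      positivity
  rcases lt_or_ge a 0 with ha | ha
  · have h1 : sumSq ⁻¹' Set.Iic a ∩ {v : Fin L → ℂ | sumSq v < 1} = ∅ := by
      ext v
      simp only [Set.mem_inter_iff, Set.mem_preimage, Set.mem_Iic, Set.mem_empty_iff_false,
        iff_false, not_and]
      intro h; linarith [sumSq_nonneg v]
    have h2 : Set.Iic a ∩ Set.Ioo (0 : ℝ) 1 = ∅ := by
      ext t
      simp only [Set.mem_inter_iff, Set.mem_Iic, Set.mem_Ioo, Set.mem_empty_iff_false, iff_false]
      intro h; linarith [h.1, h.2.1]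
    rw [h1, h2]; simp
  rcases lt_or_ge a 1 with ha1 | ha1
  · have h1 : sumSq ⁻¹' Set.Iic a ∩ {v : Fin L → ℂ | sumSq v < 1} =
        {v : Fin L → ℂ | sumSq v ≤ a} := by
      ext v
      exact ⟨fun h => h.1, fun h => ⟨h, lt_of_le_of_lt h ha1⟩⟩
    have h2 : Set.Iic a ∩ Set.Ioo (0 : ℝ) 1 = Set.Ioc 0 a := by
      ext t
      exact ⟨fun h => ⟨h.2.1, h.1⟩, fun h => ⟨h.2, h.1, lt_of_le_of_lt h.2 ha1⟩⟩
    rw [h1, h2, hint a ha, volume_sumSq_le hL ha]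
  · have h1 : sumSq ⁻¹' Set.Iic a ∩ {v : Fin L → ℂ | sumSq v < 1} =
        {v : Fin L → ℂ | sumSq v < 1} := by
      ext v
      exact ⟨fun h => h.2, fun h => ⟨(le_of_lt h).trans ha1, h⟩⟩
    have h2 : Set.Iic a ∩ Set.Ioo (0 : ℝ) 1 = Set.Ioo 0 1 := by
      ext t
      exact ⟨fun h => h.2, fun h => ⟨h.2.le.trans ha1, h⟩⟩
    rw [h1, h2, ← restrict_Ioo_eq_restrict_Ioc.symm, hint 1 zero_le_one, volume_sumSq_lt_one]
    simp

theorem integral_comp_sumSq {L : ℕ} (hL : 1 ≤ L) {φ : ℝ → ℝ} (hφ : Measurable φ) :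
    ∫ v in {v : Fin L → ℂ | sumSq v < 1}, φ (sumSq v) =
      Real.pi ^ L / (L - 1).factorial * ∫ ρ in (0 : ℝ)..1, ρ ^ (L - 1) * φ ρ := by
  have hm : Measurable (sumSq (L := L)) := continuous_sumSq.measurable
  rw [← integral_map hm.aemeasurable hφ.aestronglyMeasurable, map_sumSq_restrict hL,
    integral_withDensity_eq_integral_toReal_smul (by fun_prop)
      (.of_forall fun _ => ENNReal.ofReal_lt_top), intervalIntegral.integral_of_le zero_le_one,
    ← restrict_Ioo_eq_restrict_Ioc, ← integral_const_mul]
  refine setIntegral_congr_fun measurableSet_Ioo fun ρ hρ => ?_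
  have := hρ.1.le
  rw [ENNReal.toReal_ofReal (by positivity), smul_eq_mul]
  ring

end Radial

open scoped Matrix in
theorem exp_neg_quadForm_interference {L : ℕ} {ι : Type*} [Fintype ι] (w : ι → ℝ)
    (h : ι → Fin L → ℂ) (v : Fin L → ℂ) :
    Real.exp (-(star v ⬝ᵥ interference w h *ᵥ v).re) =
      ∏ i, Real.exp (-(w i * ‖star v ⬝ᵥ h i‖ ^ 2)) := by
  rw [← Real.exp_sum, Finset.sum_neg_distrib, interference, Matrix.sum_mulVec, dotProduct_sum,
    Complex.re_sum]
  congr 2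
  refine Finset.sum_congr rfl fun i _ => ?_
  have h1 := star_dotProduct_smul_vecMulVec (h i) v (w i)
  rw [Matrix.star_dotProduct (h i) v, norm_star] at h1
  exact h1

/-- Symmetrisation replaces |v_r|² by ρ / L with ρ = |v|². Then L times the bracket is the sum over
the chosen interferers of 1 - ρ w / (1 + ρ w) = (1 + ρ w)⁻¹, and L! = L (L - 1)! accounts for the
ordering. -/
theorem injective_sum_eq_elemSymmWith {L : ℕ} (hL : 1 ≤ L) {ι : Type*} [Fintype ι] [DecidableEq ι]
    {w : ι → ℝ} (hw : ∀ i, 0 ≤ w i) (v : Fin L → ℂ) :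
    ∑ σ : Fin L → ι with Function.Injective σ,
        (∏ r, w (σ r)) * (1 - ∑ r, w (σ r) / (1 + w (σ r) * sumSq v) * ‖v r‖ ^ 2) =
      (L - 1).factorial *
        elemSymmWith Finset.univ w (fun i => (1 + sumSq v * w i)⁻¹) L := by
  have hL0 : (L : ℝ) ≠ 0 := by positivity
  have h1 := sum_injective_symmetrize w (fun i => w i / (1 + w i * sumSq v)) fun r => ‖v r‖ ^ 2
  have h2 := sum_injective_eq_sum_powersetCard (L := L)
    fun S : Finset ι => (∏ i ∈ S, w i) * ∑ i ∈ S, (1 + sumSq v * w i)⁻¹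
  have h3 : ∀ σ ∈ (Finset.univ.filter fun σ : Fin L → ι => Function.Injective σ),
      (∏ i ∈ Finset.univ.image σ, w i) * ∑ i ∈ Finset.univ.image σ, (1 + sumSq v * w i)⁻¹ =
      L * ∏ r, w (σ r) -
        sumSq v * ((∏ r, w (σ r)) * ∑ r, w (σ r) / (1 + w (σ r) * sumSq v)) := by
    intro σ hσ
    have hσ' := (Finset.mem_filter.1 hσ).2
    rw [Finset.prod_image fun a _ b _ h => hσ' h, Finset.sum_image fun a _ b _ h => hσ' h]
    have h4 : ∀ r, (1 + sumSq v * w (σ r))⁻¹ = 1 - sumSq v * (w (σ r) / (1 + w (σ r) * sumSq v)) := by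
      intro r
      have h5 := mul_nonneg (hw (σ r)) (sumSq_nonneg v)
      have h6 : 1 + w (σ r) * sumSq v ≠ 0 := by positivity
      rw [mul_comm (sumSq v) (w (σ r))]
      field_simp
      ring
    simp_rw [h4]
    rw [Finset.sum_sub_distrib, ← Finset.mul_sum]
    simp
    ring
  rw [Finset.sum_congr rfl h3, Finset.sum_sub_distrib, ← Finset.mul_sum, ← Finset.mul_sum] at h2
  have h7 : (L.factorial : ℝ) = L * (L - 1).factorial := by
    exact_mod_cast (Nat.mul_factorial_pred (by omega)).symm
  refine mul_left_cancel₀ hL0 ?_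
  rw [← mul_assoc, ← h7, elemSymmWith, ← h2]
  simp_rw [mul_sub, mul_one]
  rw [Finset.sum_sub_distrib, mul_sub]
  congr 1

/-- The integrand is minus the derivative of `atMostProb`. At ρ = 0 no event occurs and `1 ≤ L`, so
the value there is 1. -/
theorem integral_interference_density {L : ℕ} (hL : 1 ≤ L) {ι : Type*} [Fintype ι] [DecidableEq ι]
    {w : ι → ℝ} (hw : ∀ i, 0 ≤ w i) :
    ∫ ρ in (0 : ℝ)..1, ρ ^ (L - 1) * ((∏ i, (1 + ρ * w i)⁻¹) *
      elemSymmWith Finset.univ w (fun i => (1 + ρ * w i)⁻¹) L) =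
      1 - atMostProb Finset.univ w L 1 := by
  have hc : ∀ i, ContinuousOn (fun ρ : ℝ => (1 + ρ * w i)⁻¹) (Set.uIcc 0 1) := fun i => by
    refine ContinuousOn.inv₀ (by fun_prop) fun ρ hρ => ?_
    rw [Set.uIcc_of_le zero_le_one] at hρ
    have := mul_nonneg hρ.1 (hw i)
    positivity
  have hcont : ContinuousOn (fun ρ : ℝ => -(ρ ^ (L - 1) * (∏ i, (1 + ρ * w i)⁻¹) *
      elemSymmWith Finset.univ w (fun i => (1 + ρ * w i)⁻¹) L)) (Set.uIcc 0 1) := by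
    unfold elemSymmWith
    refine (ContinuousOn.mul (ContinuousOn.mul (by fun_prop)
      (continuousOn_finsetProd _ fun i _ => hc i)) (continuousOn_finsetSum _ fun S _ => ?_)).neg
    exact continuousOn_const.mul (continuousOn_finsetSum _ fun i _ => hc i)
  have h := intervalIntegral.integral_eq_sub_of_hasDerivAt (a := 0) (b := 1)
    (f := atMostProb Finset.univ w L) (fun ρ hρ => by
      rw [Set.uIcc_of_le zero_le_one] at hρ
      exact hasDerivAt_atMostProb Finset.univ hw L hρ.1) hcont.intervalIntegrable
  have h0 : atMostProb Finset.univ w L 0 = 1 := by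
    obtain ⟨m, rfl⟩ : ∃ m, L = m + 1 := ⟨L - 1, by omega⟩
    simp [atMostProb, Finset.sum_range_succ', elemSymm_zero]
  rw [intervalIntegral.integral_neg, h0] at h
  simp_rw [mul_assoc] at h ⊢
  linarith

/-- The mean outage probability for finitely many interferers of given powers. -/
theorem integral_outageProb_interference {L : ℕ} (hL : 1 ≤ L) {ι : Type*} [Fintype ι]
    [DecidableEq ι] {w : ι → ℝ} (hw : ∀ i, 0 ≤ w i) :
    ∫ h : ι → Fin L → ℂ, outageProb (interference w h) ∂(Measure.pi fun _ => channelLaw L) =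
      1 - atMostProb Finset.univ w L 1 := by
  set γ : Measure (ι → Fin L → ℂ) := Measure.pi fun _ => channelLaw L with hγ
  set B : Set (Fin L → ℂ) := {v | sumSq v < 1}
  have hfin : IsFiniteMeasure (volume.restrict B) :=
    ⟨by rw [Measure.restrict_apply_univ]; exact volume_sumSq_lt_ne_top.lt_top⟩
  have hdetc : Continuous fun h : ι → Fin L → ℂ => (interference w h).det := by
    unfold interference
    refine Continuous.matrix_det (continuous_finsetSum _ fun i _ => ?_)
    have hv : Continuous fun h : ι → Fin L → ℂ => Matrix.vecMulVec (h i) (star (h i)) :=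
      Continuous.matrix_vecMulVec (continuous_apply i) (continuous_apply i).star
    exact hv.const_smul (w i)
  let F : (ι → Fin L → ℂ) → (Fin L → ℂ) → ℝ := fun h v =>
    (interference w h).det.re * ∏ i, Real.exp (-(w i * ‖star v ⬝ᵥ h i‖ ^ 2))
  have hFc : Continuous (Function.uncurry F) := by
    refine Continuous.mul (Complex.continuous_re.comp (hdetc.comp continuous_fst))
      (continuous_finsetProd _ fun i _ => Real.continuous_exp.comp (Continuous.neg ?_))
    refine Continuous.const_mul (Continuous.pow (Continuous.norm ?_) 2) _
    exact Continuous.dotProduct continuous_snd.star ((continuous_apply i).comp continuous_fst)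
  -- At v = 0 the tilt is trivial, so the determinant itself is integrable; it dominates `F`, whose
  -- exponential factors are at most 1.
  have hdeti : Integrable (fun h : ι → Fin L → ℂ => (interference w h).det) γ := by
    have h := (integral_det_interference_tilted (0 : Fin L → ℂ) hw).1
    simpa using h
  have hFi : Integrable (Function.uncurry F) (γ.prod (volume.restrict B)) := by
    refine (hdeti.comp_fst (volume.restrict B)).mono hFc.aestronglyMeasurable
      (.of_forall fun x => ?_)
    rw [Function.uncurry, norm_mul]
    refine (mul_le_of_le_one_right (norm_nonneg _) ?_).trans (Complex.abs_re_le_norm _)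
    rw [Real.norm_of_nonneg (Finset.prod_nonneg fun i _ => (Real.exp_pos _).le)]
    refine Finset.prod_le_one (fun i _ => (Real.exp_pos _).le) fun i _ => ?_
    rw [Real.exp_le_one_iff, neg_nonpos]
    exact mul_nonneg (hw i) (sq_nonneg _)
  -- The channel average depends on `v` only through `sumSq v`, which allows the radial reduction
  -- once the integrals are exchanged.
  have hinner : ∀ v : Fin L → ℂ, ∫ h, F h v ∂γ = (L - 1).factorial *
      ((∏ i, (1 + sumSq v * w i)⁻¹) *
        elemSymmWith Finset.univ w (fun i => (1 + sumSq v * w i)⁻¹) L) := by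
    intro v
    obtain ⟨hi, h⟩ := integral_det_interference_tilted v hw
    rw [injective_sum_eq_elemSymmWith hL hw] at h
    have h1 := congrArg Complex.re h
    have h2 := integral_re hi
    simp only [RCLike.re_eq_complex_re] at h2
    rw [← h2, Complex.ofReal_re] at h1
    rw [mul_left_comm]
    simp_rw [mul_comm (sumSq v)] at h1 ⊢
    rw [← h1]
    refine integral_congr_ae (.of_forall fun h => ?_)
    simp only [F]
    rw [← Complex.ofReal_prod, Complex.re_ofReal_mul, mul_comm]
  have hφ : Measurable fun ρ : ℝ => ((L - 1).factorial : ℝ) * ((∏ i, (1 + ρ * w i)⁻¹) *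
      elemSymmWith Finset.univ w (fun i => (1 + ρ * w i)⁻¹) L) := by
    unfold elemSymmWith
    fun_prop
  have hout : ∀ h : ι → Fin L → ℂ,
      outageProb (interference w h) = (Real.pi ^ L)⁻¹ * ∫ v in B, F h v := fun h => by
    rw [outageProb, mul_assoc, ← integral_const_mul]
    simp_rw [exp_neg_quadForm_interference]
    rfl
  simp_rw [hout]
  rw [integral_const_mul, integral_integral_swap hFi]
  simp_rw [hinner]
  rw [integral_comp_sumSq hL hφ, ← integral_interference_density hL hw]
  simp_rw [mul_left_comm (_ ^ (L - 1))]
  rw [intervalIntegral.integral_const_mul]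
  have : ((L - 1).factorial : ℝ) ≠ 0 := by positivity
  field_simp

end

/-! ### Convergence of generating functions; the path-loss integral -/

section

open Filter Topology
open scoped ENNReal NNReal

section GeneratingFunction

/-- Once the lower coefficients vanish, divide by s^k and let s decrease to 0. -/
theorem eq_zero_of_tsum_pow_mul_eq_zero {f : ℕ → ℝ} {C : ℝ} (hf : ∀ k, |f k| ≤ C)
    (h : ∀ s ∈ Set.Ioo (0 : ℝ) 1, ∑' k, s ^ k * f k = 0) (k : ℕ) : f k = 0 := by
  induction k using Nat.strong_induction_on with
  | _ k ih =>
    have h1 : ∀ s ∈ Set.Ioo (0 : ℝ) 1, ∑' j, s ^ j * f (j + k) = 0 := by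
      intro s hs
      have hsum : Summable fun j => s ^ j * f j := by
        refine Summable.of_norm_bounded
          ((summable_geometric_of_lt_one hs.1.le hs.2).mul_right C) fun j => ?_
        rw [norm_mul, norm_pow, Real.norm_of_nonneg hs.1.le]
        exact mul_le_mul_of_nonneg_left (hf j) (pow_nonneg hs.1.le j)
      have h2 := hsum.sum_add_tsum_nat_add k
      rw [h s hs, Finset.sum_eq_zero fun j hj => by
        rw [ih j (Finset.mem_range.1 hj), mul_zero], zero_add] at h2
      simp_rw [pow_add, mul_right_comm, tsum_mul_right] at h2
      exact (mul_eq_zero.1 h2).resolve_right (pow_ne_zero k hs.1.ne')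
    have hlim : Tendsto (fun s : ℝ => ∑' j, s ^ j * f (j + k)) (𝓝[>] 0)
        (𝓝 (∑' j, (0 : ℝ) ^ j * f (j + k))) := by
      refine tendsto_tsum_of_dominated_convergence (bound := fun j => (1 / 2) ^ j * C)
        ((summable_geometric_of_lt_one (by norm_num) (by norm_num)).mul_right C) (fun j => ?_) ?_
      · exact ((by fun_prop : Continuous fun s : ℝ => s ^ j * f (j + k)).tendsto 0).mono_left
          nhdsWithin_le_nhds
      · filter_upwards [Ioo_mem_nhdsGT (show (0 : ℝ) < 1 / 2 by norm_num)] with s hs j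
        rw [norm_mul, norm_pow, Real.norm_of_nonneg hs.1.le]
        exact mul_le_mul (pow_le_pow_left₀ hs.1.le hs.2.le j) (hf _) (abs_nonneg _) (by positivity)
    have h0 : Tendsto (fun s : ℝ => ∑' j, s ^ j * f (j + k)) (𝓝[>] 0) (𝓝 0) := by
      refine tendsto_const_nhds.congr' ?_
      filter_upwards [Ioo_mem_nhdsGT (show (0 : ℝ) < 1 by norm_num)] with s hs
      exact (h1 s hs).symm
    have h3 := tendsto_nhds_unique hlim h0
    rw [tsum_eq_single 0 fun j hj => by rw [zero_pow hj, zero_mul]] at h3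
    simpa using h3

/-- Convergence of generating functions on `(0, 1)` implies convergence of the coefficients. -/
theorem tendsto_coeff_of_tendsto_tsum {b : ℕ → ℕ → ℝ} {c : ℕ → ℝ}
    (hb : ∀ n k, b n k ∈ Set.Icc (0 : ℝ) 1) (hc : ∀ k, c k ∈ Set.Icc (0 : ℝ) 1)
    (h : ∀ s ∈ Set.Ioo (0 : ℝ) 1,
      Tendsto (fun n => ∑' k, s ^ k * b n k) atTop (𝓝 (∑' k, s ^ k * c k))) (k : ℕ) :
    Tendsto (fun n => b n k) atTop (𝓝 (c k)) := by
  -- Along an ultrafilter every coefficient converges, by compactness of [0, 1]; uniqueness of power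
  -- series coefficients then identifies the limits with `c`.
  rw [tendsto_iff_ultrafilter]
  intro U hU
  have hex : ∀ k, ∃ d ∈ Set.Icc (0 : ℝ) 1, Tendsto (fun n => b n k) U (𝓝 d) := fun k =>
    isCompact_Icc.ultrafilter_le_nhds (U.map fun n => b n k)
      (by
        rw [le_principal_iff, Ultrafilter.coe_map]
        exact mem_map.2 (univ_mem' fun n => hb n k))
  choose d hd hdlim using hex
  have habs : ∀ x ∈ Set.Icc (0 : ℝ) 1, |x| ≤ 1 := fun x hx =>
    abs_le.2 ⟨by linarith [hx.1], hx.2⟩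
  have hsummable : ∀ s ∈ Set.Ioo (0 : ℝ) 1, ∀ f : ℕ → ℝ, (∀ k, f k ∈ Set.Icc (0 : ℝ) 1) →
      Summable fun k => s ^ k * f k := fun s hs f hf => by
    refine Summable.of_norm_bounded (summable_geometric_of_lt_one hs.1.le hs.2) fun j => ?_
    rw [norm_mul, norm_pow, Real.norm_of_nonneg hs.1.le]
    exact mul_le_of_le_one_right (pow_nonneg hs.1.le j) (habs _ (hf j))
  have hsum : ∀ s ∈ Set.Ioo (0 : ℝ) 1, ∑' k, s ^ k * (d k - c k) = 0 := by
    intro s hs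
    have h1 : Tendsto (fun n => ∑' k, s ^ k * b n k) U (𝓝 (∑' k, s ^ k * d k)) := by
      refine tendsto_tsum_of_dominated_convergence (bound := fun k => s ^ k)
        (summable_geometric_of_lt_one hs.1.le hs.2) (fun k => (hdlim k).const_mul _)
        (.of_forall fun n k => ?_)
      rw [norm_mul, norm_pow, Real.norm_of_nonneg hs.1.le]
      exact mul_le_of_le_one_right (pow_nonneg hs.1.le k) (habs _ (hb n k))
    have h2 := tendsto_nhds_unique h1 ((h s hs).mono_left hU)
    simp_rw [mul_sub]
    rw [(hsummable s hs d hd).tsum_sub (hsummable s hs c hc), h2, sub_self]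
  have h3 := eq_zero_of_tsum_pow_mul_eq_zero (f := fun k => d k - c k) (C := 1)
    (fun k => abs_le.2 ⟨by linarith [(hd k).1, (hc k).2], by linarith [(hd k).2, (hc k).1]⟩) hsum k
  rw [← sub_eq_zero.1 h3]
  exact hdlim k

end GeneratingFunction

section PathLoss

/-- Transports planar integrals to ℂ for polar coordinates; prescribing the image of 1 aligns the
real axis with the direction of the destination. -/
theorem exists_linearIsometryEquiv_apply_one_eq {u : Plane} (hu : ‖u‖ = 1) :
    ∃ e : ℂ ≃ₗᵢ[ℝ] Plane, e 1 = u := by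
  have hon : Orthonormal ℝ (({0} : Set (Fin 2)).domRestrict fun _ : Fin 2 => u) := by
    refine ⟨fun i => hu, fun i j hij => ?_⟩
    exact absurd (Subsingleton.elim i j) hij
  obtain ⟨b, hb⟩ := hon.exists_orthonormalBasis_extension_of_card_eq (by simp)
  refine ⟨Complex.orthonormalBasisOneI.equiv b (Equiv.refl _), ?_⟩
  have h := Complex.orthonormalBasisOneI.equiv_apply_basis b (Equiv.refl _) 0
  simpa [hb 0 rfl] using h

theorem lintegral_comp_dist (y : Plane) {f : ℝ → ℝ≥0∞} (hf : Measurable f) :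
    ∫⁻ z : Plane, f (dist z y) = ∫⁻ z : ℂ, f ‖z‖ := by
  obtain ⟨e, -⟩ := exists_linearIsometryEquiv_apply_one_eq
    (u := EuclideanSpace.single 0 1) (by simp)
  simp_rw [dist_eq_norm]
  rw [lintegral_sub_right_eq_self (fun z : Plane => f ‖z‖) y,
    ← e.measurePreserving.lintegral_comp (f := fun z => f ‖z‖) (hf.comp measurable_norm)]
  simp

/-- The probability weight attached to an interferer at distance `d`. -/
noncomputable def pathLossWeight (α t d : ℝ) : ℝ := t * d ^ (-α) / (1 + t * d ^ (-α))

theorem pathLossWeight_mem_Icc {α t d : ℝ} (ht : 0 ≤ t) (hd : 0 ≤ d) :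
    pathLossWeight α t d ∈ Set.Icc (0 : ℝ) 1 := by
  have h := mul_nonneg ht (Real.rpow_nonneg hd (-α))
  exact ⟨by unfold pathLossWeight; positivity, div_le_one_of_le₀ (by linarith) (by linarith)⟩

@[fun_prop]
theorem measurable_pathLossWeight (α t : ℝ) : Measurable (pathLossWeight α t) := by
  unfold pathLossWeight; fun_prop

/-- The weight equals t / (t + d^α). Writing the reciprocal as an exponential integral separates t
from d. -/
theorem ofReal_pathLossWeight_eq_lintegral {α t d : ℝ} (ht : 0 < t) (hd : 0 < d) :
    ENNReal.ofReal (pathLossWeight α t d) =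
      ∫⁻ s in Set.Ioi 0, ENNReal.ofReal (t * Real.exp (-t * s) * Real.exp (-s * d ^ α)) := by
  have hc : 0 < t + d ^ α := by positivity
  have h1 : ∀ s : ℝ, t * Real.exp (-t * s) * Real.exp (-s * d ^ α) =
      t * Real.exp (-(t + d ^ α) * s) := fun s => by
    rw [mul_assoc, ← Real.exp_add]; ring_nf
  simp_rw [h1]
  rw [← ofReal_integral_eq_lintegral_ofReal ((exp_neg_integrableOn_Ioi 0 hc).const_mul t)
    (.of_forall fun s => by positivity), integral_const_mul, integral_exp_mul_Ioi (by linarith),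
    pathLossWeight, Real.rpow_neg hd.le]
  congr 1
  have : d ^ α ≠ 0 := by positivity
  rw [mul_zero, Real.exp_zero, neg_div_neg_eq]
  field_simp
  ring

/-- By Tonelli, the planar integral of exp(-s|z|^α) is π Γ(1 + 2/α) s^{-2/α}, and the remaining
integral in s is a Gamma integral of exponent 1 - 2/α, positive since α > 2. The identity Γ(1 + 2/α)
= (2/α) Γ(2/α) produces Δ. -/
theorem lintegral_pathLossWeight {α t : ℝ} (hα : 2 < α) (ht : 0 < t) :
    ∫⁻ z : ℂ, ENNReal.ofReal (pathLossWeight α t ‖z‖) =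
      ENNReal.ofReal (t ^ (2 / α) * contentionConst α) := by
  have hα0 : 0 < α := by linarith
  have ha : 0 < 1 - 2 / α := by
    rw [sub_pos, div_lt_one hα0]; exact hα
  have hΓ1 := Real.Gamma_pos_of_pos (show 0 < 2 / α + 1 by positivity)
  have hΓ2 := Real.Gamma_pos_of_pos ha
  -- The origin is excluded: there `0 ^ (-α) = 0` makes the weight 0 instead of its limit 1.
  have hae : ∀ᵐ z : ℂ, ENNReal.ofReal (pathLossWeight α t ‖z‖) = ∫⁻ s in Set.Ioi 0,
      ENNReal.ofReal (t * Real.exp (-t * s) * Real.exp (-s * ‖z‖ ^ α)) := by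
    filter_upwards [Measure.ae_ne volume (0 : ℂ)] with z hz
    exact ofReal_pathLossWeight_eq_lintegral ht (norm_pos_iff.2 hz)
  rw [lintegral_congr_ae hae, lintegral_lintegral_swap (by fun_prop)]
  have hin : ∀ s ∈ Set.Ioi (0 : ℝ), ∫⁻ z : ℂ,
      ENNReal.ofReal (t * Real.exp (-t * s) * Real.exp (-s * ‖z‖ ^ α)) =
      ENNReal.ofReal (t * Real.pi * Real.Gamma (2 / α + 1) *
        (s ^ ((1 - 2 / α) - 1) * Real.exp (-(t * s)))) := by
    intro s hs
    have hs : 0 < s := hs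
    have hv := Complex.integral_exp_neg_mul_rpow (p := α) (b := s) (by linarith) hs
    -- A non-integrable function has Bochner integral 0 by convention, which the positive value `hv`
    -- rules out.
    have hi : Integrable fun z : ℂ => Real.exp (-s * ‖z‖ ^ α) := by
      by_contra hni
      rw [integral_undef hni] at hv
      exact (by positivity : (0 : ℝ) < Real.pi * s ^ (-2 / α) * Real.Gamma (2 / α + 1)).ne hv
    rw [← ofReal_integral_eq_lintegral_ofReal (hi.const_mul _) (.of_forall fun z => by positivity),
      integral_const_mul, hv]
    congr 1
    rw [show (1 - 2 / α) - 1 = -2 / α by ring, neg_mul]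
    ring
  rw [setLIntegral_congr_fun measurableSet_Ioi hin]
  have hv := Real.integral_rpow_mul_exp_neg_mul_Ioi ha ht
  have hi : IntegrableOn (fun s : ℝ => s ^ ((1 - 2 / α) - 1) * Real.exp (-(t * s)))
      (Set.Ioi 0) := by
    by_contra hni
    rw [integral_undef hni] at hv
    exact (by positivity : (0 : ℝ) < (1 / t) ^ (1 - 2 / α) * Real.Gamma (1 - 2 / α)).ne hv
  rw [← ofReal_integral_eq_lintegral_ofReal (hi.const_mul _), integral_const_mul, hv]
  · congr 1
    have h2 : (1 / t) ^ (1 - 2 / α) = t⁻¹ * t ^ (2 / α) := by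
      rw [one_div, Real.inv_rpow ht.le, Real.rpow_sub ht, Real.rpow_one, inv_div, div_eq_mul_inv,
        mul_comm]
    rw [h2, Real.Gamma_add_one (by positivity), contentionConst]
    field_simp
  · filter_upwards [ae_restrict_mem measurableSet_Ioi] with s hs
    have hs : 0 < s := hs
    simp only [Pi.zero_apply]
    positivity

theorem contentionConst_pos {α : ℝ} (hα : 2 < α) : 0 < contentionConst α := by
  have hα0 : 0 < α := by linarith
  have ha : 0 < 1 - 2 / α := by
    rw [sub_pos, div_lt_one hα0]; exact hα
  have h1 := Real.Gamma_pos_of_pos (show 0 < 2 / α by positivity)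
  have h2 := Real.Gamma_pos_of_pos ha
  unfold contentionConst
  positivity

theorem integrable_pathLossWeight {α t : ℝ} (hα : 2 < α) (ht : 0 < t) (y : Plane) :
    Integrable (fun z : Plane => pathLossWeight α t (dist z y)) ∧
      ∫ z : Plane, pathLossWeight α t (dist z y) = t ^ (2 / α) * contentionConst α := by
  have h1 := lintegral_comp_dist y (f := fun d => ENNReal.ofReal (pathLossWeight α t d))
    (by fun_prop)
  rw [lintegral_pathLossWeight hα ht] at h1
  have hnn : ∀ z : Plane, 0 ≤ pathLossWeight α t (dist z y) := fun z =>
    (pathLossWeight_mem_Icc ht.le dist_nonneg).1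
  have hi : Integrable (fun z : Plane => pathLossWeight α t (dist z y)) := by
    refine ⟨Measurable.aestronglyMeasurable (by fun_prop), ?_⟩
    rw [hasFiniteIntegral_iff_ofReal (.of_forall hnn), h1]
    exact ENNReal.ofReal_lt_top
  have := contentionConst_pos hα
  refine ⟨hi, ?_⟩
  rw [← ENNReal.ofReal_eq_ofReal_iff (integral_nonneg hnn) (by positivity),
    ofReal_integral_eq_lintegral_ofReal hi (.of_forall hnn), h1]

end PathLoss

end

/-! ### Measurability, and the network truncated to its first nodes -/

section

open Filter Topology
open scoped ENNReal NNReal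

section Measurability

variable {L : ℕ}

noncomputable instance : MeasurableSpace (Matrix (Fin L) (Fin L) ℂ) := borel _

instance : BorelSpace (Matrix (Fin L) (Fin L) ℂ) := ⟨rfl⟩

instance : SecondCountableTopology (Matrix (Fin L) (Fin L) ℂ) :=
  inferInstanceAs (SecondCountableTopology (Fin L → Fin L → ℂ))

instance : TopologicalSpace.IsCompletelyPseudoMetrizableSpace (Matrix (Fin L) (Fin L) ℂ) :=
  inferInstanceAs (TopologicalSpace.IsCompletelyPseudoMetrizableSpace (Fin L → Fin L → ℂ))

theorem measurable_outageProb : Measurable (outageProb (L := L)) := by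
  unfold outageProb
  refine Measurable.mul (Measurable.const_mul (Continuous.measurable (by fun_prop)) _) ?_
  have hc : Continuous fun x : Matrix (Fin L) (Fin L) ℂ × (Fin L → ℂ) =>
      Real.exp (-(star x.2 ⬝ᵥ x.1.mulVec x.2).re) := by fun_prop
  exact (hc.stronglyMeasurable.integral_prod_right'
    (ν := volume.restrict {v : Fin L → ℂ | sumSq v < 1})).measurable

theorem measurable_matrix_inv : Measurable fun A : Matrix (Fin L) (Fin L) ℂ => A⁻¹ := by
  have h : (fun A : Matrix (Fin L) (Fin L) ℂ => A⁻¹) = fun A => (A.det)⁻¹ • A.adjugate := by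
    ext1 A
    rw [Matrix.inv_def, Ring.inverse_eq_inv']
  rw [h]
  have h1 : Measurable fun A : Matrix (Fin L) (Fin L) ℂ => A.det :=
    (continuous_id.matrix_det).measurable
  have h2 : Measurable fun A : Matrix (Fin L) (Fin L) ℂ => A.adjugate :=
    (continuous_id.matrix_adjugate).measurable
  exact h1.inv.smul h2

theorem continuous_vecMulVec_star :
    Continuous fun v : Fin L → ℂ => Matrix.vecMulVec v (star v) :=
  Continuous.matrix_vecMulVec continuous_id continuous_id.star

theorem continuous_interference {ι : Type*} [Fintype ι] :
    Continuous fun x : (ι → ℝ) × (ι → Fin L → ℂ) => interference x.1 x.2 := by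
  unfold interference
  refine continuous_finsetSum _ fun i _ => ?_
  have h1 : Continuous fun x : (ι → ℝ) × (ι → Fin L → ℂ) => x.1 i := by fun_prop
  have h2 : Continuous fun x : (ι → ℝ) × (ι → Fin L → ℂ) =>
      Matrix.vecMulVec (x.2 i) (star (x.2 i)) :=
    continuous_vecMulVec_star.comp (by fun_prop)
  exact h1.smul h2

open scoped ComplexOrder in
theorem posSemidef_interference {ι : Type*} [Fintype ι] {w : ι → ℝ} (hw : ∀ i, 0 ≤ w i)
    (h : ι → Fin L → ℂ) : (interference w h).PosSemidef :=
  Matrix.posSemidef_sum _ fun i _ => (Matrix.posSemidef_vecMulVec_self_star (h i)).smul (hw i)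

open scoped ComplexOrder in
theorem posSemidef_of_tendsto {u : ℕ → Matrix (Fin L) (Fin L) ℂ} {R : Matrix (Fin L) (Fin L) ℂ}
    (hu : ∀ n, (u n).PosSemidef) (h : Tendsto u atTop (𝓝 R)) : R.PosSemidef := by
  refine Matrix.PosSemidef.of_dotProduct_mulVec_nonneg ?_ fun v => ?_
  · refine tendsto_nhds_unique (((by fun_prop : Continuous fun A : Matrix (Fin L) (Fin L) ℂ =>
      A.conjTranspose).tendsto R).comp h) (h.congr fun n => ?_)
    exact (hu n).isHermitian.symm
  · exact ge_of_tendsto' (((by fun_prop : Continuous fun A : Matrix (Fin L) (Fin L) ℂ =>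
      star v ⬝ᵥ A.mulVec v).tendsto R).comp h) fun n => (hu n).dotProduct_mulVec_nonneg v

end Measurability

/-- Both groupings of the joint law give the same triple product, by associativity of product
measures. -/
theorem indepFun_prodMk_of_indepFun {Ω A B C : Type*} [MeasurableSpace Ω] [MeasurableSpace A]
    [MeasurableSpace B] [MeasurableSpace C] {μ : Measure Ω} [IsProbabilityMeasure μ]
    {f : Ω → A} {g : Ω → B} {k : Ω → C} (hf : Measurable f) (hg : Measurable g)
    (hk : Measurable k) (h1 : IndepFun f (fun ω => (g ω, k ω)) μ) (h2 : IndepFun g k μ) :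
    IndepFun (fun ω => (f ω, g ω)) k μ := by
  have hfg : IndepFun f g μ := h1.comp measurable_id measurable_fst
  have := Measure.isProbabilityMeasure_map (μ := μ) hf.aemeasurable
  have := Measure.isProbabilityMeasure_map (μ := μ) hg.aemeasurable
  have := Measure.isProbabilityMeasure_map (μ := μ) hk.aemeasurable
  rw [indepFun_iff_map_prod_eq_prod_map_map (hf.prodMk hg).aemeasurable hk.aemeasurable,
    (indepFun_iff_map_prod_eq_prod_map_map hf.aemeasurable hg.aemeasurable).1 hfg]
  rw [indepFun_iff_map_prod_eq_prod_map_map hf.aemeasurable (hg.prodMk hk).aemeasurable,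
    (indepFun_iff_map_prod_eq_prod_map_map hg.aemeasurable hk.aemeasurable).1 h2] at h1
  refine MeasurableEquiv.map_measurableEquiv_injective MeasurableEquiv.prodAssoc ?_
  rw [Measure.prodAssoc_prod, ← h1,
    Measure.map_map MeasurableEquiv.prodAssoc.measurable ((hf.prodMk hg).prodMk hk)]
  rfl

theorem elemSymm_nonneg {ι : Type*} (s : Finset ι) {w : ι → ℝ} (hw : ∀ i, 0 ≤ w i) (k : ℕ) :
    0 ≤ elemSymm s w k :=
  Finset.sum_nonneg fun _ _ => Finset.prod_nonneg fun i _ => hw i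

theorem elemSymm_le_prod {ι : Type*} (s : Finset ι) {w : ι → ℝ} (hw : ∀ i, 0 ≤ w i) (k : ℕ) :
    elemSymm s w k ≤ ∏ i ∈ s, (1 + w i) := by
  classical
  rw [Finset.prod_one_add]
  refine Finset.sum_le_sum_of_subset_of_nonneg (fun S hS => ?_)
    fun _ _ _ => Finset.prod_nonneg fun i _ => hw i
  exact Finset.mem_powerset.2 (Finset.mem_powersetCard.1 hS).1

theorem prod_one_add_mul_eq_sum_elemSymm {ι : Type*} (s : Finset ι) (w : ι → ℝ) (z : ℝ) :
    ∏ i ∈ s, (1 + z * w i) = ∑ k ∈ Finset.range (s.card + 1), z ^ k * elemSymm s w k := by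
  classical
  rw [Finset.prod_one_add, Finset.sum_powerset]
  refine Finset.sum_congr rfl fun k _ => ?_
  rw [elemSymm, Finset.mul_sum]
  refine Finset.sum_congr rfl fun S hS => ?_
  rw [Finset.prod_mul_distrib, Finset.prod_const, (Finset.mem_powersetCard.1 hS).2]

theorem elemSymm_eq_zero {ι : Type*} {s : Finset ι} (w : ι → ℝ) {k : ℕ} (hk : s.card < k) :
    elemSymm s w k = 0 := by
  rw [elemSymm, Finset.powersetCard_eq_empty.2 hk, Finset.sum_empty]

namespace AlohaNetwork

variable {Ω : Type*} {L : ℕ} {N : AlohaNetwork Ω L}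

/-- The power received from node `i` at `y`, multiplied by `t`. -/
noncomputable def power (N : AlohaNetwork Ω L) (α t : ℝ) (y : Plane) (i : ℕ) (ω : Ω) : ℝ :=
  if N.T i ω = true then t * dist (N.X i ω) y ^ (-α) else 0

theorem power_nonneg {α t : ℝ} (ht : 0 ≤ t) (y : Plane) (i : ℕ) (ω : Ω) :
    0 ≤ N.power α t y i ω := by
  unfold power
  split_ifs
  · exact mul_nonneg ht (Real.rpow_nonneg dist_nonneg _)
  · exact le_rfl

/-- The conditional probability, given locations and transmissions, that `k` of the first `n`
nodes are marked, a node of power `w` being marked with probability `w / (1 + w)`. -/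
noncomputable def markedProb (N : AlohaNetwork Ω L) (α t : ℝ) (y : Plane) (n k : ℕ) (ω : Ω) : ℝ :=
  (∏ i : Fin n, (1 + N.power α t y i ω)⁻¹) *
    elemSymm Finset.univ (fun i : Fin n => N.power α t y i ω) k

theorem markedProb_mem_Icc {α t : ℝ} (ht : 0 ≤ t) (y : Plane) (n k : ℕ) (ω : Ω) :
    N.markedProb α t y n k ω ∈ Set.Icc (0 : ℝ) 1 := by
  have hw : ∀ i : Fin n, 0 ≤ N.power α t y i ω := fun i => power_nonneg ht y i ω
  have hpos : 0 < ∏ i : Fin n, (1 + N.power α t y i ω) :=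
    Finset.prod_pos fun i _ => by linarith [hw i]
  rw [markedProb, Finset.prod_inv_distrib]
  refine ⟨mul_nonneg (inv_nonneg.2 hpos.le) (elemSymm_nonneg _ hw k), ?_⟩
  rw [inv_mul_le_one₀ hpos]
  exact elemSymm_le_prod _ hw k

/-- Generating function of the number of marked nodes: a transmitter contributes (1 + s w) / (1 + w)
= 1 - (1 - s) w / (1 + w), the form to which the Laplace functional applies. -/
theorem sum_pow_mul_markedProb {α t : ℝ} (ht : 0 ≤ t) (y : Plane) (n : ℕ) (s : ℝ) (ω : Ω) :
    ∑ k ∈ Finset.range (n + 1), s ^ k * N.markedProb α t y n k ω =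
      ∏ i ∈ Finset.range n, (1 - if N.T i ω = true then
        (1 - s) * pathLossWeight α t (dist (N.X i ω) y) else 0) := by
  have h1 := prod_one_add_mul_eq_sum_elemSymm Finset.univ (fun i : Fin n => N.power α t y i ω) s
  rw [Finset.card_univ, Fintype.card_fin] at h1
  have h2 : ∑ k ∈ Finset.range (n + 1), s ^ k * N.markedProb α t y n k ω =
      (∏ i : Fin n, (1 + N.power α t y i ω)⁻¹) * ∏ i : Fin n, (1 + s * N.power α t y i ω) := by
    rw [h1, Finset.mul_sum]
    exact Finset.sum_congr rfl fun k _ => by rw [markedProb]; ring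
  rw [h2, Finset.prod_range, ← Finset.prod_mul_distrib]
  refine Finset.prod_congr rfl fun i _ => ?_
  have hw := power_nonneg (N := N) (α := α) ht y i ω
  unfold power at hw ⊢
  unfold pathLossWeight
  split_ifs at hw ⊢
  · have : 1 + t * dist (N.X i ω) y ^ (-α) ≠ 0 := by positivity
    field_simp
    ring
  · simp

variable [MeasurableSpace Ω] {μ : Measure Ω} {lam p : ℝ}

theorem HasLaw.measurable_power (h : N.HasLaw μ lam p) (α t : ℝ) (y : Plane) (i : ℕ) :
    Measurable (N.power α t y i) := by
  unfold power
  refine Measurable.ite (h.measurable_T i (measurableSet_singleton true)) ?_ measurable_const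
  have := h.poisson.measurable i
  fun_prop

theorem HasLaw.measurable_markedProb (h : N.HasLaw μ lam p) (α t : ℝ) (y : Plane) (n k : ℕ) :
    Measurable (N.markedProb α t y n k) := by
  unfold markedProb elemSymm
  have := h.measurable_power α t y
  fun_prop

theorem HasLaw.integrable_markedProb [IsProbabilityMeasure μ] (h : N.HasLaw μ lam p) {α t : ℝ}
    (ht : 0 ≤ t) (y : Plane) (n k : ℕ) : Integrable (N.markedProb α t y n k) μ :=
  Integrable.of_bound (h.measurable_markedProb α t y n k).aestronglyMeasurable 1
    (.of_forall fun ω => by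
      have := markedProb_mem_Icc (N := N) (α := α) ht y n k ω
      rw [Real.norm_of_nonneg this.1]; exact this.2)

/-- By the Laplace functional of the transmitters, the generating functions converge to exp(-m(1 -
s)), that of a Poisson variable of mean m. -/
theorem HasLaw.tendsto_integral_markedProb [IsProbabilityMeasure μ] (h : N.HasLaw μ lam p)
    (hlam : 0 < lam) (hp : 0 < p) {α t : ℝ} (hα : 2 < α) (ht : 0 < t) (y : Plane) (k : ℕ) :
    Tendsto (fun n => ∫ ω, N.markedProb α t y n k ω ∂μ) atTop
      (𝓝 (Real.exp (-(lam * (p * (t ^ (2 / α) * contentionConst α)))) *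
        (lam * (p * (t ^ (2 / α) * contentionConst α))) ^ k / k.factorial)) := by
  have hΔ := contentionConst_pos hα
  set m : ℝ := lam * (p * (t ^ (2 / α) * contentionConst α)) with hm
  have hm0 : 0 ≤ m := by positivity
  obtain ⟨hqi, hqv⟩ := integrable_pathLossWeight hα ht y
  have hT : ∀ i, μ.real {ω | N.T i ω = true} = p := fun i => by
    rw [measureReal_def, h.transmit_prob, ENNReal.toReal_ofReal hp.le]
  refine tendsto_coeff_of_tendsto_tsum (b := fun n k => ∫ ω, N.markedProb α t y n k ω ∂μ)
    (c := fun k => Real.exp (-m) * m ^ k / k.factorial) (fun n k => ⟨?_, ?_⟩) (fun k => ?_)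
    (fun s hs => ?_) k
  · exact integral_nonneg fun ω => (markedProb_mem_Icc ht.le y n k ω).1
  · refine (integral_mono (h.integrable_markedProb ht.le y n k) (integrable_const 1)
      fun ω => (markedProb_mem_Icc ht.le y n k ω).2).trans ?_
    simp
  · have h1 := poissonMeasure_real_singleton (Real.toNNReal m) k
    rw [Real.coe_toNNReal _ hm0] at h1
    rw [← h1]
    exact ⟨measureReal_nonneg, measureReal_le_one⟩
  · have hlim := h.tendsto_integral_prod_marked hlam.le true hT
      (g := fun z => (1 - s) * pathLossWeight α t (dist z y)) (by fun_prop)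
      (fun z => by
        have := pathLossWeight_mem_Icc (α := α) ht.le (dist_nonneg (x := z) (y := y))
        exact ⟨mul_nonneg (by linarith [hs.2]) this.1,
          mul_le_one₀ (by linarith [hs.1]) this.1 this.2⟩)
      (hqi.const_mul _)
    have h2 : ∑' k, s ^ k * (Real.exp (-m) * m ^ k / k.factorial) =
        Real.exp (-(lam * (p * ∫ z, (1 - s) * pathLossWeight α t (dist z y)))) := by
      have h3 := integral_pow_poissonMeasure (Real.toNNReal m) s
      rw [integral_poissonMeasure, Real.coe_toNNReal _ hm0] at h3
      rw [integral_const_mul, hqv]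
      refine Eq.trans ?_ (h3.trans ?_)
      · exact tsum_congr fun k => by rw [smul_eq_mul, mul_comm]
      · congr 1; rw [hm]; ring
    rw [h2]
    refine hlim.congr fun n => ?_
    have h4 : ∀ k ∉ Finset.range (n + 1), s ^ k * ∫ ω, N.markedProb α t y n k ω ∂μ = 0 := by
      intro k hk
      rw [Finset.mem_range, not_lt] at hk
      have : ∀ ω, N.markedProb α t y n k ω = 0 := fun ω => by
        rw [markedProb, elemSymm_eq_zero _ (by rw [Finset.card_univ, Fintype.card_fin]; omega),
          mul_zero]
      simp [this]
    rw [tsum_eq_sum h4]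
    simp_rw [← sum_pow_mul_markedProb ht.le y n s]
    rw [integral_finsetSum _ fun k _ => (h.integrable_markedProb ht.le y n k).const_mul _]
    exact Finset.sum_congr rfl fun k _ => integral_const_mul _ _

theorem HasLaw.measurable_locations (h : N.HasLaw μ lam p) : Measurable fun ω i => N.X i ω :=
  measurable_pi_lambda _ h.poisson.measurable

theorem HasLaw.measurable_transmissions (h : N.HasLaw μ lam p) : Measurable fun ω i => N.T i ω :=
  measurable_pi_lambda _ h.measurable_T

theorem HasLaw.measurable_channels (h : N.HasLaw μ lam p) : Measurable fun ω i => N.h i ω :=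
  measurable_pi_lambda _ h.measurable_h

theorem HasLaw.indepFun_channels [IsProbabilityMeasure μ] (h : N.HasLaw μ lam p) :
    IndepFun (fun ω => ((fun i => N.X i ω), fun i => N.T i ω)) (fun ω i => N.h i ω) μ :=
  indepFun_prodMk_of_indepFun h.measurable_locations h.measurable_transmissions
    h.measurable_channels
    (h.indep_X_rest.comp measurable_id
      (measurable_fst.prodMk (measurable_fst.comp measurable_snd)))
    (h.indep_T_rest.comp measurable_id measurable_fst)

theorem HasLaw.indepFun_link [IsProbabilityMeasure μ] (h : N.HasLaw μ lam p) :
    IndepFun (fun ω => ((fun i => N.X i ω), ((fun i => N.T i ω), fun i => N.h i ω))) N.h₀ μ := by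
  refine indepFun_prodMk_of_indepFun h.measurable_locations
    (h.measurable_transmissions.prodMk h.measurable_channels) h.measurable_h₀ ?_ ?_
  · exact h.indep_X_rest.comp measurable_id ((measurable_fst.prodMk
      (measurable_fst.comp measurable_snd)).prodMk (measurable_snd.comp measurable_snd))
  · exact indepFun_prodMk_of_indepFun h.measurable_transmissions h.measurable_channels
      h.measurable_h₀ h.indep_T_rest h.indep_h_h₀

/-- The mean outage probability due to the first `n` nodes. -/
theorem HasLaw.integral_outageProb_truncated [IsProbabilityMeasure μ] (h : N.HasLaw μ lam p)
    (hL : 1 ≤ L) {α t : ℝ} (ht : 0 ≤ t) (y : Plane) (n : ℕ) :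
    ∫ ω, outageProb (interference (fun i : Fin n => N.power α t y i ω) fun i => N.h i ω) ∂μ =
      1 - ∑ k ∈ Finset.range L, ∫ ω, N.markedProb α t y n k ω ∂μ := by
  let W : Ω → Fin n → ℝ := fun ω i => N.power α t y i ω
  let H : Ω → Fin n → Fin L → ℂ := fun ω i => N.h i ω
  have hW : Measurable W := measurable_pi_lambda _ fun i => h.measurable_power α t y i
  have hH : Measurable H := measurable_pi_lambda _ fun i => h.measurable_h i
  -- The powers depend only on locations and transmissions, so they can be frozen and the formula
  -- for deterministic powers applied inside the mean.
  have hind : IndepFun W H μ := by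
    let φ : (ℕ → Plane) × (ℕ → Bool) → Fin n → ℝ := fun x i =>
      if x.2 i = true then t * dist (x.1 i) y ^ (-α) else 0
    have hφ : Measurable φ := measurable_pi_lambda _ fun i => Measurable.ite
      ((show Measurable fun x : (ℕ → Plane) × (ℕ → Bool) => x.2 i by fun_prop)
        (measurableSet_singleton true)) (by fun_prop) measurable_const
    let ψ : (ℕ → Fin L → ℂ) → Fin n → Fin L → ℂ := fun x i => x i
    have hψ : Measurable ψ := by fun_prop
    exact h.indepFun_channels.comp hφ hψ
  have hmapH : μ.map H = Measure.pi fun _ : Fin n => channelLaw L := by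
    have hi : iIndepFun (fun (i : Fin n) => N.h i) μ := h.indep_h.precomp (g := fun i : Fin n => (i : ℕ))
      Fin.val_injective
    have h1 := iIndepFun.map_fun_eq_pi_map (f := fun (i : Fin n) => N.h i)
      (fun i => (h.measurable_h i).aemeasurable) hi
    exact h1.trans (congrArg Measure.pi (funext fun i => h.law_h i))
  have hjoint := (indepFun_iff_map_prod_eq_prod_map_map hW.aemeasurable hH.aemeasurable).1 hind
  rw [hmapH] at hjoint
  let F : (Fin n → ℝ) × (Fin n → Fin L → ℂ) → ℝ := fun x => outageProb (interference x.1 x.2)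
  have hF : Measurable F := measurable_outageProb.comp continuous_interference.measurable
  have hbd : ∀ ω, F (W ω, H ω) ∈ Set.Icc (0 : ℝ) 1 := fun ω =>
    outageProb_mem_Icc
      (posSemidef_interference (w := W ω) (fun i => power_nonneg ht y i ω) (H ω))
  have hFi : Integrable F (μ.map fun ω => (W ω, H ω)) := by
    rw [integrable_map_measure hF.aestronglyMeasurable (hW.prodMk hH).aemeasurable]
    exact Integrable.of_bound (hF.comp (hW.prodMk hH)).aestronglyMeasurable 1
      (.of_forall fun ω => by
        rw [Function.comp_apply, Real.norm_of_nonneg (hbd ω).1]; exact (hbd ω).2)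
  have hprob := Measure.isProbabilityMeasure_map (μ := μ) hW.aemeasurable
  have h1 : ∫ ω, F (W ω, H ω) ∂μ =
      ∫ ω, ∫ η, F (W ω, η) ∂(Measure.pi fun _ : Fin n => channelLaw L) ∂μ := by
    rw [← integral_map (f := F) (hW.prodMk hH).aemeasurable hF.aestronglyMeasurable, hjoint,
      integral_prod _ (by rwa [hjoint] at hFi),
      ← integral_map (f := fun w => ∫ η, F (w, η) ∂(Measure.pi fun _ : Fin n => channelLaw L))
        hW.aemeasurable hF.stronglyMeasurable.integral_prod_right'.aestronglyMeasurable]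
  change ∫ ω, F (W ω, H ω) ∂μ = _
  rw [h1, ← integral_finsetSum _ fun k _ => h.integrable_markedProb ht y n k]
  have h2 : ∀ ω, ∫ η, F (W ω, η) ∂(Measure.pi fun _ : Fin n => channelLaw L) =
      1 - ∑ k ∈ Finset.range L, N.markedProb α t y n k ω := fun ω => by
    have h3 := integral_outageProb_interference hL (w := W ω) fun i => power_nonneg ht y i ω
    refine h3.trans ?_
    simp only [atMostProb, one_mul, one_pow, markedProb, Finset.mul_sum]
    rfl
  simp_rw [h2]
  rw [integral_sub (integrable_const _)
    (integrable_finsetSum _ fun k _ => h.integrable_markedProb ht y n k)]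
  simp

end AlohaNetwork

end

/-! ### Infinite interference and the law of the signal-to-interference ratio -/

section

open Filter Topology
open scoped ENNReal NNReal

theorem integrable_sumSq {L : ℕ} : Integrable (sumSq (L := L)) (channelLaw L) := by
  unfold sumSq
  refine integrable_finsetSum _ fun r _ => ?_
  exact (measurePreserving_eval (fun _ : Fin L => complexNormal) r).integrable_comp_of_integrable
    (g := fun z : ℂ => ‖z‖ ^ 2) integrable_complexNormal_sq.1

theorem norm_vecMulVec_star_apply_le {L : ℕ} (v : Fin L → ℂ) (r s : Fin L) :
    ‖Matrix.vecMulVec v (star v) r s‖ ≤ sumSq v := by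
  have h1 : ∀ r, ‖v r‖ ^ 2 ≤ sumSq v := fun r =>
    Finset.single_le_sum (f := fun r => ‖v r‖ ^ 2) (fun _ _ => by positivity) (Finset.mem_univ r)
  rw [Matrix.vecMulVec_apply, Pi.star_apply, norm_mul, norm_star]
  nlinarith [h1 r, h1 s, sq_nonneg (‖v r‖ - ‖v s‖)]

namespace AlohaNetwork

variable {Ω : Type*} [MeasurableSpace Ω] {μ : Measure Ω} {L : ℕ} {N : AlohaNetwork Ω L}
  {lam p : ℝ}

/-- The gain d^{-α} is not integrable near the receiver, so Campbell's formula is applied to the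
bounded weight d^{-α} / (1 + d^{-α}). Beyond distance 1 the gain is at most twice this weight, and
almost surely only finitely many nodes are closer. -/
theorem HasLaw.ae_summable_power [IsProbabilityMeasure μ] (h : N.HasLaw μ lam p)
    (hlam : 0 < lam) {α : ℝ} (hα : 2 < α) (y : Plane) :
    ∀ᵐ ω ∂μ, Summable fun i => dist (N.X i ω) y ^ (-α) * sumSq (N.h i ω) := by
  obtain ⟨hq, -⟩ := integrable_pathLossWeight hα one_pos y
  have hw01 : ∀ z : Plane, pathLossWeight α 1 (dist z y) ∈ Set.Icc (0 : ℝ) 1 := fun z =>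
    pathLossWeight_mem_Icc zero_le_one dist_nonneg
  have hfin : ∑' i, ∫⁻ ω, ENNReal.ofReal (pathLossWeight α 1 (dist (N.X i ω) y)) *
      ENNReal.ofReal (sumSq (N.h i ω)) ∂μ ≠ ⊤ := by
    have h1 : ∀ i, ∫⁻ ω, ENNReal.ofReal (pathLossWeight α 1 (dist (N.X i ω) y)) *
        ENNReal.ofReal (sumSq (N.h i ω)) ∂μ =
        (∫⁻ ω, ENNReal.ofReal (pathLossWeight α 1 (dist (N.X i ω) y)) ∂μ) *
          ∫⁻ v, ENNReal.ofReal (sumSq v) ∂(channelLaw L) := fun i => by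
      have hs : Measurable fun v : Fin L → ℂ => ENNReal.ofReal (sumSq v) :=
        continuous_sumSq.measurable.ennreal_ofReal
      have hX : Measurable fun z : Plane => ENNReal.ofReal (pathLossWeight α 1 (dist z y)) := by
        fun_prop
      rw [← h.law_h i, lintegral_map hs (h.measurable_h i)]
      refine lintegral_mul_eq_lintegral_mul_lintegral_of_indepFun''
        (hX.comp (h.poisson.measurable i)).aemeasurable
        (hs.comp (h.measurable_h i)).aemeasurable ?_
      exact h.indepFun_channels.comp (hX.comp ((measurable_pi_apply i).comp measurable_fst))
        (hs.comp (measurable_pi_apply i))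
    simp_rw [h1]
    rw [ENNReal.tsum_mul_right, h.poisson.tsum_lintegral hlam.le
      (f := fun z => ENNReal.ofReal (pathLossWeight α 1 (dist z y))) (by fun_prop)]
    refine ENNReal.mul_ne_top (ENNReal.mul_ne_top ENNReal.ofReal_ne_top ?_) ?_
    · exact (hasFiniteIntegral_iff_ofReal (.of_forall fun z => (hw01 z).1)).1 hq.2 |>.ne
    · exact (hasFiniteIntegral_iff_ofReal
        (.of_forall fun v => sumSq_nonneg v)).1 integrable_sumSq.2 |>.ne
  have hmeas : ∀ i, Measurable fun ω => ENNReal.ofReal (pathLossWeight α 1 (dist (N.X i ω) y)) *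
      ENNReal.ofReal (sumSq (N.h i ω)) := fun i => by
    have h1 := h.poisson.measurable i
    have h2 := continuous_sumSq.measurable.comp (h.measurable_h i)
    exact Measurable.mul (by fun_prop) h2.ennreal_ofReal
  rw [← lintegral_tsum fun i => (hmeas i).aemeasurable] at hfin
  filter_upwards [ae_lt_top (Measurable.tsum hmeas) hfin,
    h.poisson.ae_pointCount_ne_top (measurableSet_closedBall (x := y) (ε := 1))
      (isCompact_closedBall y 1).measure_lt_top.ne] with ω hω hcount
  have hsum : Summable fun i =>
      pathLossWeight α 1 (dist (N.X i ω) y) * sumSq (N.h i ω) := by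
    refine (ENNReal.summable_toReal hω.ne).congr fun i => ?_
    rw [ENNReal.toReal_mul, ENNReal.toReal_ofReal (hw01 _).1,
      ENNReal.toReal_ofReal (sumSq_nonneg _)]
  refine Summable.of_norm_bounded_eventually (hsum.mul_left 2) ?_
  have hF : {i : ℕ | N.X i ω ∈ Metric.closedBall y 1}.Finite := Set.encard_ne_top_iff.1 hcount
  filter_upwards [hF.compl_mem_cofinite] with i hi
  have hd : 1 < dist (N.X i ω) y := by simpa using hi
  have hP0 : 0 < dist (N.X i ω) y ^ (-α) := Real.rpow_pos_of_pos (by linarith) _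
  have hP1 : dist (N.X i ω) y ^ (-α) ≤ 1 :=
    Real.rpow_le_one_of_one_le_of_nonpos hd.le (by linarith)
  rw [Real.norm_of_nonneg (mul_nonneg hP0.le (sumSq_nonneg _)), ← mul_assoc]
  refine mul_le_mul_of_nonneg_right ?_ (sumSq_nonneg _)
  rw [pathLossWeight, one_mul, ← mul_div_assoc, le_div_iff₀ (by linarith)]
  nlinarith

/-- Needed because the `tsum` defining the covariance would be 0 by convention without summability.
-/
theorem HasLaw.ae_summable_covariance [IsProbabilityMeasure μ] (h : N.HasLaw μ lam p)
    (hlam : 0 < lam) {α : ℝ} (hα : 2 < α) (y : Plane) :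
    ∀ᵐ ω ∂μ, Summable fun i => if N.T i ω = true then
      (dist (N.X i ω) y ^ (-α)) • Matrix.vecMulVec (N.h i ω) (star (N.h i ω)) else 0 := by
  filter_upwards [h.ae_summable_power hlam hα y] with ω hω
  refine Pi.summable.2 fun r => Pi.summable.2 fun s => ?_
  refine Summable.of_norm_bounded hω fun i => ?_
  have hP0 : 0 ≤ dist (N.X i ω) y ^ (-α) := Real.rpow_nonneg dist_nonneg _
  split_ifs
  · rw [Matrix.smul_apply, norm_smul, Real.norm_of_nonneg hP0]
    exact mul_le_mul_of_nonneg_left (norm_vecMulVec_star_apply_le _ r s) hP0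
  · rw [Matrix.zero_apply, norm_zero]
    exact mul_nonneg hP0 (sumSq_nonneg _)

theorem HasLaw.ae_tendsto_interference [IsProbabilityMeasure μ] (h : N.HasLaw μ lam p)
    (hlam : 0 < lam) {α : ℝ} (hα : 2 < α) (y : Plane) :
    ∀ᵐ ω ∂μ, ∀ t : ℝ, Tendsto (fun n => interference (fun i : Fin n => N.power α t y i ω)
      fun i : Fin n => N.h i ω) atTop (𝓝 (t • N.covariance α y ω)) := by
  filter_upwards [h.ae_summable_covariance hlam hα y] with ω hω t
  refine (hω.hasSum.tendsto_sum_nat.const_smul t).congr fun n => ?_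
  rw [interference, Finset.sum_range, Finset.smul_sum]
  refine Finset.sum_congr rfl fun i _ => ?_
  unfold power
  split_ifs
  · rw [smul_smul]
  · rw [smul_zero, zero_smul]

open scoped ComplexOrder in
theorem HasLaw.ae_posSemidef_covariance [IsProbabilityMeasure μ] (h : N.HasLaw μ lam p)
    (hlam : 0 < lam) {α : ℝ} (hα : 2 < α) (y : Plane) :
    ∀ᵐ ω ∂μ, (N.covariance α y ω).PosSemidef := by
  filter_upwards [h.ae_tendsto_interference hlam hα y] with ω hω
  have h1 := hω 1
  rw [one_smul] at h1
  exact posSemidef_of_tendsto (fun n => posSemidef_interference (ι := Fin n)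
    (w := fun i => N.power α 1 y i ω) (fun i => power_nonneg zero_le_one y i ω) _) h1

/-- Exhibits the covariance as a measurable function of locations, transmissions and interfering
channels; its independence of `h₀` follows. -/
theorem measurable_tsum_covariance (α : ℝ) (y : Plane) :
    Measurable fun x : (ℕ → Plane) × ((ℕ → Bool) × (ℕ → Fin L → ℂ)) =>
      (∑' i, if x.2.1 i = true then (dist (x.1 i) y ^ (-α)) •
        Matrix.vecMulVec (x.2.2 i) (star (x.2.2 i)) else 0 : Matrix (Fin L) (Fin L) ℂ) := by
  refine Measurable.tsum fun i => Measurable.ite ?_ ?_ measurable_const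
  · exact (show Measurable fun x : (ℕ → Plane) × ((ℕ → Bool) × (ℕ → Fin L → ℂ)) => x.2.1 i by
      fun_prop) (measurableSet_singleton true)
  · have h2 : Measurable fun x : (ℕ → Plane) × ((ℕ → Bool) × (ℕ → Fin L → ℂ)) =>
        dist (x.1 i) y ^ (-α) := by fun_prop
    have h1 : Measurable fun x : (ℕ → Plane) × ((ℕ → Bool) × (ℕ → Fin L → ℂ)) => x.2.2 i := by
      fun_prop
    exact h2.smul (continuous_vecMulVec_star.measurable.comp h1)

theorem HasLaw.measurable_covariance (h : N.HasLaw μ lam p) (α : ℝ) (y : Plane) :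
    Measurable (N.covariance α y) :=
  (measurable_tsum_covariance (L := L) α y).comp
    (h.measurable_locations.prodMk (h.measurable_transmissions.prodMk h.measurable_channels))

theorem HasLaw.indepFun_covariance [IsProbabilityMeasure μ] (h : N.HasLaw μ lam p) (α : ℝ)
    (y : Plane) : IndepFun (N.covariance α y) N.h₀ μ :=
  h.indepFun_link.comp (measurable_tsum_covariance (L := L) α y) measurable_id

/-- The probability that a Poisson variable of mean `m` is less than `L`. -/
noncomputable def _root_.poissonLt (L : ℕ) (m : ℝ) : ℝ :=
  ∑ k ∈ Finset.range L, Real.exp (-m) * m ^ k / k.factorial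

/-- Truncated outage probabilities are bounded by 1 and converge almost surely by
`tendsto_outageProb`; their means are already known. -/
theorem HasLaw.integral_outageProb_covariance [IsProbabilityMeasure μ] (h : N.HasLaw μ lam p)
    (hL : 1 ≤ L) (hlam : 0 < lam) (hp : 0 < p) {α t : ℝ} (hα : 2 < α) (ht : 0 < t) (y : Plane) :
    ∫ ω, outageProb (t • N.covariance α y ω) ∂μ =
      1 - poissonLt L (lam * (p * (t ^ (2 / α) * contentionConst α))) := by
  have hpsd := fun (n : ℕ) (ω : Ω) => posSemidef_interference (ι := Fin n)
    (fun i => power_nonneg (N := N) (α := α) ht.le y i ω) fun i => N.h i ω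
  have h1 : Tendsto (fun n => ∫ ω, outageProb (interference (fun i : Fin n => N.power α t y i ω)
      fun i => N.h i ω) ∂μ) atTop (𝓝 (∫ ω, outageProb (t • N.covariance α y ω) ∂μ)) := by
    refine tendsto_integral_of_dominated_convergence (fun _ => 1) (fun n => ?_)
      (integrable_const 1) (fun n => .of_forall fun ω => ?_) ?_
    · have hW : Measurable fun ω => fun i : Fin n => N.power α t y i ω :=
        measurable_pi_lambda _ fun i => h.measurable_power α t y i
      have hH : Measurable fun ω => fun i : Fin n => N.h i ω :=
        measurable_pi_lambda _ fun i => h.measurable_h i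
      exact ((measurable_outageProb.comp continuous_interference.measurable).comp
        (hW.prodMk hH)).aestronglyMeasurable
    · have := outageProb_mem_Icc (hpsd n ω)
      rw [Real.norm_of_nonneg this.1]
      exact this.2
    · filter_upwards [h.ae_tendsto_interference hlam hα y] with ω hω
      exact tendsto_outageProb (hpsd · ω) (hω t)
  refine tendsto_nhds_unique h1 ?_
  simp_rw [h.integral_outageProb_truncated hL ht.le y]
  exact (tendsto_finsetSum _ fun k _ =>
    h.tendsto_integral_markedProb hlam hp hα ht y k).const_sub 1

theorem _root_.tendsto_poissonLt_atTop (L : ℕ) : Tendsto (poissonLt L) atTop (𝓝 0) := by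
  unfold poissonLt
  rw [← Finset.sum_const_zero (s := Finset.range L)]
  refine tendsto_finsetSum _ fun k _ => ?_
  have h1 := (Real.tendsto_pow_mul_exp_neg_atTop_nhds_zero k).div_const (k.factorial : ℝ)
  rw [zero_div] at h1
  exact h1.congr fun m => by rw [mul_comm]

open scoped ComplexOrder in
-- Invertibility is read off the outage formula. The outage expression is at most the indicator of a
-- nonzero determinant, so that event has probability at least 1 minus a Poisson probability whose
-- mean tends to infinity with t.
theorem HasLaw.ae_posDef_covariance [IsProbabilityMeasure μ] (h : N.HasLaw μ lam p)
    (hL : 1 ≤ L) (hlam : 0 < lam) (hp : 0 < p) {α : ℝ} (hα : 2 < α) (y : Plane) :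
    ∀ᵐ ω ∂μ, (N.covariance α y ω).PosDef := by
  have hΔ := contentionConst_pos hα
  set S : Set Ω := {ω | (N.covariance α y ω).det ≠ 0} with hS
  have hdet : Measurable fun ω => (N.covariance α y ω).det :=
    (continuous_id.matrix_det).measurable.comp (h.measurable_covariance α y)
  have hSm : MeasurableSet S := (hdet (measurableSet_singleton 0)).compl
  have hle : ∀ t : ℝ, 0 < t →
      1 - poissonLt L (lam * (p * (t ^ (2 / α) * contentionConst α))) ≤ μ.real S := by
    intro t ht
    rw [← h.integral_outageProb_covariance hL hlam hp hα ht y, ← integral_indicator_one hSm]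
    have hb : ∀ᵐ ω ∂μ, outageProb (t • N.covariance α y ω) ∈ Set.Icc (0 : ℝ) 1 := by
      filter_upwards [h.ae_posSemidef_covariance hlam hα y] with ω hω
      exact outageProb_mem_Icc (hω.smul ht.le)
    refine integral_mono_ae (Integrable.of_bound ?_ 1 ?_)
      ((integrable_const (1 : ℝ)).indicator hSm) ?_
    · exact (measurable_outageProb.comp
        ((h.measurable_covariance α y).const_smul t)).aestronglyMeasurable
    · filter_upwards [hb] with ω hω
      rw [Real.norm_of_nonneg hω.1]
      exact hω.2
    · filter_upwards [hb] with ω hω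
      by_cases hmem : ω ∈ S
      · rw [Set.indicator_of_mem hmem]
        exact hω.2
      · rw [Set.indicator_of_notMem hmem, outageProb_of_det_eq_zero]
        have : (N.covariance α y ω).det = 0 := not_not.1 hmem
        rw [Matrix.det_smul_of_tower, this, smul_zero]
  have hlim : Tendsto (fun t : ℝ =>
      1 - poissonLt L (lam * (p * (t ^ (2 / α) * contentionConst α)))) atTop (𝓝 (1 - 0)) := by
    refine ((tendsto_poissonLt_atTop L).comp ?_).const_sub 1
    refine Tendsto.const_mul_atTop hlam (Tendsto.const_mul_atTop hp
      (Tendsto.atTop_mul_const hΔ (tendsto_rpow_atTop (by positivity))))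
  have h1 : (1 : ℝ) ≤ μ.real S := by
    rw [sub_zero] at hlim
    exact le_of_tendsto hlim ((eventually_gt_atTop 0).mono hle)
  have h2 : ∀ᵐ ω ∂μ, ω ∈ S := by
    have h3 : μ.real S = 1 := le_antisymm measureReal_le_one h1
    rw [measureReal_def, ENNReal.toReal_eq_one_iff] at h3
    exact (mem_ae_iff_prob_eq_one hSm).2 h3
  filter_upwards [h2, h.ae_posSemidef_covariance hlam hα y] with ω hω hω'
  exact hω'.posDef_iff_det_ne_zero.2 hω

open scoped Matrix in
theorem _root_.measurable_quadForm_inv (t : ℝ) :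
    Measurable fun z : Matrix (Fin L) (Fin L) ℂ × (Fin L → ℂ) =>
      (star z.2 ⬝ᵥ (t • z.1)⁻¹ *ᵥ z.2).re := by
  have h1 : Measurable fun z : Matrix (Fin L) (Fin L) ℂ × (Fin L → ℂ) =>
    (star z.2 ⬝ᵥ z.1 *ᵥ z.2).re := Continuous.measurable (by fun_prop)
  have h2 : Measurable fun A : Matrix (Fin L) (Fin L) ℂ => (t • A)⁻¹ :=
    measurable_matrix_inv.comp (measurable_const_smul t)
  have h3 := h1.comp (h2.prodMap (measurable_id (α := Fin L → ℂ)))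
  simp only [Function.comp_def, Prod.map_fst, Prod.map_snd, id_eq] at h3
  exact h3

open scoped Matrix in
theorem lt_iff_quadForm_inv_lt {R : Matrix (Fin L) (Fin L) ℂ} (hR : R.det ≠ 0) (v : Fin L → ℂ)
    {α β r : ℝ} (hβ : 0 < β) (hr : 0 < r) :
    r ^ (-α) * (star v ⬝ᵥ R⁻¹ *ᵥ v).re < β ↔
      (star v ⬝ᵥ ((β * r ^ α) • R)⁻¹ *ᵥ v).re < 1 := by
  have ht0 : 0 < β * r ^ α := by positivity
  have hinv : ((β * r ^ α) • R)⁻¹ = (β * r ^ α)⁻¹ • R⁻¹ := by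
    refine Matrix.inv_eq_left_inv ?_
    rw [smul_mul_smul_comm, inv_mul_cancel₀ ht0.ne', one_smul, Matrix.nonsing_inv_mul _ hR.isUnit]
  rw [hinv, Matrix.smul_mulVec, dotProduct_smul, Complex.smul_re, smul_eq_mul,
    inv_mul_lt_iff₀ ht0, mul_one, Real.rpow_neg hr.le, inv_mul_lt_iff₀ (by positivity),
    mul_comm β]

open scoped Matrix ComplexOrder in
-- The link channel is independent of the covariance, so integrating it out at a fixed, almost
-- surely positive definite, matrix gives `outageProb`.
theorem HasLaw.measureReal_quadForm_lt [IsProbabilityMeasure μ] (h : N.HasLaw μ lam p)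
    (hL : 1 ≤ L) (hlam : 0 < lam) (hp : 0 < p) {α t : ℝ} (hα : 2 < α) (ht : 0 < t) (y : Plane) :
    μ.real {ω | (star (N.h₀ ω) ⬝ᵥ (t • N.covariance α y ω)⁻¹ *ᵥ N.h₀ ω).re < 1} =
      1 - poissonLt L (lam * (p * (t ^ (2 / α) * contentionConst α))) := by
  rw [← h.integral_outageProb_covariance hL hlam hp hα ht y]
  have hmR := h.measurable_covariance α y
  have hpd := h.ae_posDef_covariance hL hlam hp hα y
  set S : Set (Matrix (Fin L) (Fin L) ℂ × (Fin L → ℂ)) :=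
    {z | (star z.2 ⬝ᵥ (t • z.1)⁻¹ *ᵥ z.2).re < 1} with hS
  have hmS : MeasurableSet S := measurableSet_lt (measurable_quadForm_inv t) measurable_const
  have hj := (indepFun_iff_map_prod_eq_prod_map_map hmR.aemeasurable
    h.measurable_h₀.aemeasurable).1 (h.indepFun_covariance α y)
  rw [h.law_h₀] at hj
  have h1 : μ ((fun ω => (N.covariance α y ω, N.h₀ ω)) ⁻¹' S) =
      ∫⁻ ω, ENNReal.ofReal (outageProb (t • N.covariance α y ω)) ∂μ := by
    rw [← Measure.map_apply (hmR.prodMk h.measurable_h₀) hmS, hj, Measure.prod_apply hmS,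
      lintegral_map (measurable_measure_prodMk_left hmS) hmR]
    refine lintegral_congr_ae ?_
    filter_upwards [hpd] with ω hω
    rw [← channelLaw_real_quadForm_lt (hω.smul ht), ofReal_measureReal]
    rfl
  rw [integral_eq_lintegral_of_nonneg_ae, ← h1]
  · rfl
  · filter_upwards [hpd] with ω hω
    exact (outageProb_mem_Icc (hω.smul ht).posSemidef).1
  · exact (measurable_outageProb.comp (hmR.const_smul t)).aestronglyMeasurable

open scoped ComplexOrder in
/-- The law of the signal-to-interference ratio under optimum combining. -/
theorem HasLaw.successProb_eq [IsProbabilityMeasure μ] (h : N.HasLaw μ lam p)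
    (hL : 1 ≤ L) (hlam : 0 < lam) (hp : 0 < p) {α β : ℝ} (hα : 2 < α) (hβ : 0 < β)
    {x y : Plane} (hxy : x ≠ y) :
    N.successProb μ α β x y =
      poissonLt L (lam * (p * (β ^ (2 / α) * dist x y ^ 2 * contentionConst α))) := by
  have hr : 0 < dist x y := dist_pos.2 hxy
  have ht0 : 0 < β * dist x y ^ α := by positivity
  have h1 := h.measureReal_quadForm_lt hL hlam hp hα ht0 y
  -- With t = β r^α, the factor t^{2/α} becomes β^{2/α} r².
  rw [Real.mul_rpow hβ.le (by positivity), ← Real.rpow_mul hr.le,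
    mul_div_cancel₀ _ (by linarith : α ≠ 0), Real.rpow_two] at h1
  set A : Set Ω := {ω | β ≤ N.sinr α x y ω} with hA
  set B : Set Ω := {ω | (star (N.h₀ ω) ⬝ᵥ Matrix.mulVec
    ((β * dist x y ^ α) • N.covariance α y ω)⁻¹ (N.h₀ ω)).re < 1} with hB
  have hAB : Aᶜ =ᵐ[μ] B := by
    filter_upwards [h.ae_posDef_covariance hL hlam hp hα y] with ω hω
    refine propext ?_
    change ¬ (β ≤ N.sinr α x y ω) ↔ ω ∈ B
    rw [not_le]
    exact lt_iff_quadForm_inv_lt hω.det_pos.ne' _ hβ hr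
  have hBm : MeasurableSet B := ((measurable_quadForm_inv (β * dist x y ^ α)).comp
    ((h.measurable_covariance α y).prodMk h.measurable_h₀)) measurableSet_Iio
  have hAm : NullMeasurableSet A μ := (hBm.nullMeasurableSet.congr hAB.symm).of_compl
  have h2 := probReal_compl_eq_one_sub₀ hAm
  have h3 : μ.real Aᶜ = μ.real B := measureReal_congr hAB
  rw [h3, h1] at h2
  change μ.real A = _
  linarith

end AlohaNetwork

end

/-! ### Planar geometry of the forward half-plane -/

section

open Filter Topology
open scoped ENNReal NNReal

@[fun_prop]
theorem measurable_cos_angle (x D : Plane) : Measurable fun y => Real.cos (∠ D x y) := by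
  unfold EuclideanGeometry.angle InnerProductGeometry.angle
  fun_prop

theorem angle_le_pi_div_two_iff {x D y : Plane} :
    ∠ D x y ≤ Real.pi / 2 ↔ 0 ≤ Real.cos (∠ D x y) := by
  have h0 := angle_nonneg D x y
  have h1 := angle_le_pi D x y
  refine ⟨fun h => Real.cos_nonneg_of_neg_pi_div_two_le_of_le (by linarith [Real.pi_pos]) h,
    fun h => ?_⟩
  by_contra hlt
  exact absurd h (not_le.2 (Real.cos_neg_of_pi_div_two_lt_of_lt (not_le.1 hlt)
    (by linarith [Real.pi_pos])))

theorem lintegral_norm_mul_re_div_norm {f g : ℝ → ℝ≥0∞} (hf : Measurable f) (hg : Measurable g) :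
    ∫⁻ z : ℂ, f ‖z‖ * g (z.re / ‖z‖) =
      (∫⁻ r in Set.Ioi (0 : ℝ), ENNReal.ofReal r * f r) *
        ∫⁻ θ in Set.Ioo (-Real.pi) Real.pi, g (Real.cos θ) := by
  have hcos : Measurable fun θ => g (Real.cos θ) := hg.comp Real.measurable_cos
  rw [← Complex.lintegral_comp_polarCoord_symm, ← lintegral_prod_mul
    (Measurable.aemeasurable (by fun_prop)) hcos.aemeasurable, Measure.prod_restrict,
    ← Measure.volume_eq_prod, polarCoord_target]
  refine setLIntegral_congr_fun (measurableSet_Ioi.prod measurableSet_Ioo) fun q hq => ?_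
  have hr : 0 < q.1 := hq.1
  have hn : ‖Complex.polarCoord.symm q‖ = q.1 := by
    rw [Complex.norm_polarCoord_symm, abs_of_pos hr]
  have hre : (Complex.polarCoord.symm q).re = q.1 * Real.cos q.2 := by
    rw [Complex.polarCoord_symm_apply]
    simp [Complex.cos_ofReal_re, Complex.sin_ofReal_im]
  rw [hn, hre, mul_div_cancel_left₀ _ hr.ne', smul_eq_mul, mul_assoc]

/-- Moving `x` to the origin and `D` onto the positive real axis turns cos ∠ into Re z / |z|, and
polar coordinates separate the two factors. -/
theorem lintegral_dist_mul_cos_angle {x D : Plane} (hD : D ≠ x) {f g : ℝ → ℝ≥0∞}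
    (hf : Measurable f) (hg : Measurable g) :
    ∫⁻ y : Plane, f (dist x y) * g (Real.cos (∠ D x y)) =
      (∫⁻ r in Set.Ioi (0 : ℝ), ENNReal.ofReal r * f r) *
        ∫⁻ θ in Set.Ioo (-Real.pi) Real.pi, g (Real.cos θ) := by
  have hDx : 0 < ‖D - x‖ := norm_pos_iff.2 (sub_ne_zero.2 hD)
  obtain ⟨e, he⟩ := exists_linearIsometryEquiv_apply_one_eq (u := ‖D - x‖⁻¹ • (D - x))
    (by rw [norm_smul, norm_inv, norm_norm, inv_mul_cancel₀ hDx.ne'])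
  rw [← lintegral_norm_mul_re_div_norm hf hg]
  have hcos : ∀ z : ℂ, Real.cos (∠ D x (e z + x)) = z.re / ‖z‖ := fun z => by
    have hin : inner ℝ (D - x) (e z) = ‖D - x‖ * z.re := by
      have h1 : D - x = ‖D - x‖ • e 1 := by
        rw [he, smul_smul, mul_inv_cancel₀ hDx.ne', one_smul]
      have h2 : inner ℝ (D - x) (e z) = inner ℝ (‖D - x‖ • e 1) (e z) := by rw [← h1]
      rw [h2, real_inner_smul_left, e.inner_map_map, Complex.inner]
      simp
    rw [EuclideanGeometry.angle, InnerProductGeometry.cos_angle, vsub_eq_sub, vsub_eq_sub,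
      add_sub_cancel_right, hin, e.norm_map, mul_div_mul_left _ _ hDx.ne']
  have hc : Measurable fun y : Plane => Real.cos (∠ D x (y + x)) :=
    (measurable_cos_angle x D).comp (measurable_id.add_const x)
  let F : Plane → ℝ≥0∞ := fun y => f (dist x (y + x)) * g (Real.cos (∠ D x (y + x)))
  have hF : Measurable F := (hf.comp (by fun_prop)).mul (hg.comp hc)
  rw [← lintegral_add_right_eq_self
    (fun y : Plane => f (dist x y) * g (Real.cos (∠ D x y))) x,
    ← e.measurePreserving.lintegral_comp (f := F) hF]
  refine lintegral_congr fun z => ?_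
  simp only [F]
  rw [hcos, dist_comm, dist_eq_norm, add_sub_cancel_right, e.norm_map]

theorem cos_nonneg_iff_of_mem_Ioo {θ : ℝ} (hθ : θ ∈ Set.Ioo (-Real.pi) Real.pi) :
    0 ≤ Real.cos θ ↔ θ ∈ Set.Icc (-(Real.pi / 2)) (Real.pi / 2) := by
  refine ⟨fun h => ⟨?_, ?_⟩, fun h => Real.cos_nonneg_of_mem_Icc h⟩
  · by_contra hlt
    have h1 := Real.cos_neg_of_pi_div_two_lt_of_lt (x := -θ) (by linarith)
      (by linarith [hθ.1, Real.pi_pos])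
    rw [Real.cos_neg] at h1
    linarith
  · by_contra hlt
    have h1 := Real.cos_neg_of_pi_div_two_lt_of_lt (x := θ) (by linarith)
      (by linarith [hθ.2, Real.pi_pos])
    linarith

theorem lintegral_indicator_cos_nonneg :
    ∫⁻ θ in Set.Ioo (-Real.pi) Real.pi, (Set.Ici (0 : ℝ)).indicator 1 (Real.cos θ) =
      ENNReal.ofReal Real.pi := by
  have h1 : ∫⁻ θ in Set.Ioo (-Real.pi) Real.pi,
      (Set.Ici (0 : ℝ)).indicator (1 : ℝ → ℝ≥0∞) (Real.cos θ) =
      ∫⁻ θ in Set.Ioo (-Real.pi) Real.pi,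
        (Set.Icc (-(Real.pi / 2)) (Real.pi / 2)).indicator (1 : ℝ → ℝ≥0∞) θ := by
    refine setLIntegral_congr_fun measurableSet_Ioo fun θ hθ => ?_
    by_cases h : 0 ≤ Real.cos θ
    · rw [Set.indicator_of_mem (s := Set.Ici 0) h,
        Set.indicator_of_mem ((cos_nonneg_iff_of_mem_Ioo hθ).1 h)]; rfl
    · rw [Set.indicator_of_notMem (s := Set.Ici 0) h,
        Set.indicator_of_notMem fun h' => h ((cos_nonneg_iff_of_mem_Ioo hθ).2 h')]
  rw [h1, lintegral_indicator_one measurableSet_Icc, Measure.restrict_apply measurableSet_Icc,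
    Set.inter_eq_left.2, Real.volume_Icc]
  · congr 1; ring
  · intro θ hθ
    constructor <;> linarith [hθ.1, hθ.2, Real.pi_pos]

theorem lintegral_ofReal_cos :
    ∫⁻ θ in Set.Ioo (-Real.pi) Real.pi, ENNReal.ofReal (Real.cos θ) = 2 := by
  have h1 : ∫⁻ θ in Set.Ioo (-Real.pi) Real.pi, ENNReal.ofReal (Real.cos θ) =
      ∫⁻ θ in Set.Ioo (-Real.pi) Real.pi, (Set.Icc (-(Real.pi / 2)) (Real.pi / 2)).indicator
        (fun θ => ENNReal.ofReal (Real.cos θ)) θ := by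
    refine setLIntegral_congr_fun measurableSet_Ioo fun θ hθ => ?_
    by_cases h : 0 ≤ Real.cos θ
    · rw [Set.indicator_of_mem ((cos_nonneg_iff_of_mem_Ioo hθ).1 h)]
    · rw [Set.indicator_of_notMem fun h' => h ((cos_nonneg_iff_of_mem_Ioo hθ).2 h')]
      exact ENNReal.ofReal_of_nonpos (not_le.1 h).le
  have hsub : Set.Icc (-(Real.pi / 2)) (Real.pi / 2) ⊆ Set.Ioo (-Real.pi) Real.pi := by
    intro θ hθ
    constructor <;> linarith [hθ.1, hθ.2, Real.pi_pos]
  rw [h1, lintegral_indicator measurableSet_Icc, Measure.restrict_restrict measurableSet_Icc,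
    Set.inter_eq_left.2 hsub, ← ofReal_integral_eq_lintegral_ofReal
      (Real.continuous_cos.integrableOn_Icc)
      (ae_restrict_of_forall_mem measurableSet_Icc fun θ hθ => Real.cos_nonneg_of_mem_Icc hθ),
    integral_Icc_eq_integral_Ioc, ← intervalIntegral.integral_of_le (by linarith [Real.pi_pos]),
    integral_cos, Real.sin_neg, Real.sin_pi_div_two]
  norm_num

/-- The ring of the points whose squared distance to `x` lies in `[a, b)`. -/
def squareRing (x : Plane) (a b : ℝ) : Set Plane := {y | a ≤ dist x y ^ 2 ∧ dist x y ^ 2 < b}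

/-- The half-plane of the points seen from `x` within a right angle of the direction of `D`. -/
def forwardHalfPlane (x D : Plane) : Set Plane := {y | 0 ≤ Real.cos (∠ D x y)}

theorem measurableSet_squareRing (x : Plane) (a b : ℝ) : MeasurableSet (squareRing x a b) := by
  unfold squareRing
  measurability

theorem measurableSet_forwardHalfPlane (x D : Plane) : MeasurableSet (forwardHalfPlane x D) :=
  measurableSet_le measurable_const (measurable_cos_angle x D)

/-- In the squared radius, area is linear: equal increments give rings of equal area, which keeps
the later subdivision estimates uniform. -/
theorem lintegral_ofReal_indicator_sq {a b : ℝ} (ha : 0 ≤ a) (hab : a ≤ b) :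
    ∫⁻ r in Set.Ioi (0 : ℝ), ENNReal.ofReal r * {r : ℝ | a ≤ r ^ 2 ∧ r ^ 2 < b}.indicator 1 r =
      ENNReal.ofReal ((b - a) / 2) := by
  have hs : MeasurableSet {r : ℝ | a ≤ r ^ 2 ∧ r ^ 2 < b} := by measurability
  have h1 : ∀ r : ℝ, ENNReal.ofReal r * {r : ℝ | a ≤ r ^ 2 ∧ r ^ 2 < b}.indicator 1 r =
      {r : ℝ | a ≤ r ^ 2 ∧ r ^ 2 < b}.indicator (fun r => ENNReal.ofReal r) r := fun r => by
    by_cases h : r ∈ {r : ℝ | a ≤ r ^ 2 ∧ r ^ 2 < b}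
    · simp only [Set.indicator_of_mem h, Pi.one_apply, mul_one]
    · simp only [Set.indicator_of_notMem h, mul_zero]
  have hset : ({r : ℝ | a ≤ r ^ 2 ∧ r ^ 2 < b} ∩ Set.Ioi 0 : Set ℝ) =ᵐ[volume]
      Set.Ioc (Real.sqrt a) (Real.sqrt b) := by
    have h2 : {r : ℝ | a ≤ r ^ 2 ∧ r ^ 2 < b} ∩ Set.Ioi 0 =
        Set.Ico (Real.sqrt a) (Real.sqrt b) ∩ Set.Ioi 0 := by
      ext r
      simp only [Set.mem_inter_iff, Set.mem_ofPred_eq, Set.mem_Ioi, Set.mem_Ico]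
      refine and_congr_left fun hr => and_congr ?_ ?_
      · rw [Real.sqrt_le_left hr.le]
      · rw [Real.lt_sqrt hr.le]
    rw [h2]
    have h3 : Set.Ioc (Real.sqrt a) (Real.sqrt b) =
        Set.Ioc (Real.sqrt a) (Real.sqrt b) ∩ Set.Ioi 0 := by
      rw [eq_comm, Set.inter_eq_left]
      exact fun r hr => (Real.sqrt_nonneg a).trans_lt hr.1
    rw [h3]
    exact (Ico_ae_eq_Ioc).inter (ae_eq_refl _)
  simp_rw [h1]
  rw [lintegral_indicator hs, Measure.restrict_restrict hs, setLIntegral_congr hset,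
    ← ofReal_integral_eq_lintegral_ofReal,
    ← intervalIntegral.integral_of_le (Real.sqrt_le_sqrt hab), integral_id, Real.sq_sqrt ha,
    Real.sq_sqrt (ha.trans hab)]
  · exact (continuous_id.integrableOn_Icc).mono_set Set.Ioc_subset_Icc_self
  · exact ae_restrict_of_forall_mem measurableSet_Ioc fun r hr =>
      (Real.sqrt_nonneg a).trans hr.1.le

theorem volume_squareRing (x : Plane) {a b : ℝ} (ha : 0 ≤ a) (hab : a ≤ b) :
    volume (squareRing x a b) = ENNReal.ofReal (Real.pi * (b - a)) := by
  obtain ⟨D, hD⟩ := exists_ne x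
  have h1 := lintegral_dist_mul_cos_angle hD
    (f := {r : ℝ | a ≤ r ^ 2 ∧ r ^ 2 < b}.indicator 1) (g := fun _ => 1)
    (measurable_one.indicator (by measurability)) measurable_const
  rw [lintegral_ofReal_indicator_sq ha hab, setLIntegral_one, Real.volume_Ioo,
    ← ENNReal.ofReal_mul (by linarith)] at h1
  rw [← lintegral_indicator_one (measurableSet_squareRing x a b)]
  refine Eq.trans (lintegral_congr fun y => ?_) (h1.trans ?_)
  · rw [mul_one]; rfl
  · congr 1; ring

theorem volume_squareRing_inter_forwardHalfPlane {x D : Plane} (hD : D ≠ x) {a b : ℝ}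
    (ha : 0 ≤ a) (hab : a ≤ b) :
    volume (squareRing x a b ∩ forwardHalfPlane x D) =
      ENNReal.ofReal (Real.pi / 2 * (b - a)) := by
  have h1 := lintegral_dist_mul_cos_angle hD
    (f := {r : ℝ | a ≤ r ^ 2 ∧ r ^ 2 < b}.indicator 1) (g := (Set.Ici 0).indicator 1)
    (measurable_one.indicator (by measurability)) (measurable_one.indicator measurableSet_Ici)
  rw [lintegral_ofReal_indicator_sq ha hab, lintegral_indicator_cos_nonneg,
    ← ENNReal.ofReal_mul (by linarith)] at h1
  rw [← lintegral_indicator_one ((measurableSet_squareRing x a b).inter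
    (measurableSet_forwardHalfPlane x D)), Set.inter_indicator_one]
  refine Eq.trans (lintegral_congr fun y => ?_) (h1.trans ?_)
  · rfl
  · congr 1; ring

end

/-! ### Existence, uniqueness and measurability of the relay -/

section

open Filter Topology
open scoped ENNReal NNReal

/-- From e^{-r} ≥ 1 - r, one gets 1 - e^{-r}(1 + r) ≤ 1 - (1 - r)(1 + r) = r². -/
theorem poissonMeasure_two_le (r : ℝ≥0) :
    poissonMeasure r {n | 2 ≤ n} ≤ ENNReal.ofReal ((r : ℝ) ^ 2) := by
  have h0 := poissonMeasure_real_singleton r 0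
  have h1 := poissonMeasure_real_singleton r 1
  have hc : ({n | 2 ≤ n} : Set ℕ)ᶜ = {0} ∪ {1} := by
    ext n
    simp only [Set.mem_compl_iff, Set.mem_ofPred_eq, Set.mem_union, Set.mem_singleton_iff]
    omega
  have h2 : (poissonMeasure r).real ({n | 2 ≤ n} : Set ℕ)ᶜ =
      Real.exp (-r) + Real.exp (-r) * r := by
    rw [hc, measureReal_union (by simp) (measurableSet_singleton 1), h0, h1]
    simp
  rw [probReal_compl_eq_one_sub .of_discrete] at h2
  rw [← ofReal_measureReal]
  refine ENNReal.ofReal_le_ofReal ?_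
  have h3 := Real.add_one_le_exp (-(r : ℝ))
  have h4 : (0 : ℝ) ≤ r := r.2
  nlinarith

theorem IsPoissonPointProcess.measure_two_le_pointCount {Ω : Type*} [MeasurableSpace Ω]
    {μ : Measure Ω} {X : ℕ → Ω → Plane} {lam : ℝ} (h : IsPoissonPointProcess μ X lam)
    (hlam : 0 ≤ lam) {A : Set Plane} (hA : MeasurableSet A) (hA' : volume A ≠ ⊤) :
    μ {ω | 2 ≤ pointCount X A ω} ≤ ENNReal.ofReal ((lam * volume.real A) ^ 2) := by
  have h1 : {ω | 2 ≤ pointCount X A ω} = pointCount X A ⁻¹' {n | 2 ≤ n} := rfl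
  have h2 : (Nat.cast : ℕ → ℕ∞) ⁻¹' {n | 2 ≤ n} = {n : ℕ | 2 ≤ n} := by
    ext n
    exact (Nat.cast_le (α := ℕ∞) (m := 2) (n := n))
  rw [h1, ← Measure.map_apply (measurable_pointCount h.measurable hA) .of_discrete,
    h.count_law A hA hA', Measure.map_apply .of_discrete .of_discrete, h2]
  refine (poissonMeasure_two_le _).trans_eq ?_
  rw [Real.coe_toNNReal _ (mul_nonneg hlam measureReal_nonneg)]

/-- Almost surely, no two points of a Poisson process are at the same distance from `x`. -/
theorem IsPoissonPointProcess.ae_dist_injective {Ω : Type*} [MeasurableSpace Ω]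
    {μ : Measure Ω} {X : ℕ → Ω → Plane} {lam : ℝ} (h : IsPoissonPointProcess μ X lam)
    (hlam : 0 ≤ lam) (x : Plane) :
    ∀ᵐ ω ∂μ, ∀ i j, dist x (X i ω) = dist x (X j ω) → i = j := by
  have hM : ∀ M : ℕ, ∀ᵐ ω ∂μ, ∀ i j, dist x (X i ω) ^ 2 < M →
      dist x (X i ω) = dist x (X j ω) → i = j := by
    intro M
    -- Cut the disc of squared radius M into n rings of equal area. Two equidistant points share a
    -- ring, which has probability O(1/n²) for each of the n rings.
    have hb : ∀ n : ℕ, 0 < n → μ {ω | ¬ ∀ i j, dist x (X i ω) ^ 2 < M →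
        dist x (X i ω) = dist x (X j ω) → i = j} ≤
        ENNReal.ofReal ((lam * Real.pi * M) ^ 2 / n) := by
      intro n hn
      have hn0 : (0 : ℝ) < n := by exact_mod_cast hn
      have hring : ∀ k : ℕ, volume (squareRing x (k * (M / n)) ((k + 1 : ℕ) * (M / n))) =
          ENNReal.ofReal (Real.pi * (M / n)) := fun k => by
        rw [volume_squareRing x (by positivity) (by gcongr; omega)]
        congr 1; push_cast; ring
      have hsub : {ω | ¬ ∀ i j, dist x (X i ω) ^ 2 < M → dist x (X i ω) = dist x (X j ω) → i = j} ⊆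
          ⋃ k ∈ Finset.range n, {ω | 2 ≤ pointCount X
            (squareRing x (k * (M / n)) ((k + 1 : ℕ) * (M / n))) ω} := by
        intro ω hω
        simp only [Set.mem_ofPred_eq, not_forall] at hω
        obtain ⟨i, j, hi, hij, hne⟩ := hω
        have hM0 : (0 : ℝ) < M := lt_of_le_of_lt (sq_nonneg _) hi
        have hδ : (0 : ℝ) < M / n := by positivity
        have hdn : dist x (X i ω) ^ 2 / (M / n) < n := by
          rw [div_lt_iff₀ hδ, mul_div_cancel₀ _ hn0.ne']; exact hi
        have hq0 : 0 ≤ dist x (X i ω) ^ 2 / (M / n) := by positivity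
        have hmem : X i ω ∈ squareRing x ((⌊dist x (X i ω) ^ 2 / (M / n)⌋₊ : ℕ) * (M / n))
            ((⌊dist x (X i ω) ^ 2 / (M / n)⌋₊ + 1 : ℕ) * (M / n)) := by
          constructor
          · exact (le_div_iff₀ hδ).1 (Nat.floor_le hq0)
          · rw [← div_lt_iff₀ hδ]
            exact_mod_cast Nat.lt_floor_add_one _
        simp only [Set.mem_iUnion, Finset.mem_range]
        refine ⟨⌊dist x (X i ω) ^ 2 / (M / n)⌋₊, (Nat.floor_lt hq0).2 hdn, ?_⟩
        have hmem' : X j ω ∈ squareRing x ((⌊dist x (X i ω) ^ 2 / (M / n)⌋₊ : ℕ) * (M / n))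
            ((⌊dist x (X i ω) ^ 2 / (M / n)⌋₊ + 1 : ℕ) * (M / n)) := by
          rw [squareRing, Set.mem_ofPred_eq, ← hij]
          exact hmem
        change 2 ≤ Set.encard _
        rw [← Set.encard_pair hne]
        refine Set.encard_le_encard ?_
        rintro l (rfl | rfl)
        · exact hmem
        · exact hmem'
      refine (measure_mono hsub).trans ((measure_biUnion_finset_le _ _).trans ?_)
      refine (Finset.sum_le_sum fun k _ => h.measure_two_le_pointCount hlam
        (measurableSet_squareRing _ _ _) (by rw [hring]; exact ENNReal.ofReal_ne_top)).trans ?_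
      simp_rw [measureReal_def, hring]
      rw [Finset.sum_const, Finset.card_range, ENNReal.toReal_ofReal (by positivity),
        nsmul_eq_mul, ← ENNReal.ofReal_natCast, ← ENNReal.ofReal_mul hn0.le]
      refine (ENNReal.ofReal_le_ofReal (le_of_eq ?_))
      field_simp
    have hlim : Tendsto (fun n : ℕ => ENNReal.ofReal ((lam * Real.pi * M) ^ 2 / n)) atTop
        (𝓝 0) := by
      rw [← ENNReal.ofReal_zero]
      exact ENNReal.tendsto_ofReal (tendsto_const_div_atTop_nhds_zero_nat _)
    exact le_antisymm (ge_of_tendsto hlim ((eventually_gt_atTop 0).mono hb)) zero_le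
  filter_upwards [ae_all_iff.2 hM] with ω hω i j hij
  obtain ⟨M, hMi⟩ := exists_nat_gt (dist x (X i ω) ^ 2)
  exact hω M i j hMi hij

namespace AlohaNetwork

variable {Ω : Type*} {L : ℕ} {N : AlohaNetwork Ω L}

/-- The event that no receiver lies in `A`. -/
def voidEvent (N : AlohaNetwork Ω L) (A : Set Plane) : Set Ω :=
  {ω | ∀ i, N.T i ω = false → N.X i ω ∉ A}

/-- The event that node `i` is a forward receiver nearest to `x`. -/
def nearestEvent (N : AlohaNetwork Ω L) (x D : Plane) (i : ℕ) : Set Ω :=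
  {ω | (N.T i ω = false ∧ N.X i ω ∈ forwardHalfPlane x D) ∧
    ∀ j, N.T j ω = false → N.X j ω ∈ forwardHalfPlane x D →
      dist x (N.X i ω) ≤ dist x (N.X j ω)}

theorem isNFPRelay_of_mem_nearestEvent {x D : Plane} {i : ℕ} {ω : Ω}
    (h : ω ∈ N.nearestEvent x D i) : N.IsNFPRelay x D ω (N.X i ω) := by
  refine ⟨⟨⟨i, h.1.1, rfl⟩, angle_le_pi_div_two_iff.2 h.1.2⟩, ?_⟩
  rintro z ⟨j, hj, rfl⟩ hz
  exact h.2 j hj (angle_le_pi_div_two_iff.1 hz)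

theorem IsNFPRelay.eq_of_dist_injective {x D : Plane} {ω : Ω}
    (hinj : ∀ i j, dist x (N.X i ω) = dist x (N.X j ω) → i = j) {y z : Plane}
    (hy : N.IsNFPRelay x D ω y) (hz : N.IsNFPRelay x D ω z) : y = z := by
  obtain ⟨⟨⟨i, hi, rfl⟩, hiD⟩, himin⟩ := hy
  obtain ⟨⟨⟨j, hj, rfl⟩, hjD⟩, hjmin⟩ := hz
  rw [hinj i j (le_antisymm (himin _ ⟨j, hj, rfl⟩ hjD) (hjmin _ ⟨i, hi, rfl⟩ hiD))]

theorem isNFPRelay_nfpRelay {x D : Plane} {ω : Ω}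
    (h : ∃ y, N.IsNFPRelay x D ω y) : N.IsNFPRelay x D ω (N.nfpRelay x D ω) := by
  rw [nfpRelay, dif_pos h]
  exact h.choose_spec

variable [MeasurableSpace Ω] {μ : Measure Ω} {lam p : ℝ}

theorem HasLaw.measurableSet_receiver (h : N.HasLaw μ lam p) {A : Set Plane}
    (hA : MeasurableSet A) (i : ℕ) : MeasurableSet {ω | N.T i ω = false ∧ N.X i ω ∈ A} :=
  (h.measurable_T i (measurableSet_singleton false)).inter (h.poisson.measurable i hA)

theorem HasLaw.measurableSet_voidEvent (h : N.HasLaw μ lam p) {A : Set Plane}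
    (hA : MeasurableSet A) : MeasurableSet (N.voidEvent A) := by
  have h1 : N.voidEvent A = ⋂ i, {ω | N.T i ω = false ∧ N.X i ω ∈ A}ᶜ := by
    ext ω
    simp [voidEvent]
  rw [h1]
  exact MeasurableSet.iInter fun i => (h.measurableSet_receiver hA i).compl

theorem HasLaw.measureReal_not_transmit [IsProbabilityMeasure μ] (h : N.HasLaw μ lam p)
    (hp : 0 ≤ p) (i : ℕ) : μ.real {ω | N.T i ω = false} = 1 - p := by
  have h1 : {ω | N.T i ω = false} = {ω | N.T i ω = true}ᶜ := by
    ext ω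
    simp
  have hm : MeasurableSet {ω | N.T i ω = true} := h.measurable_T i (measurableSet_singleton true)
  rw [h1, probReal_compl_eq_one_sub hm, measureReal_def, h.transmit_prob, ENNReal.toReal_ofReal hp]

/-- The Laplace functional of the receivers at the indicator of `A`: the partial products are
indicators that no receiver among the first `n` nodes lies in `A`. -/
theorem HasLaw.measureReal_voidEvent [IsProbabilityMeasure μ] (h : N.HasLaw μ lam p)
    (hlam : 0 ≤ lam) (hp : 0 ≤ p) {A : Set Plane} (hA : MeasurableSet A) (hA' : volume A ≠ ⊤) :
    μ.real (N.voidEvent A) = Real.exp (-(lam * (1 - p) * volume.real A)) := by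
  have h1 := h.tendsto_integral_prod_marked hlam false (h.measureReal_not_transmit hp)
    (g := A.indicator 1) (measurable_one.indicator hA)
    (fun z => ⟨Set.indicator_nonneg (fun _ _ => zero_le_one) z,
      Set.indicator_le_self' (fun _ _ => zero_le_one) z⟩)
    ((integrable_indicator_iff hA).2 (integrableOn_const (C := (1 : ℝ)) hA' enorm_ne_top))
  rw [integral_indicator_one hA, ← mul_assoc] at h1
  refine tendsto_nhds_unique ?_ h1
  rw [← integral_indicator_one (h.measurableSet_voidEvent hA)]
  have hterm : ∀ i ω, (1 - if N.T i ω = false then A.indicator (1 : Plane → ℝ) (N.X i ω) else 0) =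
      {ω | N.T i ω = false ∧ N.X i ω ∈ A}ᶜ.indicator (1 : Ω → ℝ) ω := fun i ω => by
    by_cases h1 : N.T i ω = false <;> by_cases h2 : N.X i ω ∈ A <;> simp [h1, h2]
  have h01 : ∀ i ω, {ω | N.T i ω = false ∧ N.X i ω ∈ A}ᶜ.indicator (1 : Ω → ℝ) ω ∈
      Set.Icc (0 : ℝ) 1 := fun i ω =>
    ⟨Set.indicator_nonneg (fun _ _ => zero_le_one) ω,
      Set.indicator_le_self' (fun _ _ => zero_le_one) ω⟩
  simp_rw [hterm]
  refine tendsto_integral_of_dominated_convergence (fun _ => 1) (fun n => ?_)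
    (integrable_const 1) (fun n => .of_forall fun ω => ?_) (.of_forall fun ω => ?_)
  · exact (Finset.measurable_prod _ fun i _ =>
      measurable_one.indicator (h.measurableSet_receiver hA i).compl).aestronglyMeasurable
  · rw [Real.norm_of_nonneg (Finset.prod_nonneg fun i _ => (h01 i ω).1)]
    exact Finset.prod_le_one (fun i _ => (h01 i ω).1) fun i _ => (h01 i ω).2
  · by_cases hω : ω ∈ N.voidEvent A
    · rw [Set.indicator_of_mem hω]
      refine tendsto_const_nhds.congr fun n => (Finset.prod_eq_one fun i _ => ?_).symm
      exact Set.indicator_of_mem (s := {ω | N.T i ω = false ∧ N.X i ω ∈ A}ᶜ)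
        (fun hi => hω i hi.1 hi.2) _
    · rw [Set.indicator_of_notMem hω]
      obtain ⟨i, hi, hiA⟩ : ∃ i, N.T i ω = false ∧ N.X i ω ∈ A := by
        simpa [voidEvent] using hω
      refine tendsto_const_nhds.congr' ((eventually_gt_atTop i).mono fun n hn => ?_)
      refine (Finset.prod_eq_zero (Finset.mem_range.2 hn) ?_).symm
      exact Set.indicator_of_notMem (s := {ω | N.T i ω = false ∧ N.X i ω ∈ A}ᶜ)
        (fun hc => hc ⟨hi, hiA⟩) _

/-- Almost surely, some receiver lies in the forward half-plane. -/
theorem HasLaw.ae_exists_forward_receiver [IsProbabilityMeasure μ] (h : N.HasLaw μ lam p)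
    (hlam : 0 < lam) (hp : 0 ≤ p) (hp1 : p < 1) {x D : Plane} (hD : D ≠ x) :
    ∀ᵐ ω ∂μ, ∃ i, N.T i ω = false ∧ N.X i ω ∈ forwardHalfPlane x D := by
  have hvoid : ∀ n : ℕ, μ.real (N.voidEvent (forwardHalfPlane x D)) ≤
      Real.exp (-(lam * (1 - p) * (Real.pi / 2)  * n)) := by
    intro n
    have hm := (measurableSet_squareRing x 0 n).inter (measurableSet_forwardHalfPlane x D)
    have hv := volume_squareRing_inter_forwardHalfPlane hD le_rfl (Nat.cast_nonneg (α := ℝ) n)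
    have h1 := h.measureReal_voidEvent hlam.le hp hm (by rw [hv]; exact ENNReal.ofReal_ne_top)
    rw [measureReal_def volume, hv, ENNReal.toReal_ofReal (by
      rw [sub_zero]; positivity), sub_zero, ← mul_assoc] at h1
    rw [← h1]
    refine measureReal_mono ?_
    exact fun ω hω i hi hi' => hω i hi hi'.2
  have hlim : Tendsto (fun n : ℕ => Real.exp (-(lam * (1 - p) * (Real.pi / 2) * n))) atTop
      (𝓝 0) := by
    refine Real.tendsto_exp_neg_atTop_nhds_zero.comp ?_
    have h2 : 0 < lam * (1 - p) * (Real.pi / 2) :=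
      mul_pos (mul_pos hlam (by linarith)) (by positivity)
    exact Tendsto.const_mul_atTop h2 tendsto_natCast_atTop_atTop
  have h0 : μ.real (N.voidEvent (forwardHalfPlane x D)) = 0 :=
    le_antisymm (ge_of_tendsto' hlim hvoid) measureReal_nonneg
  rw [measureReal_eq_zero_iff] at h0
  filter_upwards [measure_eq_zero_iff_ae_notMem.1 h0] with ω hω
  simpa [voidEvent] using hω

theorem HasLaw.measurableSet_nearestEvent (h : N.HasLaw μ lam p) (x D : Plane) (i : ℕ) :
    MeasurableSet (N.nearestEvent x D i) := by
  have hH := measurableSet_forwardHalfPlane x D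
  have h1 : N.nearestEvent x D i = {ω | N.T i ω = false ∧ N.X i ω ∈ forwardHalfPlane x D} ∩
      ⋂ j, ({ω | N.T j ω = false ∧ N.X j ω ∈ forwardHalfPlane x D}ᶜ ∪
        {ω | dist x (N.X i ω) ≤ dist x (N.X j ω)}) := by
    ext ω
    simp only [nearestEvent, Set.mem_ofPred_eq, Set.mem_inter_iff, Set.mem_iInter, Set.mem_union,
      Set.mem_compl_iff]
    refine and_congr_right fun _ => forall_congr' fun j => ?_
    tauto
  rw [h1]
  refine (h.measurableSet_receiver hH i).inter (MeasurableSet.iInter fun j =>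
    (h.measurableSet_receiver hH j).compl.union (measurableSet_le ?_ ?_))
  · exact measurable_const.dist (h.poisson.measurable i)
  · exact measurable_const.dist (h.poisson.measurable j)

/-- A ball reaching some forward receiver holds finitely many nodes, so the minimal distance is
attained. -/
theorem HasLaw.ae_exists_nearestEvent [IsProbabilityMeasure μ] (h : N.HasLaw μ lam p)
    (hlam : 0 < lam) (hp : 0 ≤ p) (hp1 : p < 1) {x D : Plane} (hD : D ≠ x) :
    ∀ᵐ ω ∂μ, ∃ i, ω ∈ N.nearestEvent x D i := by
  have hball : ∀ᵐ ω ∂μ, ∀ n : ℕ, pointCount N.X (Metric.closedBall x n) ω ≠ ⊤ :=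
    ae_all_iff.2 fun n => h.poisson.ae_pointCount_ne_top measurableSet_closedBall
      (isCompact_closedBall x n).measure_lt_top.ne
  filter_upwards [h.ae_exists_forward_receiver hlam hp hp1 hD, hball] with ω ⟨i₀, hi₀⟩ hω
  obtain ⟨n, hn⟩ := exists_nat_ge (dist x (N.X i₀ ω))
  have hfin : {i : ℕ | N.X i ω ∈ Metric.closedBall x n}.Finite := Set.encard_ne_top_iff.1 (hω n)
  set S : Set ℕ := {i | (N.T i ω = false ∧ N.X i ω ∈ forwardHalfPlane x D) ∧
    dist x (N.X i ω) ≤ n} with hS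
  have hSfin : S.Finite := hfin.subset fun i hi => by
    simpa [dist_comm] using hi.2
  obtain ⟨i, hi, hmin⟩ := Set.exists_min_image S (fun i => dist x (N.X i ω)) hSfin
    ⟨i₀, hi₀, hn⟩
  refine ⟨i, hi.1, fun j hj hjH => ?_⟩
  by_cases hjn : dist x (N.X j ω) ≤ n
  · exact hmin j ⟨⟨hj, hjH⟩, hjn⟩
  · exact hi.2.trans (not_le.1 hjn).le

theorem HasLaw.ae_existsUnique_isNFPRelay [IsProbabilityMeasure μ] (h : N.HasLaw μ lam p)
    (hlam : 0 < lam) (hp : 0 ≤ p) (hp1 : p < 1) {x D : Plane} (hD : D ≠ x) :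
    ∀ᵐ ω ∂μ, ∃! y, N.IsNFPRelay x D ω y := by
  filter_upwards [h.ae_exists_nearestEvent hlam hp hp1 hD,
    h.poisson.ae_dist_injective hlam.le x] with ω ⟨i, hi⟩ hinj
  exact ⟨N.X i ω, isNFPRelay_of_mem_nearestEvent hi, fun z hz =>
    hz.eq_of_dist_injective hinj (isNFPRelay_of_mem_nearestEvent hi)⟩

/-- The relay is defined by choice, but on the event that node i is nearest it almost surely equals
`X i` by uniqueness, and these countably many events cover almost everything. -/
theorem HasLaw.aemeasurable_nfpRelay [IsProbabilityMeasure μ] (h : N.HasLaw μ lam p)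
    (hlam : 0 < lam) (hp : 0 ≤ p) (hp1 : p < 1) {x D : Plane} (hD : D ≠ x) :
    AEMeasurable (N.nfpRelay x D) μ := by
  have hcover : μ.restrict (⋃ i, N.nearestEvent x D i) = μ := by
    rw [Measure.restrict_eq_self_of_ae_mem]
    filter_upwards [h.ae_exists_nearestEvent hlam hp hp1 hD] with ω hω
    exact Set.mem_iUnion.2 hω
  rw [← hcover, aemeasurable_iUnion_iff]
  intro i
  refine (h.poisson.measurable i).aemeasurable.congr ?_
  filter_upwards [ae_restrict_mem (h.measurableSet_nearestEvent x D i),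
    ae_restrict_of_ae (h.poisson.ae_dist_injective hlam.le x)] with ω hi hinj
  have hi' := isNFPRelay_of_mem_nearestEvent hi
  exact hi'.eq_of_dist_injective hinj (isNFPRelay_nfpRelay ⟨_, hi'⟩)

end AlohaNetwork

end

/-! ### Law of the relay and mean progress -/

section

open Filter Topology
open scoped ENNReal NNReal

theorem integral_pow_mul_exp_neg_mul_sq {b : ℝ} (hb : 0 < b) (n : ℕ) :
    IntegrableOn (fun r : ℝ => r ^ n * Real.exp (-b * r ^ 2)) (Set.Ioi 0) ∧
      ∫ r in Set.Ioi (0 : ℝ), r ^ n * Real.exp (-b * r ^ 2) =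
        1 / 2 * Real.Gamma ((n + 1) / 2) / b ^ (((n : ℝ) + 1) / 2) := by
  have hn : (-1 : ℝ) < n := by have := Nat.cast_nonneg (α := ℝ) n; linarith
  have h1 := integrableOn_rpow_mul_exp_neg_mul_sq hb hn
  have h2 := integral_rpow_mul_exp_neg_mul_rpow two_pos hn hb
  simp only [Real.rpow_natCast, Real.rpow_two] at h1 h2
  refine ⟨h1, h2.trans ?_⟩
  rw [neg_div, Real.rpow_neg hb.le]
  ring

/-- The law of the nearest point, in the forward half-plane at `x`, of a Poisson process of
density `κ`. -/
noncomputable def nearestForwardLaw (κ : ℝ) (x D : Plane) : Measure Plane :=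
  volume.withDensity ((forwardHalfPlane x D).indicator fun y =>
    ENNReal.ofReal (κ * Real.exp (-(κ * (Real.pi / 2)) * dist x y ^ 2)))

theorem measurable_nearestForwardLaw_density (κ : ℝ) (x D : Plane) :
    Measurable ((forwardHalfPlane x D).indicator fun y =>
      ENNReal.ofReal (κ * Real.exp (-(κ * (Real.pi / 2)) * dist x y ^ 2))) :=
  Measurable.indicator (by fun_prop) (measurableSet_forwardHalfPlane x D)

/-- Total mass one is what upgrades the one-sided bound in `HasLaw.map_nfpRelay` to an equality. The
radial integral is 1/π and the angular one π. -/
theorem isProbabilityMeasure_nearestForwardLaw {κ : ℝ} (hκ : 0 < κ) {x D : Plane} (hD : D ≠ x) :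
    IsProbabilityMeasure (nearestForwardLaw κ x D) := by
  have hc : 0 < κ * (Real.pi / 2) := by positivity
  obtain ⟨h1, h2⟩ := integral_pow_mul_exp_neg_mul_sq hc 1
  have h3 := lintegral_dist_mul_cos_angle hD
    (f := fun r => ENNReal.ofReal (κ * Real.exp (-(κ * (Real.pi / 2)) * r ^ 2)))
    (g := (Set.Ici 0).indicator 1) (by fun_prop) (measurable_one.indicator measurableSet_Ici)
  have h4 : ∫⁻ r in Set.Ioi (0 : ℝ), ENNReal.ofReal r *
      ENNReal.ofReal (κ * Real.exp (-(κ * (Real.pi / 2)) * r ^ 2)) =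
      ENNReal.ofReal (1 / Real.pi) := by
    have h5 : ∫ r in Set.Ioi (0 : ℝ), κ * (r ^ 1 * Real.exp (-(κ * (Real.pi / 2)) * r ^ 2)) =
        1 / Real.pi := by
      rw [integral_const_mul, h2]
      norm_num
      field_simp
    rw [← h5, ofReal_integral_eq_lintegral_ofReal (h1.const_mul κ)]
    · refine setLIntegral_congr_fun measurableSet_Ioi fun r hr => ?_
      rw [← ENNReal.ofReal_mul (le_of_lt hr)]
      congr 1
      ring
    · refine ae_restrict_of_forall_mem measurableSet_Ioi fun r hr => ?_
      have hr0 : (0 : ℝ) < r := hr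
      simp only [Pi.zero_apply]
      positivity
  rw [h4, lintegral_indicator_cos_nonneg, ← ENNReal.ofReal_mul (by positivity),
    one_div_mul_cancel Real.pi_ne_zero, ENNReal.ofReal_one] at h3
  refine ⟨?_⟩
  rw [nearestForwardLaw, withDensity_apply _ MeasurableSet.univ, Measure.restrict_univ, ← h3]
  refine lintegral_congr fun y => ?_
  by_cases hy : 0 ≤ Real.cos (∠ D x y)
  · rw [Set.indicator_of_mem (s := forwardHalfPlane x D) hy, Set.indicator_of_mem
      (s := Set.Ici (0 : ℝ)) hy, Pi.one_apply, mul_one]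
  · rw [Set.indicator_of_notMem (s := forwardHalfPlane x D) hy, Set.indicator_of_notMem
      (s := Set.Ici (0 : ℝ)) hy, mul_zero]

theorem iUnion_squareRing (x : Plane) {δ : ℝ} (hδ : 0 < δ) :
    ⋃ k : ℕ, squareRing x (k * δ) ((k + 1) * δ) = Set.univ := by
  refine Set.eq_univ_of_forall fun y => Set.mem_iUnion.2 ⟨⌊dist x y ^ 2 / δ⌋₊, ?_, ?_⟩
  · exact (le_div_iff₀ hδ).1 (Nat.floor_le (by positivity))
  · rw [← div_lt_iff₀ hδ]
    exact Nat.lt_floor_add_one _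

theorem pairwise_disjoint_squareRing (x : Plane) {δ : ℝ} (hδ : 0 < δ) :
    Pairwise (Function.onFun Disjoint fun k : ℕ => squareRing x (k * δ) ((k + 1) * δ)) := by
  have h : ∀ j k : ℕ, j < k → Disjoint (squareRing x (j * δ) ((j + 1) * δ))
      (squareRing x (k * δ) ((k + 1) * δ)) := fun j k hjk => by
    refine Set.disjoint_left.2 fun y hy hy' => ?_
    have h1 : ((j : ℝ) + 1) * δ ≤ k * δ := by
      gcongr
      exact_mod_cast hjk
    linarith [hy.2, hy'.1]
  intro j k hjk
  rcases lt_or_gt_of_ne hjk with hlt | hlt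
  · exact h j k hlt
  · exact (h k j hlt).symm

namespace AlohaNetwork

variable {Ω : Type*} [MeasurableSpace Ω] {μ : Measure Ω} {L : ℕ} {N : AlohaNetwork Ω L}
  {lam p : ℝ}

/-- If the relay lies in `B`, the inner half-disc `C` has no receiver while `B'` has one. This has
probability exp(-κπa/2)(1 - exp(-κ|B'|)) ≤ exp(-κπa/2) κ|B'|, whereas the density on `B'` is at
least κ exp(-κπb/2); the ratio of the exponentials is the stated factor. -/
theorem HasLaw.measure_nfpRelay_mem_le [IsProbabilityMeasure μ] (h : N.HasLaw μ lam p)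
    (hlam : 0 < lam) (hp : 0 ≤ p) (hp1 : p < 1) {x D : Plane} (hD : D ≠ x) {a b : ℝ}
    (ha : 0 ≤ a) (hab : a ≤ b) {B : Set Plane} (hB : MeasurableSet B)
    (hBr : B ⊆ squareRing x a b) :
    μ {ω | N.nfpRelay x D ω ∈ B} ≤
      ENNReal.ofReal (Real.exp (lam * (1 - p) * (Real.pi / 2) * (b - a))) *
        nearestForwardLaw (lam * (1 - p)) x D B := by
  have hκ : 0 < lam * (1 - p) := mul_pos hlam (by linarith)
  set κ := lam * (1 - p) with hκd
  have hH := measurableSet_forwardHalfPlane x D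
  set C := squareRing x 0 a ∩ forwardHalfPlane x D with hC
  set B' := B ∩ forwardHalfPlane x D with hB'
  have hCm : MeasurableSet C := (measurableSet_squareRing x 0 a).inter hH
  have hBm : MeasurableSet B' := hB.inter hH
  have hCv : volume C = ENNReal.ofReal (Real.pi / 2 * a) := by
    rw [hC, volume_squareRing_inter_forwardHalfPlane hD le_rfl ha, sub_zero]
  have hCr : volume.real C = Real.pi / 2 * a := by
    rw [measureReal_def, hCv, ENNReal.toReal_ofReal (by positivity)]
  have hBv : volume B' ≠ ⊤ := by
    refine ne_top_of_le_ne_top ?_ (measure_mono (Set.inter_subset_left.trans hBr))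
    rw [volume_squareRing x ha hab]
    exact ENNReal.ofReal_ne_top
  have hdisj : Disjoint C B' := Set.disjoint_left.2 fun y hy hy' =>
    not_lt.2 (hBr hy'.1).1 hy.1.2
  have hCfin : volume C ≠ ⊤ := by rw [hCv]; exact ENNReal.ofReal_ne_top
  have hunion : volume.real (C ∪ B') = volume.real C + volume.real B' :=
    measureReal_union hdisj hBm hCfin hBv
  have hsub : N.voidEvent (C ∪ B') ⊆ N.voidEvent C := fun ω hω i hi hiC => hω i hi (Or.inl hiC)
  have h1 : μ {ω | N.nfpRelay x D ω ∈ B} ≤ μ (N.voidEvent C \ N.voidEvent (C ∪ B')) := by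
    refine measure_mono_ae ?_
    filter_upwards [h.ae_existsUnique_isNFPRelay hlam hp hp1 hD] with ω hex hω
    obtain ⟨⟨⟨i, hi, hiY⟩, hYH⟩, hmin⟩ := isNFPRelay_nfpRelay hex.exists
    have hωB : N.nfpRelay x D ω ∈ B := hω
    refine ⟨fun j hj hjC => ?_, fun hv => ?_⟩
    · have h2 := hmin _ ⟨j, hj, rfl⟩ (angle_le_pi_div_two_iff.2 hjC.2)
      have h3 := (hBr hωB).1
      have h4 := hjC.1.2
      have h5 := pow_le_pow_left₀ dist_nonneg h2 2
      linarith
    · refine hv i hi (Or.inr ⟨?_, ?_⟩)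
      · rw [hiY]; exact hωB
      · rw [hiY]; exact angle_le_pi_div_two_iff.1 hYH
  have h2 : μ.real (N.voidEvent C \ N.voidEvent (C ∪ B')) ≤
      Real.exp (-(κ * (Real.pi / 2 * a))) * (κ * volume.real B') := by
    rw [measureReal_sdiff hsub (h.measurableSet_voidEvent (hCm.union hBm)),
      h.measureReal_voidEvent hlam.le hp hCm hCfin,
      h.measureReal_voidEvent hlam.le hp (hCm.union hBm) (measure_union_ne_top hCfin hBv),
      hunion, hCr, ← hκd, mul_add, neg_add, Real.exp_add]
    have h3 := Real.add_one_le_exp (-(κ * volume.real B'))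
    have h4 := Real.exp_pos (-(κ * (Real.pi / 2 * a)))
    nlinarith
  have h3 : ENNReal.ofReal (κ * Real.exp (-(κ * (Real.pi / 2)) * b)) * volume B' ≤
      nearestForwardLaw κ x D B := by
    rw [nearestForwardLaw, withDensity_apply _ hB, setLIntegral_indicator hH,
      Set.inter_comm, ← setLIntegral_const]
    refine setLIntegral_mono (by fun_prop) fun y hy => ENNReal.ofReal_le_ofReal ?_
    have h4 : dist x y ^ 2 ≤ b := (hBr hy.1).2.le
    refine mul_le_mul_of_nonneg_left (Real.exp_le_exp.2 ?_) hκ.le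
    have h5 : 0 ≤ κ * (Real.pi / 2) := by positivity
    nlinarith
  refine h1.trans (le_trans ?_ (mul_le_mul_right h3 _))
  rw [← ofReal_measureReal (μ := μ), ← ofReal_measureReal (μ := volume) (s := B') (h := hBv),
    ← ENNReal.ofReal_mul (by positivity), ← ENNReal.ofReal_mul (by positivity)]
  refine ENNReal.ofReal_le_ofReal (h2.trans_eq ?_)
  have h5 : Real.exp (-(κ * (Real.pi / 2 * a))) = Real.exp (κ * (Real.pi / 2) * (b - a)) *
      Real.exp (-(κ * (Real.pi / 2)) * b) := by
    rw [← Real.exp_add]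
    congr 1
    ring
  rw [h5]
  ring

/-- The law of the relay selected by nearest-with-forward-progress routing. -/
theorem HasLaw.map_nfpRelay [IsProbabilityMeasure μ] (h : N.HasLaw μ lam p)
    (hlam : 0 < lam) (hp : 0 ≤ p) (hp1 : p < 1) {x D : Plane} (hD : D ≠ x) :
    μ.map (N.nfpRelay x D) = nearestForwardLaw (lam * (1 - p)) x D := by
  have hκ : 0 < lam * (1 - p) := mul_pos hlam (by linarith)
  have hY := h.aemeasurable_nfpRelay hlam hp hp1 hD
  have h1 := isProbabilityMeasure_nearestForwardLaw hκ hD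
  have h2 := Measure.isProbabilityMeasure_map (μ := μ) hY
  refine Measure.eq_of_le_of_isProbabilityMeasure (Measure.le_iff.2 fun B hB => ?_)
  -- Slicing by rings of increment δ in the squared radius gives the same error factor on every
  -- slice; it tends to 1 with δ → 0.
  have hδ : ∀ δ : ℝ, 0 < δ → μ.map (N.nfpRelay x D) B ≤
      ENNReal.ofReal (Real.exp (lam * (1 - p) * (Real.pi / 2) * δ)) *
        nearestForwardLaw (lam * (1 - p)) x D B := by
    intro δ hδ
    have hcov : B = ⋃ k : ℕ, B ∩ squareRing x (k * δ) ((k + 1) * δ) := by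
      rw [← Set.inter_iUnion, iUnion_squareRing x hδ, Set.inter_univ]
    have hm : ∀ k : ℕ, MeasurableSet (B ∩ squareRing x (k * δ) ((k + 1) * δ)) := fun k =>
      hB.inter (measurableSet_squareRing _ _ _)
    have hd : Pairwise (Function.onFun Disjoint fun k : ℕ =>
        B ∩ squareRing x (k * δ) ((k + 1) * δ)) := fun j k hjk =>
      (pairwise_disjoint_squareRing x hδ hjk).mono Set.inter_subset_right Set.inter_subset_right
    have e1 : ∀ m : Measure Plane, m B = ∑' k : ℕ, m (B ∩ squareRing x (k * δ) ((k + 1) * δ)) :=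
      fun m => by rw [← measure_iUnion hd hm, ← hcov]
    rw [e1, e1, ← ENNReal.tsum_mul_left]
    refine ENNReal.tsum_le_tsum fun k => ?_
    rw [Measure.map_apply_of_aemeasurable hY (hm k)]
    have h3 := h.measure_nfpRelay_mem_le hlam hp hp1 hD (a := k * δ) (b := (k + 1) * δ)
      (by positivity) (by nlinarith) (hm k) Set.inter_subset_right
    rw [show ((k : ℝ) + 1) * δ - k * δ = δ by ring] at h3
    exact h3
  have hlim : Tendsto (fun δ : ℝ =>
      ENNReal.ofReal (Real.exp (lam * (1 - p) * (Real.pi / 2) * δ)) *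
        nearestForwardLaw (lam * (1 - p)) x D B) (𝓝[>] 0)
      (𝓝 (1 * nearestForwardLaw (lam * (1 - p)) x D B)) := by
    refine ENNReal.Tendsto.mul_const ?_ (Or.inl one_ne_zero)
    have h3 : Continuous fun δ : ℝ =>
      ENNReal.ofReal (Real.exp (lam * (1 - p) * (Real.pi / 2) * δ)) :=
      ENNReal.continuous_ofReal.comp (by fun_prop)
    have h4 := h3.tendsto 0
    rw [mul_zero, Real.exp_zero, ENNReal.ofReal_one] at h4
    exact h4.mono_left nhdsWithin_le_nhds
  rw [one_mul] at hlim
  exact ge_of_tendsto hlim (eventually_nhdsWithin_of_forall hδ)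

end AlohaNetwork

theorem continuous_poissonLt (L : ℕ) : Continuous (poissonLt L) := by
  unfold poissonLt
  fun_prop

theorem poissonLt_nonneg (L : ℕ) {m : ℝ} (hm : 0 ≤ m) : 0 ≤ poissonLt L m :=
  Finset.sum_nonneg fun k _ => by positivity

/-- The mean of the progress when the success probability at distance `r` is
`poissonLt L (c * r ^ 2)`. -/
theorem lintegral_nearestForwardLaw {κ c : ℝ} (hκ : 0 < κ) (hc : 0 ≤ c) (L : ℕ) {x D : Plane}
    (hD : D ≠ x) :
    ∫⁻ y, ENNReal.ofReal (dist x y * Real.cos (∠ D x y) * poissonLt L (c * dist x y ^ 2))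
      ∂(nearestForwardLaw κ x D) =
    ENNReal.ofReal (∑ k ∈ Finset.range L, κ * c ^ k / k.factorial *
      (Real.Gamma (k + 3 / 2) / (κ * (Real.pi / 2) + c) ^ ((k : ℝ) + 3 / 2))) := by
  have hb : 0 < κ * (Real.pi / 2) + c := by positivity
  have hP := (continuous_poissonLt L).measurable
  have h0 : ∀ r : ℝ, 0 ≤ poissonLt L (c * r ^ 2) := fun r => poissonLt_nonneg L (by positivity)
  -- Taking `ENNReal.ofReal` as angular factor kills negative cosines, which encodes the restriction
  -- to the half-plane.
  have h1 := lintegral_dist_mul_cos_angle hD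
    (f := fun r => ENNReal.ofReal (κ * Real.exp (-(κ * (Real.pi / 2)) * r ^ 2) *
      (r * poissonLt L (c * r ^ 2)))) (g := ENNReal.ofReal) (by fun_prop)
    ENNReal.measurable_ofReal
  have h2 : ∫⁻ r in Set.Ioi (0 : ℝ), ENNReal.ofReal r *
      ENNReal.ofReal (κ * Real.exp (-(κ * (Real.pi / 2)) * r ^ 2) *
        (r * poissonLt L (c * r ^ 2))) =
      ENNReal.ofReal (∑ k ∈ Finset.range L, κ * c ^ k / k.factorial *
        (1 / 2 * Real.Gamma (k + 3 / 2) / (κ * (Real.pi / 2) + c) ^ ((k : ℝ) + 3 / 2))) := by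
    have h3 : ∀ k : ℕ, (((2 * k + 2 : ℕ) : ℝ) + 1) / 2 = k + 3 / 2 := fun k => by
      push_cast; ring
    -- The power `2 * k + 2` collects the polar Jacobian, the distance, and r^{2k} from the Poisson
    -- term.
    have hint : ∀ k ∈ Finset.range L, IntegrableOn (fun r : ℝ => κ * c ^ k / k.factorial *
        (r ^ (2 * k + 2) * Real.exp (-(κ * (Real.pi / 2) + c) * r ^ 2))) (Set.Ioi 0) :=
      fun k _ => (integral_pow_mul_exp_neg_mul_sq hb _).1.const_mul _
    have h4 : ∑ k ∈ Finset.range L, κ * c ^ k / k.factorial *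
        (1 / 2 * Real.Gamma (k + 3 / 2) / (κ * (Real.pi / 2) + c) ^ ((k : ℝ) + 3 / 2)) =
        ∫ r in Set.Ioi (0 : ℝ), ∑ k ∈ Finset.range L, κ * c ^ k / k.factorial *
          (r ^ (2 * k + 2) * Real.exp (-(κ * (Real.pi / 2) + c) * r ^ 2)) := by
      rw [integral_finsetSum _ hint]
      refine Finset.sum_congr rfl fun k _ => ?_
      rw [integral_const_mul, (integral_pow_mul_exp_neg_mul_sq hb _).2, h3]
    rw [h4, ofReal_integral_eq_lintegral_ofReal (integrable_finsetSum _ hint)]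
    · refine setLIntegral_congr_fun measurableSet_Ioi fun r hr => ?_
      rw [← ENNReal.ofReal_mul (le_of_lt hr)]
      congr 1
      rw [poissonLt, Finset.mul_sum, Finset.mul_sum, Finset.mul_sum]
      refine Finset.sum_congr rfl fun k _ => ?_
      rw [show -(κ * (Real.pi / 2) + c) * r ^ 2 =
        -(κ * (Real.pi / 2)) * r ^ 2 + -(c * r ^ 2) by ring, Real.exp_add, mul_pow, ← pow_mul]
      ring
    · refine ae_restrict_of_forall_mem measurableSet_Ioi fun r hr => ?_
      have hr0 : (0 : ℝ) < r := hr
      exact Finset.sum_nonneg fun k _ => by positivity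
  rw [h2, lintegral_ofReal_cos] at h1
  have h5 : ∫⁻ y, ENNReal.ofReal (dist x y * Real.cos (∠ D x y) * poissonLt L (c * dist x y ^ 2))
      ∂(nearestForwardLaw κ x D) = ∫⁻ y, ENNReal.ofReal
        (κ * Real.exp (-(κ * (Real.pi / 2)) * dist x y ^ 2) *
          (dist x y * poissonLt L (c * dist x y ^ 2))) * ENNReal.ofReal (Real.cos (∠ D x y)) := by
    rw [nearestForwardLaw, lintegral_withDensity_eq_lintegral_mul _
      (measurable_nearestForwardLaw_density κ x D) (by fun_prop)]
    refine lintegral_congr fun y => ?_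
    rw [Pi.mul_apply]
    by_cases hy : 0 ≤ Real.cos (∠ D x y)
    · rw [Set.indicator_of_mem (s := forwardHalfPlane x D) hy, ← ENNReal.ofReal_mul (by positivity),
        ← ENNReal.ofReal_mul (mul_nonneg (by positivity) (mul_nonneg dist_nonneg (h0 _)))]
      congr 1
      ring
    · rw [Set.indicator_of_notMem (s := forwardHalfPlane x D) hy, zero_mul,
        ENNReal.ofReal_of_nonpos (not_le.1 hy).le, mul_zero]
  rw [h5, h1, show (2 : ℝ≥0∞) = ENNReal.ofReal 2 by norm_num, mul_comm,
    ← ENNReal.ofReal_mul zero_le_two, Finset.mul_sum]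
  congr 1
  refine Finset.sum_congr rfl fun k _ => ?_
  ring

/-- Scaling in the density: λ^{k+1} over λ^{k+3/2} leaves λ^{-1/2} in every term. -/
theorem mean_progress_rescale {lam p E : ℝ} (hlam : 0 < lam)
    (hA : 0 < (1 - p) * Real.pi / 2 + E * p) (k : ℕ) (G : ℝ) :
    lam * (1 - p) * (lam * p * E) ^ k / k.factorial *
      (G / (lam * (1 - p) * (Real.pi / 2) + lam * p * E) ^ ((k : ℝ) + 3 / 2)) =
    1 / Real.sqrt lam * (G * E ^ k * p ^ k * (1 - p) /
      (k.factorial * ((1 - p) * Real.pi / 2 + E * p) ^ ((k : ℝ) + 3 / 2))) := by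
  have h1 : lam * (1 - p) * (Real.pi / 2) + lam * p * E =
      lam * ((1 - p) * Real.pi / 2 + E * p) := by ring
  have h2 : lam ^ ((k : ℝ) + 3 / 2) = lam ^ k * (lam * Real.sqrt lam) := by
    rw [Real.rpow_add hlam, Real.rpow_natCast, show (3 / 2 : ℝ) = 1 + 1 / 2 by norm_num,
      Real.rpow_add hlam, Real.rpow_one, Real.sqrt_eq_rpow]
  rw [h1, Real.mul_rpow hlam.le hA.le, h2]
  have h3 : 0 < ((1 - p) * Real.pi / 2 + E * p) ^ ((k : ℝ) + 3 / 2) := Real.rpow_pos_of_pos hA _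
  have h4 : 0 < Real.sqrt lam := Real.sqrt_pos.2 hlam
  have h5 : (k.factorial : ℝ) ≠ 0 := by exact_mod_cast k.factorial_ne_zero
  field_simp
  ring

end

theorem theorem1 {Ω : Type*} [MeasurableSpace Ω] (μ : Measure Ω) [IsProbabilityMeasure μ]
    (L : ℕ) (hL : 1 ≤ L) (lam p α β : ℝ) (hlam : 0 < lam) (hp0 : 0 < p) (hp1 : p < 1)
    (hα : 2 < α) (hβ : 0 < β)
    (N : AlohaNetwork Ω L) (hN : N.HasLaw μ lam p)
    (x D : Plane) (hD : D ≠ x) :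
    (∀ᵐ ω ∂μ, ∃! y, N.IsNFPRelay x D ω y) ∧
    Integrable (N.weightedProgress μ α β x D) μ ∧
    ∫ ω, N.weightedProgress μ α β x D ω ∂μ =
      1 / Real.sqrt lam *
        ∑ k ∈ Finset.range L,
          Real.Gamma ((k : ℝ) + 3 / 2) * (β ^ (2 / α) * contentionConst α) ^ k * p ^ k * (1 - p) /
            ((k.factorial : ℝ) *
              ((1 - p) * Real.pi / 2 + contentionConst α * β ^ (2 / α) * p) ^ ((k : ℝ) + 3 / 2)) := by
  have hex := hN.ae_existsUnique_isNFPRelay hlam hp0.le hp1 hD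
  refine ⟨hex, ?_⟩
  have hΔ := contentionConst_pos hα
  have hq : 0 < 1 - p := by linarith
  have hκ : 0 < lam * (1 - p) := mul_pos hlam hq
  set E := β ^ (2 / α) * contentionConst α with hE
  have hE0 : 0 < E := by positivity
  have hc : 0 ≤ lam * p * E := by positivity
  have hA : 0 < (1 - p) * Real.pi / 2 + E * p := by positivity
  have hY := hN.aemeasurable_nfpRelay hlam hp0.le hp1 hD
  have hφm : Measurable fun y => dist x y * Real.cos (∠ D x y) *
      poissonLt L (lam * p * E * dist x y ^ 2) := by
    have h1 := (continuous_poissonLt L).measurable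
    fun_prop
  have hφ : N.weightedProgress μ α β x D = fun ω => dist x (N.nfpRelay x D ω) *
      Real.cos (∠ D x (N.nfpRelay x D ω)) *
        poissonLt L (lam * p * E * dist x (N.nfpRelay x D ω) ^ 2) := by
    ext ω
    rw [AlohaNetwork.weightedProgress]
    -- The success formula needs distinct endpoints. When the relay is `x`, the default in the
    -- absence of a relay, the distance factor annihilates both sides.
    by_cases hxy : x = N.nfpRelay x D ω
    · rw [← hxy, dist_self, zero_mul, zero_mul, zero_mul]
    · rw [hN.successProb_eq hL hlam hp0 hα hβ hxy]
      congr 2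
      rw [hE]
      ring
  have hnn : 0 ≤ᵐ[μ] N.weightedProgress μ α β x D := by
    rw [hφ]
    filter_upwards [hex] with ω hω
    have h1 := (AlohaNetwork.isNFPRelay_nfpRelay hω.exists).1.2
    exact mul_nonneg (mul_nonneg dist_nonneg (angle_le_pi_div_two_iff.1 h1))
      (poissonLt_nonneg L (by positivity))
  have haem : AEStronglyMeasurable (N.weightedProgress μ α β x D) μ := by
    rw [hφ]
    exact (hφm.comp_aemeasurable hY).aestronglyMeasurable
  have hval : ∫⁻ ω, ENNReal.ofReal (N.weightedProgress μ α β x D ω) ∂μ = ENNReal.ofReal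
      (1 / Real.sqrt lam * ∑ k ∈ Finset.range L,
        Real.Gamma ((k : ℝ) + 3 / 2) * E ^ k * p ^ k * (1 - p) /
          ((k.factorial : ℝ) * ((1 - p) * Real.pi / 2 + E * p) ^ ((k : ℝ) + 3 / 2))) := by
    rw [hφ, ← lintegral_map' (f := fun y => ENNReal.ofReal (dist x y * Real.cos (∠ D x y) *
      poissonLt L (lam * p * E * dist x y ^ 2))) hφm.ennreal_ofReal.aemeasurable hY,
      hN.map_nfpRelay hlam hp0.le hp1 hD, lintegral_nearestForwardLaw hκ hc L hD, Finset.mul_sum]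
    congr 1
    exact Finset.sum_congr rfl fun k _ => mean_progress_rescale hlam hA k _
  refine ⟨⟨haem, ?_⟩, ?_⟩
  · rw [hasFiniteIntegral_iff_ofReal hnn, hval]
    exact ENNReal.ofReal_lt_top
  · rw [integral_eq_lintegral_of_nonneg_ae hnn haem, hval, ENNReal.toReal_ofReal, hE,
      mul_comm (contentionConst α)]
    refine mul_nonneg (by positivity) (Finset.sum_nonneg fun k _ => ?_)
    have h1 : 0 < Real.Gamma ((k : ℝ) + 3 / 2) := Real.Gamma_pos_of_pos (by positivity)
    positivity
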